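/- Let $\mathbf k$ be an algebraically closed field (of any characteristic) and let $G$ be a finite group scheme over $\mathbf k$, with coordinate algebra $\mathscr O(G)$, a finite dimensional commutative Hopf algebra. Let $\mathbf k[G]=\mathscr O(G)^*$ be its group algebra, a cocommutative Hopf algebra. Let $u\rightharpoonup b=\langle S(b_1)b_3,u\rangle b_2$ be the coadjoint action of $\mathbf k[G]$ on $\mathscr O(G)$. Let $D(G)=\mathscr O(G)^{\rm cop}\bowtie\mathbf k[G]$ be the Drinfeld double: it is $\mathscr O(G)^{\rm cop}\otimes\mathbf k[G]$ as a coalgebra, with product $(b\bowtie u)(b'\bowtie u')=b(u_1\rightharpoonup b')\bowtie u_2u'$. For a Hopf algebra $A$, $\operatorname{Rep}(A)$ is the tensor category of finite dimensional representations of $A$. A *tensor subcategory* of it is a full subcategory that contains the unit object and is closed under finite direct sums, subobjects, quotients, tensor products and (left and right) duals; two tensor subcategories are equal if they have the same objects. Put $\mathscr Z(G)=\operatorname{Rep}(D(G))$. *Triples.* For a closed subgroup scheme $L\subseteq G$ let $q_L:\mathscr O(G)\to\mathscr O(L)$ be the restriction, and regard $\mathbf k[L]\subseteq\mathbf k[G]$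 through its transpose. If $K$ is normal, $\mathbf k[G]$ acts on $\mathscr O(K)$ by $u*q_K(b)=q_K(u\rightharpoonup b)$. A triple $(K,H,B)$ consists of two normal closed subgroup schemes $K,H$ of $G$ that centralize each other (that is, $vw=wv$ for all $v\in\mathbf k[H]$, $w\in\mathbf k[K]$) and a Hopf algebra map $B:\mathbf k[H]\to\mathscr O(K)$ that is $G$-equivariant, i.e. $u*B(v)=B(u_1vS(u_2))$ for all $u\in\mathbf k[G]$, $v\in\mathbf k[H]$. *Sections.* For a normal closed subgroup scheme $H$ let $\pi:\mathbf k[G]\to\mathbf k[G/H]=\mathbf k[G]/\mathbf k[G]\mathbf k[H]^+$ be the projection. A section is a convolution invertible linear map $\gamma:\mathbf k[G/H]\to\mathbf k[G]$ with $\pi\gamma=\mathrm{id}$, $\varepsilon\gamma=\varepsilon$, $\gamma(1)=1$ and $\gamma(x_1)\otimes x_2=\gamma(x)_1\otimes\pi(\gamma(x)_2)$ for all $x$. Put $\eta(u)=u_1\gamma^{-1}(\pi(u_2))$ and $\eta^{-1}(u)=\gamma(\pi(u_1))S(u_2)$, where $\gamma^{-1}$ is the convolution inverse of $\gamma$. *The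 algebra $D(K,H,B)$.* Given a triple $(K,H,B)$ and a section $\gamma$ for $H$, put, for $x,y\in\mathbf k[G/H]$ and $a\in\mathscr O(K)$, $$x\cdot a=\gamma(x)*a,\qquad \sigma(x,y)=B\big(\gamma(x_1)\gamma(y_1)\gamma^{-1}(x_2y_2)\big),$$ $$\tau(x)=(B\otimes B)\big(\eta^{-1}(\gamma(x)_1)_1\,\eta(\gamma(x)_2)\otimes\eta^{-1}(\gamma(x)_1)_2\,\eta(\gamma(x)_3)\big)=\tau(x)^1\otimes\tau(x)^2.$$ Let $D(K,H,B)=\mathscr O(K)\otimes\mathbf k[G/H]$, with elements written $a\#x$, with unit $1\#1$, counit $a\#x\mapsto\varepsilon(a)\varepsilon(x)$, multiplication and comultiplication $$(a\#x)(\tilde a\#\tilde x)=a(x_1\cdot\tilde a)\sigma(x_2,\tilde x_1)\#x_3\tilde x_2,\qquad \delta(a\#x)=(a_2\tau(x_1)^1\#x_2)\otimes(a_1\tau(x_1)^2\#x_3),$$ and let $\theta:D(G)\to D(K,H,B)$, $\theta(b\bowtie u)=q_K(b)B(\eta(u_1))\#\pi(u_2)$. **Theorem.** Every normal closed subgroup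 scheme $H$ of $G$ has a section. Choose a section for every triple, in any way. Then for every triple $(K,H,B)$, $D(K,H,B)$ is a Hopf algebra and $\theta$ is a surjective Hopf algebra map. The representations of $D(G)$ that factor through $\theta$ are the objects of a tensor subcategory $\mathscr Z(K,H,B)=\operatorname{Rep}(D(K,H,B))$ of $\mathscr Z(G)$. The assignment $(K,H,B)\mapsto\mathscr Z(K,H,B)$ is a bijection from the set of triples to the set of tensor subcategories of $\mathscr Z(G)=\operatorname{Rep}(D(G))$. -/

import Mathlib

/-!
A finite group scheme `G` over the field `k` is given by its coordinate algebra `O = O(G)`, a finite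
dimensional commutative Hopf algebra over `k`.
-/

universe u

namespace FiniteGroupScheme

open scoped TensorProduct
open Coalgebra WithConv

noncomputable section

/-! ### The group algebra -/

section GroupAlgebra

/-- The group algebra `k[G] = O(G)^*`, with the convolution product. -/
def GroupAlg (k O : Type*) [Field k] [CommRing O] [HopfAlgebra k O] : Type _ :=
  WithConv (O →ₗ[k] k)

variable {k O : Type*} [Field k] [CommRing O] [HopfAlgebra k O]

namespace GroupAlg

instance : Ring (GroupAlg k O) := inferInstanceAs (Ring (WithConv (O →ₗ[k] k)))

instance : Algebra k (GroupAlg k O) := inferInstanceAs (Algebra k (WithConv (O →ₗ[k] k)))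

variable (k O) in
/-- The underlying vector space of `k[G]` is the dual space of `O(G)`. -/
def toDual : GroupAlg k O ≃ₗ[k] Module.Dual k O := WithConv.linearEquiv k (O →ₗ[k] k)

/-- `u a` is the value `⟨a, u⟩` of the canonical pairing of `k[G]` with `O(G)`. -/
instance : CoeFun (GroupAlg k O) (fun _ => O → k) := ⟨fun u => toDual k O u⟩

instance [Module.Finite k O] : Module.Finite k (GroupAlg k O) :=
  Module.Finite.equiv (toDual k O).symm

lemma ext {u v : GroupAlg k O} (h : ∀ a : O, u a = v a) : u = v :=
  (toDual k O).injective (LinearMap.ext h)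

lemma one_apply (a : O) : (1 : GroupAlg k O) a = counit (R := k) a := rfl

lemma mul_apply {ι : Type*} (u v : GroupAlg k O) {a : O} (r : Coalgebra.Repr k a ι) :
    (u * v) a = ∑ i ∈ r.index, u (r.left i) * v (r.right i) := r.convMul_apply _ _

/-- The pairing of `k[G] ⊗ k[G]` with `O(G) ⊗ O(G)`. -/
def pair₂ (k O : Type*) [Field k] [CommRing O] [HopfAlgebra k O] :
    GroupAlg k O ⊗[k] GroupAlg k O →ₗ[k] Module.Dual k (O ⊗[k] O) :=
  TensorProduct.dualDistrib k O O ∘ₗ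
    TensorProduct.map (toDual k O).toLinearMap (toDual k O).toLinearMap

@[simp] lemma pair₂_tmul (u v : GroupAlg k O) (a b : O) :
    pair₂ k O (u ⊗ₜ v) (a ⊗ₜ b) = u a * v b := rfl

lemma pair₂_mul {ι κ : Type*} (s t : GroupAlg k O ⊗[k] GroupAlg k O) {a b : O}
    (r : Coalgebra.Repr k a ι) (r' : Coalgebra.Repr k b κ) :
    pair₂ k O (s * t) (a ⊗ₜ b) = ∑ i ∈ r.index, ∑ j ∈ r'.index,
      pair₂ k O s (r.left i ⊗ₜ r'.left j) * pair₂ k O t (r.right i ⊗ₜ r'.right j) := by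
  induction s with
  | zero => simp
  | add x y hx hy => simp only [add_mul, map_add, LinearMap.add_apply, hx, hy,
      Finset.sum_add_distrib]
  | tmul u v =>
    induction t with
    | zero => simp
    | add x y hx hy => simp only [mul_add, map_add, LinearMap.add_apply, hx, hy,
        Finset.sum_add_distrib]
    | tmul w z =>
      simp only [Algebra.TensorProduct.tmul_mul_tmul, pair₂_tmul, mul_apply _ _ r,
        mul_apply _ _ r', Finset.sum_mul_sum]
      exact Finset.sum_congr rfl fun i _ => Finset.sum_congr rfl fun j _ => by ring

/-- The pairing of `k[G] ⊗ (k[G] ⊗ k[G])` with `O(G) ⊗ (O(G) ⊗ O(G))`. -/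
def pair₃ (k O : Type*) [Field k] [CommRing O] [HopfAlgebra k O] :
    GroupAlg k O ⊗[k] (GroupAlg k O ⊗[k] GroupAlg k O) →ₗ[k]
      Module.Dual k (O ⊗[k] (O ⊗[k] O)) :=
  TensorProduct.dualDistrib k O (O ⊗[k] O) ∘ₗ
    TensorProduct.map (toDual k O).toLinearMap (pair₂ k O)

@[simp] lemma pair₃_tmul (u : GroupAlg k O) (t : GroupAlg k O ⊗[k] GroupAlg k O) (a : O)
    (s : O ⊗[k] O) : pair₃ k O (u ⊗ₜ t) (a ⊗ₜ s) = u a * pair₂ k O t s := rfl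

variable [Module.Finite k O]

variable (k O) in
/-- As `O(G)` is finite dimensional, the pairing `pair₂` is perfect. -/
def pair₂Equiv : GroupAlg k O ⊗[k] GroupAlg k O ≃ₗ[k] Module.Dual k (O ⊗[k] O) :=
  (TensorProduct.congr (toDual k O) (toDual k O)).trans (TensorProduct.dualDistribEquiv k O O)

lemma pair₂_ext {s t : GroupAlg k O ⊗[k] GroupAlg k O}
    (h : ∀ a b : O, pair₂ k O s (a ⊗ₜ b) = pair₂ k O t (a ⊗ₜ b)) : s = t :=
  (pair₂Equiv k O).injective (TensorProduct.ext' h)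

lemma pair₃_ext {s t : GroupAlg k O ⊗[k] (GroupAlg k O ⊗[k] GroupAlg k O)}
    (h : ∀ a b c : O, pair₃ k O s (a ⊗ₜ (b ⊗ₜ c)) = pair₃ k O t (a ⊗ₜ (b ⊗ₜ c))) : s = t :=
  ((TensorProduct.congr (toDual k O) (pair₂Equiv k O)).trans
    (TensorProduct.dualDistribEquiv k O (O ⊗[k] O))).injective
    (TensorProduct.ext (LinearMap.ext fun a => TensorProduct.ext' fun b c => h a b c))

/-- The comultiplication of `k[G]`, the transpose of the multiplication of `O(G)`:
`⟨a ⊗ b, Δ(u)⟩ = ⟨a b, u⟩`. -/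
def comulAux : GroupAlg k O →ₗ[k] GroupAlg k O ⊗[k] GroupAlg k O :=
  (pair₂Equiv k O).symm.toLinearMap ∘ₗ (LinearMap.mul' k O).dualMap ∘ₗ (toDual k O).toLinearMap

/-- The counit of `k[G]`, evaluation at `1`. -/
def counitAux : GroupAlg k O →ₗ[k] k := LinearMap.applyₗ (1 : O) ∘ₗ (toDual k O).toLinearMap

@[simp] lemma counitAux_apply (u : GroupAlg k O) : counitAux u = u 1 := rfl

lemma pair₂_comulAux (u : GroupAlg k O) (a b : O) :
    pair₂ k O (comulAux u) (a ⊗ₜ b) = u (a * b) := by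
  have h : pair₂Equiv k O (comulAux u) = (LinearMap.mul' k O).dualMap (toDual k O u) := by
    simp [comulAux]
  exact congr($h (a ⊗ₜ b))

instance : Coalgebra k (GroupAlg k O) where
  comul := comulAux
  counit := counitAux
  coassoc := by
    refine LinearMap.ext fun u => pair₃_ext fun a b c => ?_
    have h1 (t : GroupAlg k O ⊗[k] GroupAlg k O) :
        pair₃ k O (TensorProduct.assoc k _ _ _ (comulAux.rTensor _ t)) (a ⊗ₜ (b ⊗ₜ c)) =
          pair₂ k O t ((a * b) ⊗ₜ c) := by
      induction t with
      | zero => simp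
      | add x y hx hy => simp_all
      | tmul v w =>
        have h2 (s : GroupAlg k O ⊗[k] GroupAlg k O) :
            pair₃ k O (TensorProduct.assoc k _ _ _ (s ⊗ₜ w)) (a ⊗ₜ (b ⊗ₜ c)) =
              pair₂ k O s (a ⊗ₜ b) * w c := by
          induction s with
          | zero => simp
          | add x y hx hy => simp_all [TensorProduct.add_tmul, add_mul]
          | tmul v w => simp [mul_assoc]
        simp [h2, pair₂_comulAux]
    have h3 (t : GroupAlg k O ⊗[k] GroupAlg k O) :
        pair₃ k O (comulAux.lTensor _ t) (a ⊗ₜ (b ⊗ₜ c)) = pair₂ k O t (a ⊗ₜ (b * c)) := by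
      induction t with
      | zero => simp
      | add x y hx hy => simp_all
      | tmul v w => simp [pair₂_comulAux]
    simp [h1, h3, pair₂_comulAux, mul_assoc]
  rTensor_counit_comp_comul := by
    refine LinearMap.ext fun u => (TensorProduct.lid k _).injective (ext fun a => ?_)
    have h (t : GroupAlg k O ⊗[k] GroupAlg k O) :
        (TensorProduct.lid k _ (counitAux.rTensor _ t)) a = pair₂ k O t (1 ⊗ₜ a) := by
      induction t with
      | zero => simp
      | add x y hx hy => simp_all
      | tmul v w => simp
    simp [h, pair₂_comulAux]
  lTensor_counit_comp_comul := by
    refine LinearMap.ext fun u => (TensorProduct.rid k _).injective (ext fun a => ?_)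
    have h (t : GroupAlg k O ⊗[k] GroupAlg k O) :
        (TensorProduct.rid k _ (counitAux.lTensor _ t)) a = pair₂ k O t (a ⊗ₜ 1) := by
      induction t with
      | zero => simp
      | add x y hx hy => simp_all
      | tmul v w => simp [mul_comm]
    simp [h, pair₂_comulAux]

lemma counit_apply (u : GroupAlg k O) : counit (R := k) u = u 1 := rfl

lemma pair₂_comul (u : GroupAlg k O) (a b : O) :
    pair₂ k O (comul u) (a ⊗ₜ b) = u (a * b) := pair₂_comulAux u a b

/-- The comultiplication of `k[G]` in Sweedler form. -/
lemma apply_mul {ι : Type*} {u : GroupAlg k O} (r : Coalgebra.Repr k u ι) (a b : O) :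
    u (a * b) = ∑ i ∈ r.index, r.left i a * r.right i b := by
  rw [← pair₂_comul, ← r.eq]; simp

instance : IsCocomm k (GroupAlg k O) where
  comm_comp_comul := by
    refine LinearMap.ext fun u => pair₂_ext fun a b => ?_
    have h (t : GroupAlg k O ⊗[k] GroupAlg k O) :
        pair₂ k O (TensorProduct.comm k _ _ t) (a ⊗ₜ b) = pair₂ k O t (b ⊗ₜ a) := by
      induction t with
      | zero => simp
      | add x y hx hy => simp_all
      | tmul v w => simp [mul_comm]
    simp [h, pair₂_comul, mul_comm]

instance : Bialgebra k (GroupAlg k O) :=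
  Bialgebra.mk' k (GroupAlg k O)
    (by simp [counit_apply, one_apply])
    (fun {u v} => by
      rw [counit_apply, mul_apply u v ⟨{()}, fun _ => 1, fun _ => 1, by
        simp [Algebra.TensorProduct.one_def]⟩]
      simp [counit_apply])
    (pair₂_ext fun a b => by simp [pair₂_comul, Algebra.TensorProduct.one_def, one_apply])
    (fun {u v} => pair₂_ext fun a b => by
      rw [pair₂_mul _ _ (ℛ k a) (ℛ k b), pair₂_comul, mul_apply u v ((ℛ k a).mul (ℛ k b))]
      simp [pair₂_comul, Finset.sum_product])

/-- The antipode of `k[G]`, the transpose of the antipode of `O(G)`. -/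
def antipodeAux : GroupAlg k O →ₗ[k] GroupAlg k O :=
  (toDual k O).symm.toLinearMap ∘ₗ (HopfAlgebra.antipode k (A := O)).dualMap ∘ₗ
    (toDual k O).toLinearMap

@[simp] lemma antipodeAux_apply (u : GroupAlg k O) (a : O) :
    (antipodeAux u) a = u (HopfAlgebra.antipode k a) := by simp [antipodeAux]

lemma sum_apply {ι : Type*} (s : Finset ι) (f : ι → GroupAlg k O) (a : O) :
    (∑ i ∈ s, f i) a = ∑ i ∈ s, (f i) a := by
  rw [map_sum, LinearMap.sum_apply]

lemma algebraMap_apply (c : k) (a : O) :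
    (algebraMap k (GroupAlg k O) c) a = c * counit (R := k) a := by
  rw [Algebra.algebraMap_eq_smul_one, map_smul, LinearMap.smul_apply, one_apply, smul_eq_mul]

instance : HopfAlgebra k (GroupAlg k O) where
  antipode := antipodeAux
  mul_antipode_rTensor_comul := by
    refine LinearMap.ext fun u => ext fun a => ?_
    have h : u (∑ j ∈ (ℛ k a).index,
        HopfAlgebra.antipode k ((ℛ k a).left j) * (ℛ k a).right j) = counit (R := k) a * u 1 := by
      rw [HopfAlgebra.sum_antipode_mul_eq_smul, map_smul, smul_eq_mul]
    simp only [map_sum, apply_mul (ℛ k u)] at h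
    rw [Finset.sum_comm] at h
    rw [LinearMap.comp_apply, LinearMap.comp_apply, ← (ℛ k u).eq]
    simpa [mul_apply _ _ (ℛ k a), counit_apply, sum_apply, algebraMap_apply, mul_comm] using h
  mul_antipode_lTensor_comul := by
    refine LinearMap.ext fun u => ext fun a => ?_
    have h : u (∑ j ∈ (ℛ k a).index,
        (ℛ k a).left j * HopfAlgebra.antipode k ((ℛ k a).right j)) = counit (R := k) a * u 1 := by
      rw [HopfAlgebra.sum_mul_antipode_eq_smul, map_smul, smul_eq_mul]
    simp only [map_sum, apply_mul (ℛ k u)] at h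
    rw [Finset.sum_comm] at h
    rw [LinearMap.comp_apply, LinearMap.comp_apply, ← (ℛ k u).eq]
    simpa [mul_apply _ _ (ℛ k a), counit_apply, sum_apply, algebraMap_apply, mul_comm] using h

lemma antipode_apply (u : GroupAlg k O) (a : O) :
    (HopfAlgebra.antipode k u) a = u (HopfAlgebra.antipode k a) := antipodeAux_apply u a

end GroupAlg

end GroupAlgebra

/-! ### The adjoint coaction and the coadjoint action -/

section Coadjoint

variable {k O : Type*} [Field k] [CommRing O] [HopfAlgebra k O]

variable (k O) in
/-- The right adjoint coaction `b ↦ b₂ ⊗ S(b₁) b₃` of `O(G)` on itself, the comorphism of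
`G × G → G`, `(g, f) ↦ f⁻¹ g f`.  It is written as the convolution product
`f⁻¹ * g * f` of the two universal points `g = (b ↦ b ⊗ 1)` and `f = (b ↦ 1 ⊗ b)`. -/
def adCoact : O →ₐ[k] O ⊗[k] O :=
  (toConv (Algebra.TensorProduct.includeRight.comp (HopfAlgebra.antipodeAlgHom k O)) *
    toConv (Algebra.TensorProduct.includeLeft : O →ₐ[k] O ⊗[k] O) *
    toConv (Algebra.TensorProduct.includeRight : O →ₐ[k] O ⊗[k] O)).ofConv

/-- The slice map `m ⊗ a ↦ ⟨a, u⟩ m` for `u ∈ k[G]`. -/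
def slice (M : Type*) [AddCommGroup M] [Module k M] :
    GroupAlg k O →ₗ[k] M ⊗[k] O →ₗ[k] M where
  toFun u := (TensorProduct.rid k M).toLinearMap ∘ₗ (GroupAlg.toDual k O u).lTensor M
  map_add' u v := by ext; simp
  map_smul' c u := by ext; simp

@[simp] lemma slice_tmul {M : Type*} [AddCommGroup M] [Module k M] (u : GroupAlg k O) (m : M)
    (a : O) : slice M u (m ⊗ₜ a) = u a • m := by simp [slice]

/-- The linear action `u · m = ⟨m₍₁₎, u⟩ m₍₀₎` of `k[G]` on `M` that corresponds to a coaction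
`m ↦ m₍₀₎ ⊗ m₍₁₎` of `O(G)` on `M`. -/
def actOfCoact {M : Type*} [AddCommGroup M] [Module k M] (ρ : M →ₗ[k] M ⊗[k] O) :
    GroupAlg k O →ₗ[k] Module.End k M :=
  (LinearMap.lcomp k M ρ) ∘ₗ slice M

lemma actOfCoact_apply {M : Type*} [AddCommGroup M] [Module k M] (ρ : M →ₗ[k] M ⊗[k] O)
    (u : GroupAlg k O) (m : M) : actOfCoact ρ u m = slice M u (ρ m) := rfl

variable (k O) in
/-- The left coadjoint action `u ⇀ b = ⟨S(b₁) b₃, u⟩ b₂` of `k[G]` on `O(G)`. -/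
def coadj : GroupAlg k O →ₗ[k] Module.End k O := actOfCoact (adCoact k O).toLinearMap

lemma coadj_apply (u : GroupAlg k O) (b : O) : coadj k O u b = slice O u (adCoact k O b) := rfl

lemma conj_conj {R : Type*} [CommRing R] [Bialgebra k R] (a b c : WithConv (O →ₐ[k] R)) :
    c⁻¹ * (b⁻¹ * a * b) * c = (b * c)⁻¹ * a * (b * c) := by group

lemma conj_mul' {R : Type*} [CommRing R] [Bialgebra k R] (a b c : WithConv (O →ₐ[k] R)) :
    c⁻¹ * (a * b) * c = c⁻¹ * a * c * (c⁻¹ * b * c) := by group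

lemma comp_conv {R S : Type*} [CommRing R] [Algebra k R] [CommRing S] [Algebra k S]
    (h : R →ₐ[k] S) (f g : WithConv (O →ₐ[k] R)) :
    toConv (h.comp (f * g).ofConv) = toConv (h.comp f.ofConv) * toConv (h.comp g.ofConv) :=
  congrArg toConv (AlgHom.comp_convMul_distrib h f g)

lemma toConv_comp_adCoact {R : Type*} [CommRing R] [Bialgebra k R] (h : O ⊗[k] O →ₐ[k] R) :
    toConv (h.comp (adCoact k O)) =
      (toConv (h.comp Algebra.TensorProduct.includeRight))⁻¹ *
      toConv (h.comp Algebra.TensorProduct.includeLeft) *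
      toConv (h.comp Algebra.TensorProduct.includeRight) := by
  rw [adCoact, comp_conv, comp_conv]
  rfl

variable (k O) in
lemma includeLeft_conv_includeRight :
    toConv (Algebra.TensorProduct.includeLeft : O →ₐ[k] O ⊗[k] O) *
      toConv (Algebra.TensorProduct.includeRight : O →ₐ[k] O ⊗[k] O) =
      toConv (Bialgebra.comulAlgHom k O) := by
  refine WithConv.ext (AlgHom.ext fun b => ?_)
  have := AlgHom.convMul_apply (toConv (Algebra.TensorProduct.includeLeft : O →ₐ[k] O ⊗[k] O))
    (toConv (Algebra.TensorProduct.includeRight : O →ₐ[k] O ⊗[k] O)) b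
  refine this.trans ?_
  rw [← (ℛ k b).eq]
  simp
  exact (ℛ k b).eq

variable (k O) in
lemma adCoact_coassoc :
    (Algebra.TensorProduct.assoc k k k O O O).toAlgHom.comp
      ((Algebra.TensorProduct.map (adCoact k O) (AlgHom.id k O)).comp (adCoact k O)) =
    (Algebra.TensorProduct.map (AlgHom.id k O) (Bialgebra.comulAlgHom k O)).comp
      (adCoact k O) := by
  apply toConv_injective
  let i₁ : O →ₐ[k] O ⊗[k] (O ⊗[k] O) := Algebra.TensorProduct.includeLeft
  let j : O ⊗[k] O →ₐ[k] O ⊗[k] (O ⊗[k] O) := Algebra.TensorProduct.includeRight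
  let e : O ⊗[k] O →ₐ[k] O ⊗[k] (O ⊗[k] O) :=
    (Algebra.TensorProduct.assoc k k k O O O).toAlgHom.comp Algebra.TensorProduct.includeLeft
  let i₂ : O →ₐ[k] O ⊗[k] (O ⊗[k] O) := j.comp Algebra.TensorProduct.includeLeft
  let i₃ : O →ₐ[k] O ⊗[k] (O ⊗[k] O) := j.comp Algebra.TensorProduct.includeRight
  rw [← AlgHom.comp_assoc]
  refine (toConv_comp_adCoact (k := k) (O := O) (R := O ⊗[k] (O ⊗[k] O)) _).trans
    (Eq.trans ?_ (toConv_comp_adCoact (k := k) (O := O) (R := O ⊗[k] (O ⊗[k] O)) _).symm)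
  have h1 : ((Algebra.TensorProduct.assoc k k k O O O).toAlgHom.comp
      (Algebra.TensorProduct.map (adCoact k O) (AlgHom.id k O))).comp
      Algebra.TensorProduct.includeRight = i₃ := by
    ext b; simp [i₃, j, Algebra.TensorProduct.one_def]
  have h2 : ((Algebra.TensorProduct.assoc k k k O O O).toAlgHom.comp
      (Algebra.TensorProduct.map (adCoact k O) (AlgHom.id k O))).comp
      Algebra.TensorProduct.includeLeft = e.comp (adCoact k O) := by
    ext b; simp [e]
  have h3 : (Algebra.TensorProduct.map (AlgHom.id k O) (Bialgebra.comulAlgHom k O)).comp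
      Algebra.TensorProduct.includeRight = j.comp (Bialgebra.comulAlgHom k O) := by
    ext b; simp [j]
  have h4 : (Algebra.TensorProduct.map (AlgHom.id k O) (Bialgebra.comulAlgHom k O)).comp
      Algebra.TensorProduct.includeLeft = i₁ := by
    ext b; simp [i₁]
  have h5 : toConv (j.comp (Bialgebra.comulAlgHom k O)) = toConv i₂ * toConv i₃ := by
    have := comp_conv j (toConv Algebra.TensorProduct.includeLeft)
      (toConv Algebra.TensorProduct.includeRight)
    rwa [includeLeft_conv_includeRight] at this
  have h6 : e.comp Algebra.TensorProduct.includeRight = i₂ := by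
    ext b; simp [e, i₂, j]
  have h7 : e.comp Algebra.TensorProduct.includeLeft = i₁ := by
    ext b; simp [e, i₁, Algebra.TensorProduct.one_def]
  have h8 := toConv_comp_adCoact (k := k) (O := O) (R := O ⊗[k] (O ⊗[k] O)) e
  rw [h6, h7] at h8
  rw [h1, h2, h3, h4, h5, h8]
  exact conj_conj (R := O ⊗[k] (O ⊗[k] O)) _ _ _

variable (k O) in
lemma adCoact_counit :
    (Algebra.TensorProduct.map (AlgHom.id k O) (Bialgebra.counitAlgHom k O)).comp (adCoact k O) =
      (Algebra.TensorProduct.rid k k O).symm := by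
  apply toConv_injective
  rw [toConv_comp_adCoact]
  have h1 : toConv ((Algebra.TensorProduct.map (AlgHom.id k O) (Bialgebra.counitAlgHom k O)).comp
      Algebra.TensorProduct.includeRight) = 1 := by
    refine WithConv.ext (AlgHom.ext fun b => ?_)
    simp [AlgHom.convOne_def, Algebra.ofId_apply, Algebra.algebraMap_eq_smul_one,
      Algebra.TensorProduct.one_def, TensorProduct.smul_tmul']
    rw [TensorProduct.smul_tmul, smul_eq_mul, mul_one]
  rw [h1]
  simp
  ext b
  simp

/-- The adjoint coaction is compatible with the comultiplication: conjugation is a group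
homomorphism. -/
lemma adCoact_comul (b : O) :
    (comul.rTensor O (adCoact k O b) : (O ⊗[k] O) ⊗[k] O) =
      Algebra.TensorProduct.lift
        ((Algebra.TensorProduct.map Algebra.TensorProduct.includeLeft (AlgHom.id k O)).comp
          (adCoact k O))
        ((Algebra.TensorProduct.map Algebra.TensorProduct.includeRight (AlgHom.id k O)).comp
          (adCoact k O)) (fun _ _ => Commute.all _ _) (comul b) := by
  have h : toConv ((Algebra.TensorProduct.map (Bialgebra.comulAlgHom k O) (AlgHom.id k O)).comp
      (adCoact k O)) =
      toConv ((Algebra.TensorProduct.map (Algebra.TensorProduct.includeLeft : O →ₐ[k] O ⊗[k] O)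
        (AlgHom.id k O)).comp (adCoact k O)) *
      toConv ((Algebra.TensorProduct.map (Algebra.TensorProduct.includeRight : O →ₐ[k] O ⊗[k] O)
        (AlgHom.id k O)).comp (adCoact k O)) := by
    let l : O ⊗[k] O →ₐ[k] (O ⊗[k] O) ⊗[k] O := Algebra.TensorProduct.includeLeft
    let i₃ : O →ₐ[k] (O ⊗[k] O) ⊗[k] O := Algebra.TensorProduct.includeRight
    rw [toConv_comp_adCoact, toConv_comp_adCoact, toConv_comp_adCoact]
    have h1 (f : O →ₐ[k] O ⊗[k] O) : (Algebra.TensorProduct.map f (AlgHom.id k O)).comp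
        Algebra.TensorProduct.includeRight = i₃ := by
      ext b; simp [i₃]
    have h2 (f : O →ₐ[k] O ⊗[k] O) : (Algebra.TensorProduct.map f (AlgHom.id k O)).comp
        Algebra.TensorProduct.includeLeft = l.comp f := by
      ext b; simp [l]
    have h3 : toConv (l.comp (Bialgebra.comulAlgHom k O)) =
        toConv (l.comp Algebra.TensorProduct.includeLeft) *
        toConv (l.comp Algebra.TensorProduct.includeRight) := by
      have := comp_conv l (toConv Algebra.TensorProduct.includeLeft)
        (toConv Algebra.TensorProduct.includeRight)
      rwa [includeLeft_conv_includeRight] at this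
    simp only [h1, h2, h3]
    exact conj_mul' (R := (O ⊗[k] O) ⊗[k] O) _ _ _
  have h' := congr($(h).ofConv b)
  exact h'.trans (AlgHom.convMul_apply _ _ b)

lemma slice_mul {R : Type*} [CommRing R] [Algebra k R] [Module.Finite k O] {ι : Type*}
    {u : GroupAlg k O} (r : Coalgebra.Repr k u ι) (s t : R ⊗[k] O) :
    slice R u (s * t) = ∑ i ∈ r.index, slice R (r.left i) s * slice R (r.right i) t := by
  induction s with
  | zero => simp
  | add x y hx hy => simp only [add_mul, map_add, hx, hy, Finset.sum_add_distrib]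
  | tmul a b =>
    induction t with
    | zero => simp
    | add x y hx hy => simp only [mul_add, map_add, hx, hy, Finset.sum_add_distrib]
    | tmul c d =>
      simp [GroupAlg.apply_mul r, Finset.sum_smul, smul_smul, mul_comm]

lemma slice_rTensor {M N : Type*} [AddCommGroup M] [Module k M] [AddCommGroup N] [Module k N]
    (f : M →ₗ[k] N) (u : GroupAlg k O) (t : M ⊗[k] O) :
    slice N u (f.rTensor O t) = f (slice M u t) := by
  induction t with
  | zero => simp
  | add x y hx hy => simp only [map_add, hx, hy]
  | tmul a b => simp

lemma coadj_mul [Module.Finite k O] {ι : Type*} {u : GroupAlg k O} (r : Coalgebra.Repr k u ι)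
    (b c : O) : coadj k O u (b * c) =
      ∑ i ∈ r.index, coadj k O (r.left i) b * coadj k O (r.right i) c := by
  simp [coadj_apply, slice_mul r]

lemma coadj_one [Module.Finite k O] (u : GroupAlg k O) :
    coadj k O u 1 = counit (R := k) u • (1 : O) := by
  rw [coadj_apply, map_one, Algebra.TensorProduct.one_def, slice_tmul, GroupAlg.counit_apply]

lemma counit_coadj [Module.Finite k O] (u : GroupAlg k O) (b : O) :
    counit (R := k) (coadj k O u b) = counit (R := k) u * counit (R := k) b := by
  have h : (Algebra.TensorProduct.map (Bialgebra.counitAlgHom k O) (AlgHom.id k O)).comp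
      (adCoact k O) = Algebra.TensorProduct.includeLeft.comp (Bialgebra.counitAlgHom k O) := by
    apply toConv_injective
    refine (toConv_comp_adCoact _).trans ?_
    have h1 : toConv ((Algebra.TensorProduct.map (Bialgebra.counitAlgHom k O)
        (AlgHom.id k O)).comp Algebra.TensorProduct.includeLeft) = 1 := by
      refine WithConv.ext (AlgHom.ext fun b => ?_)
      simp [AlgHom.convOne_def, Algebra.ofId_apply, Algebra.algebraMap_eq_smul_one,
        TensorProduct.smul_tmul', Algebra.TensorProduct.one_def]
    have h2 : toConv ((Algebra.TensorProduct.includeLeft : k →ₐ[k] k ⊗[k] O).comp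
        (Bialgebra.counitAlgHom k O)) = 1 := by
      refine WithConv.ext (AlgHom.ext fun b => ?_)
      simp [AlgHom.convOne_def, Algebra.ofId_apply, Algebra.algebraMap_eq_smul_one,
        TensorProduct.smul_tmul', Algebra.TensorProduct.one_def]
    rw [h1, h2]
    simp
  have h' : slice k u ((counit (R := k) (A := O)).rTensor O (adCoact k O b)) =
      slice k u (counit (R := k) b ⊗ₜ 1) := congr(slice k u ($h b))
  rw [slice_rTensor, slice_tmul] at h'
  rw [coadj_apply, h', GroupAlg.counit_apply, smul_eq_mul]

lemma comul_coadj [Module.Finite k O] {ι κ : Type*} {u : GroupAlg k O}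
    (r : Coalgebra.Repr k u ι) {b : O} (q : Coalgebra.Repr k b κ) :
    comul (R := k) (coadj k O u b) = ∑ i ∈ r.index, ∑ j ∈ q.index,
      coadj k O (r.left i) (q.left j) ⊗ₜ[k] coadj k O (r.right i) (q.right j) := by
  rw [coadj_apply, ← slice_rTensor, adCoact_comul, ← q.eq]
  simp only [map_sum, Algebra.TensorProduct.lift_tmul, slice_mul r]
  rw [Finset.sum_comm]
  refine Finset.sum_congr rfl fun i _ => Finset.sum_congr rfl fun j _ => ?_
  have h1 : slice (O ⊗[k] O) (r.left i) (((Algebra.TensorProduct.map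
      Algebra.TensorProduct.includeLeft (AlgHom.id k O)).comp (adCoact k O)) (q.left j)) =
      coadj k O (r.left i) (q.left j) ⊗ₜ 1 :=
    slice_rTensor (Algebra.TensorProduct.includeLeft : O →ₐ[k] O ⊗[k] O).toLinearMap _ _
  have h2 : slice (O ⊗[k] O) (r.right i) (((Algebra.TensorProduct.map
      Algebra.TensorProduct.includeRight (AlgHom.id k O)).comp (adCoact k O)) (q.right j)) =
      1 ⊗ₜ coadj k O (r.right i) (q.right j) :=
    slice_rTensor (Algebra.TensorProduct.includeRight : O →ₐ[k] O ⊗[k] O).toLinearMap _ _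
  rw [h1, h2]
  simp

/-- A coassociative and counital coaction of `O(G)` gives an action of `k[G]`. -/
def actAlgHom {M : Type*} [AddCommGroup M] [Module k M] (ρ : M →ₗ[k] M ⊗[k] O)
    (h₁ : (TensorProduct.assoc k M O O).toLinearMap ∘ₗ ρ.rTensor O ∘ₗ ρ = comul.lTensor M ∘ₗ ρ)
    (h₂ : (TensorProduct.rid k M).toLinearMap ∘ₗ counit.lTensor M ∘ₗ ρ = LinearMap.id) :
    GroupAlg k O →ₐ[k] Module.End k M :=
  AlgHom.ofLinearMap (actOfCoact ρ) h₂
    (fun u v => by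
      have key (t : M ⊗[k] O) : slice M (u * v) t = slice M u (slice (M ⊗[k] O) v
          ((TensorProduct.assoc k M O O).symm (comul.lTensor M t))) := by
        induction t with
        | zero => simp
        | add x y hx hy => simp only [map_add, hx, hy]
        | tmul m a =>
          rw [LinearMap.lTensor_tmul, slice_tmul, GroupAlg.mul_apply u v (ℛ k a), ← (ℛ k a).eq]
          simp [TensorProduct.tmul_sum, Finset.sum_smul, smul_smul, mul_comm]
      refine LinearMap.ext fun m => ?_
      have h : (TensorProduct.assoc k M O O).symm (comul.lTensor M (ρ m)) = ρ.rTensor O (ρ m) := by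
        rw [LinearEquiv.symm_apply_eq]
        exact congr($h₁ m).symm
      rw [actOfCoact_apply, key, h, slice_rTensor]
      rfl)

variable (k O) in
/-- The coadjoint action is an action of the algebra `k[G]`. -/
def coadjAlgHom : GroupAlg k O →ₐ[k] Module.End k O :=
  actAlgHom (adCoact k O).toLinearMap
    congr(($(adCoact_coassoc k O)).toLinearMap)
    (LinearMap.ext fun b => by
      have h : counit.lTensor O (adCoact k O b) = (Algebra.TensorProduct.rid k k O).symm b :=
        congr($(adCoact_counit k O) b)
      simp [h])

@[simp] lemma coadjAlgHom_apply (u : GroupAlg k O) : coadjAlgHom k O u = coadj k O u := rfl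

end Coadjoint

/-! ### The Drinfeld double -/

/-- The underlying vector space `O(G) ⊗ k[G]` of the Drinfeld double
`D(G) = O(G)^cop ⋈ k[G]`. -/
def Double (k O : Type*) [Field k] [CommRing O] [HopfAlgebra k O] : Type _ :=
  O ⊗[k] GroupAlg k O

namespace Double

variable {k O : Type*} [Field k] [CommRing O] [HopfAlgebra k O]

instance : AddCommGroup (Double k O) := inferInstanceAs (AddCommGroup (O ⊗[k] GroupAlg k O))

instance : Module k (Double k O) := inferInstanceAs (Module k (O ⊗[k] GroupAlg k O))

instance [Module.Finite k O] : Module.Finite k (Double k O) :=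
  inferInstanceAs (Module.Finite k (O ⊗[k] GroupAlg k O))

/-- The element `b ⋈ u` of `D(G)`. -/
def mk (b : O) (u : GroupAlg k O) : Double k O := b ⊗ₜ[k] u

variable [Module.Finite k O]

/-- Left multiplication by `b ⋈ 1`. -/
def opL : O →ₐ[k] Module.End k (O ⊗[k] GroupAlg k O) := Algebra.lsmul k k (O ⊗[k] GroupAlg k O)

lemma opL_tmul (b c : O) (w : GroupAlg k O) : opL b (c ⊗ₜ[k] w) = (b * c) ⊗ₜ w := rfl

/-- Left multiplication by `1 ⋈ u`, that is `c ⊗ w ↦ (u₁ ⇀ c) ⊗ u₂ w`. -/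
def opU : GroupAlg k O →ₐ[k] Module.End k (O ⊗[k] GroupAlg k O) :=
  (Module.endTensorEndAlgHom (R := k) (S := k) (A := k) (M := O) (N := GroupAlg k O)).comp
    ((Algebra.TensorProduct.map (coadjAlgHom k O) (Algebra.lmul k (GroupAlg k O))).comp
      (Bialgebra.comulAlgHom k (GroupAlg k O)))

lemma opU_tmul {ι : Type*} {u : GroupAlg k O} (r : Coalgebra.Repr k u ι) (c : O)
    (w : GroupAlg k O) : opU u (c ⊗ₜ[k] w) =
      ∑ i ∈ r.index, coadj k O (r.left i) c ⊗ₜ (r.right i * w) := by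
  simp only [opU, AlgHom.comp_apply, Bialgebra.comulAlgHom_apply, ← r.eq, map_sum,
    LinearMap.sum_apply]
  rfl

lemma opU_opL {ι : Type*} {u : GroupAlg k O} (r : Coalgebra.Repr k u ι) (b : O) :
    opU u * opL b = ∑ i ∈ r.index, opL (coadj k O (r.left i) b) * opU (r.right i) := by
  refine TensorProduct.ext' fun c w => ?_
  have h := Coalgebra.sum_tmul_tmul_eq r (fun i => ℛ k (r.left i)) (fun i => ℛ k (r.right i))
  let Ψ : GroupAlg k O ⊗[k] (GroupAlg k O ⊗[k] GroupAlg k O) →ₗ[k] O ⊗[k] GroupAlg k O :=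
    (LinearMap.mul' k O).rTensor (GroupAlg k O) ∘ₗ
      (TensorProduct.assoc k O O (GroupAlg k O)).symm.toLinearMap ∘ₗ
      TensorProduct.map ((coadj k O).flip b)
        (TensorProduct.map ((coadj k O).flip c) (LinearMap.mulRight k w))
  have hΨ := congrArg Ψ h
  simp only [Ψ, map_sum, LinearMap.comp_apply, TensorProduct.map_tmul, LinearEquiv.coe_coe,
    TensorProduct.assoc_symm_tmul, LinearMap.rTensor_tmul, LinearMap.mul'_apply,
    LinearMap.flip_apply, LinearMap.mulRight_apply] at hΨ
  simp only [Module.End.mul_apply, LinearMap.sum_apply, opL_tmul, opU_tmul r, coadj_mul (ℛ k _),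
    TensorProduct.sum_tmul, opU_tmul (ℛ k _), map_sum]
  exact hΨ

/-- The multiplication `(b ⋈ u)(c ⋈ w) = b (u₁ ⇀ c) ⋈ u₂ w`. -/
def mulAux : O ⊗[k] GroupAlg k O →ₗ[k] Module.End k (O ⊗[k] GroupAlg k O) :=
  TensorProduct.lift ((LinearMap.mul k (Module.End k (O ⊗[k] GroupAlg k O))).compl₁₂
    opL.toLinearMap opU.toLinearMap)

lemma mulAux_tmul (b : O) (u : GroupAlg k O) : mulAux (b ⊗ₜ[k] u) = opL b * opU u := by
  simp [mulAux]

lemma mulAux_mulAux (x y : O ⊗[k] GroupAlg k O) :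
    mulAux (mulAux x y) = mulAux x * mulAux y := by
  have hL (b : O) (z : O ⊗[k] GroupAlg k O) : mulAux (opL b z) = opL b * mulAux z := by
    induction z with
    | zero => simp
    | add x y hx hy => simp only [map_add, hx, hy, mul_add]
    | tmul c w => rw [opL_tmul, mulAux_tmul, mulAux_tmul, map_mul, mul_assoc]
  have hU (u : GroupAlg k O) (z : O ⊗[k] GroupAlg k O) : mulAux (opU u z) = opU u * mulAux z := by
    induction z with
    | zero => simp
    | add x y hx hy => simp only [map_add, hx, hy, mul_add]
    | tmul c w =>
      rw [opU_tmul (ℛ k u), mulAux_tmul, ← mul_assoc, opU_opL (ℛ k u)]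
      simp only [map_sum, mulAux_tmul, map_mul, Finset.sum_mul, mul_assoc]
  induction x with
  | zero => simp
  | add x z hx hz => simp only [map_add, LinearMap.add_apply, hx, hz, add_mul]
  | tmul b u => rw [mulAux_tmul, Module.End.mul_apply, hL, hU, mul_assoc]

instance : Mul (Double k O) := ⟨fun x y => mulAux (k := k) (O := O) x y⟩

instance : One (Double k O) := ⟨mk 1 1⟩

lemma mk_mul_mk {ι : Type*} (b b' : O) {u : GroupAlg k O} (u' : GroupAlg k O)
    (r : Coalgebra.Repr k u ι) :
    mk b u * mk b' u' = ∑ i ∈ r.index, mk (b * coadj k O (r.left i) b') (r.right i * u') := by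
  change mulAux (b ⊗ₜ[k] u) (b' ⊗ₜ[k] u') = _
  rw [mulAux_tmul, Module.End.mul_apply, opU_tmul r, map_sum]
  rfl

instance : Ring (Double k O) :=
  { (inferInstance : AddCommGroup (Double k O)) with
    left_distrib := fun x y z => map_add (mulAux (k := k) (O := O) x) y z
    right_distrib := fun x y z => congr($(map_add (mulAux (k := k) (O := O)) x y) z)
    zero_mul := fun x => congr($(map_zero (mulAux (k := k) (O := O))) x)
    mul_zero := fun x => map_zero (mulAux (k := k) (O := O) x)
    mul_assoc := fun x y z => congr($(mulAux_mulAux (k := k) (O := O) x y) z)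
    one_mul := fun x => by
      change mulAux ((1 : O) ⊗ₜ[k] (1 : GroupAlg k O)) x = x
      rw [mulAux_tmul, map_one, map_one, one_mul]
      rfl
    mul_one := fun x => by
      change mulAux (k := k) (O := O) x ((1 : O) ⊗ₜ[k] (1 : GroupAlg k O)) = x
      induction x using TensorProduct.induction_on with
      | zero => simp
      | add x y hx hy => rw [map_add, LinearMap.add_apply, hx, hy]
      | tmul b u =>
        have h : ∑ i ∈ (ℛ k u).index, counit (R := k) ((ℛ k u).left i) • (ℛ k u).right i = u :=
          Coalgebra.sum_counit_smul _
        rw [mulAux_tmul, Module.End.mul_apply, opU_tmul (ℛ k u)]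
        simp only [coadj_one, mul_one, TensorProduct.smul_tmul, ← TensorProduct.tmul_sum, h]
        rw [opL_tmul, mul_one]
    zsmul := fun n x => n • x
    zsmul_zero' := zero_zsmul
    zsmul_succ' := fun n x => SubNegMonoid.zsmul_succ' n x
    zsmul_neg' := fun n x => SubNegMonoid.zsmul_neg' n x
    neg_add_cancel := neg_add_cancel }

instance : Algebra k (Double k O) :=
  Algebra.ofModule
    (fun c x y => congr($(map_smul (mulAux (k := k) (O := O)) c x) y))
    (fun c x y => map_smul (mulAux (k := k) (O := O) x) c y)

/-- The inclusion of `O(G)` in `D(G)`. -/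
def inlO : O →ₐ[k] Double k O :=
  AlgHom.ofLinearMap ((TensorProduct.mk k O (GroupAlg k O)).flip 1) rfl (fun b c => by
    change mk (b * c) 1 = mk b 1 * mk c 1
    rw [mk_mul_mk b c 1 ⟨{()}, fun _ => 1, fun _ => 1, by simp [Algebra.TensorProduct.one_def]⟩]
    have : coadj k O 1 c = c := by rw [← coadjAlgHom_apply, map_one, Module.End.one_apply]
    simp [this])

/-- The inclusion of `k[G]` in `D(G)`. -/
def inrA : GroupAlg k O →ₐ[k] Double k O :=
  AlgHom.ofLinearMap (TensorProduct.mk k O (GroupAlg k O) 1) rfl (fun u v => by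
    change mk 1 (u * v) = mk 1 u * mk 1 v
    rw [mk_mul_mk 1 1 v (ℛ k u)]
    have h : ∑ i ∈ (ℛ k u).index, counit (R := k) ((ℛ k u).left i) • (ℛ k u).right i = u :=
      Coalgebra.sum_counit_smul _
    simp only [coadj_one, one_mul, mk, TensorProduct.smul_tmul, ← smul_mul_assoc]
    nth_rw 1 [← h]
    rw [Finset.sum_mul]
    exact TensorProduct.tmul_sum _ _ _)

lemma mk_eq (b : O) (u : GroupAlg k O) : mk b u = inlO b * inrA u := by
  change _ = mk b 1 * mk 1 u
  rw [mk_mul_mk b 1 u ⟨{()}, fun _ => 1, fun _ => 1, by simp [Algebra.TensorProduct.one_def]⟩]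
  have : coadj k O 1 1 = (1 : O) := by
    rw [← coadjAlgHom_apply, map_one (coadjAlgHom k O), Module.End.one_apply]
  simp [this]

lemma inrA_mul_inlO {ι : Type*} {u : GroupAlg k O} (r : Coalgebra.Repr k u ι) (b : O) :
    inrA u * inlO b = ∑ i ∈ r.index, inlO (coadj k O (r.left i) b) * inrA (r.right i) := by
  simp only [← mk_eq]
  change mk 1 u * mk b 1 = _
  rw [mk_mul_mk 1 b 1 r]
  simp

lemma induction {P : Double k O → Prop} (x : Double k O) (h0 : P 0)
    (hadd : ∀ x y, P x → P y → P (x + y)) (h : ∀ b u, P (inlO b * inrA u)) : P x :=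
  TensorProduct.induction_on (motive := P) x h0 (fun b u => by
    have := h b u
    rwa [← mk_eq] at this) hadd

lemma algHom_ext {R : Type*} [Ring R] [Algebra k R] {f g : Double k O →ₐ[k] R}
    (h₁ : ∀ b, f (inlO b) = g (inlO b)) (h₂ : ∀ u, f (inrA u) = g (inrA u)) : f = g := by
  refine AlgHom.ext fun x => ?_
  induction x using induction with
  | h0 => simp
  | hadd x y hx hy => rw [map_add, map_add, hx, hy]
  | h b u => rw [map_mul, map_mul, h₁, h₂]

/-- The universal property of `D(G)` as a smash product. -/
def lift {R : Type*} [Ring R] [Algebra k R] (F : O →ₐ[k] R) (E : GroupAlg k O →ₐ[k] R)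
    (h : ∀ u b, E u * F b = ∑ i ∈ (ℛ k u).index, F (coadj k O ((ℛ k u).left i) b) *
      E ((ℛ k u).right i)) : Double k O →ₐ[k] R := by
  let f : Double k O →ₗ[k] R := TensorProduct.lift ((LinearMap.mul k R).compl₁₂
    F.toLinearMap E.toLinearMap)
  have hf (b : O) (u : GroupAlg k O) : f (mk b u) = F b * E u :=
    TensorProduct.lift.tmul _ _
  refine AlgHom.ofLinearMap f ((hf 1 1).trans (by simp)) (fun x y => ?_)
  induction x using induction with
  | h0 => simp
  | hadd x z hx hz => rw [add_mul, map_add, map_add, hx, hz, add_mul]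
  | h b u =>
    induction y using induction with
    | h0 => simp
    | hadd x z hx hz => rw [mul_add, map_add, map_add, hx, hz, mul_add]
    | h b' u' =>
      simp only [← mk_eq]
      rw [mk_mul_mk b b' u' (ℛ k u), hf, hf, map_sum]
      simp only [hf, map_mul]
      calc _ = F b * (E u * F b') * E u' := by
            rw [h, Finset.mul_sum, Finset.sum_mul]
            exact Finset.sum_congr rfl fun i _ => by simp only [mul_assoc]
        _ = _ := by simp only [mul_assoc]

end Double

namespace Double

variable {k O : Type*} [Field k] [CommRing O] [HopfAlgebra k O] [Module.Finite k O]

/-- The linear map `u ⊗ w ↦ (u ⇀ b) ⋈ w`. -/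
def coadjMk (b : O) : GroupAlg k O ⊗[k] GroupAlg k O →ₗ[k] Double k O :=
  TensorProduct.map ((coadj k O).flip b) LinearMap.id

lemma coadjMk_tmul (b : O) (u w : GroupAlg k O) :
    coadjMk b (u ⊗ₜ w) = inlO (coadj k O u b) * inrA w := by
  rw [← mk_eq]; rfl

/-- The restriction of the comultiplication of `D(G)` to `O(G)`, `b ↦ b₂ ⊗ b₁`. -/
def comulO : O →ₐ[k] Double k O ⊗[k] Double k O :=
  (Algebra.TensorProduct.map inlO inlO).comp
    ((Algebra.TensorProduct.comm k O O).toAlgHom.comp (Bialgebra.comulAlgHom k O))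

lemma comulO_apply {ι : Type*} {b : O} (q : Coalgebra.Repr k b ι) :
    comulO b = ∑ j ∈ q.index, inlO (q.right j) ⊗ₜ[k] (inlO (q.left j) : Double k O) := by
  simp [comulO, ← q.eq]

/-- The restriction of the comultiplication of `D(G)` to `k[G]`, `u ↦ u₁ ⊗ u₂`. -/
def comulA : GroupAlg k O →ₐ[k] Double k O ⊗[k] Double k O :=
  (Algebra.TensorProduct.map inrA inrA).comp (Bialgebra.comulAlgHom k (GroupAlg k O))

lemma comulA_apply {ι : Type*} {u : GroupAlg k O} (r : Coalgebra.Repr k u ι) :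
    comulA u = ∑ i ∈ r.index, inrA (r.left i) ⊗ₜ[k] (inrA (r.right i) : Double k O) := by
  simp [comulA, ← r.eq]

/-- In a cocommutative coalgebra, the two factors of `Δ(u)` may be exchanged. -/
def reprSwap {A : Type*} [AddCommGroup A] [Module k A] [Coalgebra k A] [IsCocomm k A] {u : A}
    {ι : Type*} (r : Coalgebra.Repr k u ι) : Coalgebra.Repr k u ι where
  index := r.index
  left := r.right
  right := r.left
  eq := by
    have := congrArg (TensorProduct.comm k A A) r.eq
    rw [comm_comul] at this
    rw [← this]; simp

lemma comul_comul (u : GroupAlg k O) :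
    TensorProduct.map comul comul (comul (R := k) u) =
      TensorProduct.tensorTensorTensorComm k _ _ _ _
        (TensorProduct.map comul comul (comul (R := k) u)) :=
  congr($((comulCoalgHom k (GroupAlg k O)).map_comp_comul) u)

lemma comulA_mul_comulO (u : GroupAlg k O) (b : O) :
    comulA u * comulO b = ∑ i ∈ (ℛ k u).index,
      comulO (coadj k O ((ℛ k u).left i) b) * comulA ((ℛ k u).right i) := by
  let q := ℛ k b
  let r := ℛ k u
  let Ψ : (GroupAlg k O ⊗[k] GroupAlg k O) ⊗[k] (GroupAlg k O ⊗[k] GroupAlg k O) →ₗ[k]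
      Double k O ⊗[k] Double k O :=
    ∑ j ∈ q.index, TensorProduct.map (coadjMk (q.right j)) (coadjMk (q.left j))
  have hΨ (x y z w : GroupAlg k O) : Ψ ((x ⊗ₜ y) ⊗ₜ (z ⊗ₜ w)) = ∑ j ∈ q.index,
      (inlO (coadj k O x (q.right j)) * inrA y) ⊗ₜ (inlO (coadj k O z (q.left j)) * inrA w) := by
    simp only [Ψ, LinearMap.sum_apply, TensorProduct.map_tmul, coadjMk_tmul]
  have h := congrArg Ψ (comul_comul u)
  rw [← r.eq] at h
  simp only [map_sum, TensorProduct.map_tmul] at h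
  have hl : comulA u * comulO b = ∑ i ∈ r.index,
      Ψ (comul (r.left i) ⊗ₜ comul (r.right i)) := by
    rw [comulA_apply r, comulO_apply q, Finset.sum_mul_sum]
    refine Finset.sum_congr rfl fun i _ => ?_
    rw [← (ℛ k (r.left i)).eq, ← (ℛ k (r.right i)).eq]
    simp only [TensorProduct.sum_tmul, TensorProduct.tmul_sum, map_sum, hΨ,
      Algebra.TensorProduct.tmul_mul_tmul, inrA_mul_inlO (ℛ k _)]
    rw [Finset.sum_comm]
    simp only [Finset.sum_comm (s := q.index)]
  have hr (i) : comulO (coadj k O (r.left i) b) * comulA (r.right i) =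
      Ψ (TensorProduct.tensorTensorTensorComm k _ _ _ _
        (comul (r.left i) ⊗ₜ comul (r.right i))) := by
    have h1 : comulO (coadj k O (r.left i) b) = ∑ l ∈ (ℛ k (r.left i)).index, ∑ j ∈ q.index,
        inlO (coadj k O ((ℛ k (r.left i)).left l) (q.right j)) ⊗ₜ[k]
          (inlO (coadj k O ((ℛ k (r.left i)).right l) (q.left j)) : Double k O) := by
      have h2 := comul_coadj (reprSwap (ℛ k (r.left i))) q
      simp only [comulO, AlgHom.comp_apply, Bialgebra.comulAlgHom_apply, h2, map_sum]
      rfl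
    rw [h1, comulA_apply (ℛ k (r.right i)), ← (ℛ k (r.left i)).eq, ← (ℛ k (r.right i)).eq]
    simp only [TensorProduct.sum_tmul, TensorProduct.tmul_sum, map_sum,
      TensorProduct.tensorTensorTensorComm_tmul, hΨ, Finset.sum_mul,
      Finset.mul_sum, Algebra.TensorProduct.tmul_mul_tmul]
  rw [hl, h]
  exact Finset.sum_congr rfl fun i _ => (hr i).symm


/-- The comultiplication of `D(G)` as an algebra map,
`b ⋈ u ↦ (b₂ ⋈ u₁) ⊗ (b₁ ⋈ u₂)`. -/
def comulHom : Double k O →ₐ[k] Double k O ⊗[k] Double k O :=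
  lift comulO comulA comulA_mul_comulO

/-- The counit of `D(G)` as an algebra map, `b ⋈ u ↦ ε(b) ε(u)`. -/
def counitHom : Double k O →ₐ[k] k :=
  lift (Bialgebra.counitAlgHom k O) (Bialgebra.counitAlgHom k (GroupAlg k O)) (fun u b => by
    simp only [Bialgebra.counitAlgHom_apply, counit_coadj]
    have h : counit (R := k) (∑ i ∈ (ℛ k u).index,
        counit (R := k) ((ℛ k u).left i) • (ℛ k u).right i) = counit (R := k) u := by
      rw [Coalgebra.sum_counit_smul]
    simp only [map_sum, map_smul, smul_eq_mul] at h
    rw [← h, Finset.sum_mul]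
    exact Finset.sum_congr rfl fun i _ => by ring)

lemma lift_inlO {R : Type*} [Ring R] [Algebra k R] (F : O →ₐ[k] R) (E : GroupAlg k O →ₐ[k] R)
    (h) (b : O) : lift F E h (inlO b) = F b := by
  have := TensorProduct.lift.tmul (f' := (LinearMap.mul k R).compl₁₂ F.toLinearMap E.toLinearMap)
    b (1 : GroupAlg k O)
  exact this.trans (by simp)

lemma lift_inrA {R : Type*} [Ring R] [Algebra k R] (F : O →ₐ[k] R) (E : GroupAlg k O →ₐ[k] R)
    (h) (u : GroupAlg k O) : lift F E h (inrA u) = E u := by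
  have := TensorProduct.lift.tmul (f' := (LinearMap.mul k R).compl₁₂ F.toLinearMap E.toLinearMap)
    (1 : O) u
  exact this.trans (by simp)

lemma comulHom_inlO (b : O) : comulHom (k := k) (inlO b) = comulO b := lift_inlO ..

lemma comulHom_inrA (u : GroupAlg k O) : comulHom (inrA u) = comulA u := lift_inrA ..

lemma counitHom_inlO (b : O) : counitHom (k := k) (inlO b) = counit (R := k) b := lift_inlO ..

lemma counitHom_inrA (u : GroupAlg k O) : counitHom (inrA u) = counit (R := k) u := lift_inrA ..

instance : Bialgebra k (Double k O) :=
  Bialgebra.ofAlgHom comulHom counitHom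
    (by
      refine algHom_ext (fun b => ?_) (fun u => ?_)
      · let q := ℛ k b
        have h := Coalgebra.sum_tmul_tmul_eq q (fun i => ℛ k (q.left i)) (fun i => ℛ k (q.right i))
        let Ψ : O ⊗[k] (O ⊗[k] O) →ₗ[k] Double k O ⊗[k] (Double k O ⊗[k] Double k O) :=
          TensorProduct.map inlO.toLinearMap
            (TensorProduct.map inlO.toLinearMap inlO.toLinearMap) ∘ₗ
          (TensorProduct.assoc k _ _ _).toLinearMap ∘ₗ (TensorProduct.comm k _ _).toLinearMap ∘ₗ
          (TensorProduct.comm k _ _).toLinearMap.lTensor _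
        have h' := congrArg Ψ h
        simp only [Ψ, map_sum, LinearMap.comp_apply, LinearMap.lTensor_tmul, LinearEquiv.coe_coe,
          TensorProduct.comm_tmul, TensorProduct.assoc_tmul, TensorProduct.map_tmul,
          AlgHom.toLinearMap_apply] at h'
        simp only [AlgHom.comp_apply, comulHom_inlO, comulO_apply q, map_sum,
          Algebra.TensorProduct.map_tmul, AlgHom.id_apply]
        simp only [comulO_apply (ℛ k _), TensorProduct.sum_tmul, TensorProduct.tmul_sum, map_sum]
        exact h'.symm
      · let r := ℛ k u
        have h := Coalgebra.sum_tmul_tmul_eq r (fun i => ℛ k (r.left i)) (fun i => ℛ k (r.right i))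
        have h' := congrArg (TensorProduct.map (inrA (k := k) (O := O)).toLinearMap
          (TensorProduct.map (inrA (k := k) (O := O)).toLinearMap
            (inrA (k := k) (O := O)).toLinearMap)) h
        simp only [map_sum, TensorProduct.map_tmul, AlgHom.toLinearMap_apply] at h'
        simp only [AlgHom.comp_apply, comulHom_inrA, comulA_apply r, map_sum,
          Algebra.TensorProduct.map_tmul, AlgHom.id_apply]
        simp only [comulA_apply (ℛ k _), TensorProduct.sum_tmul, TensorProduct.tmul_sum, map_sum]
        exact h')
    (by
      refine algHom_ext (fun b => ?_) (fun u => ?_)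
      · have h := congrArg ((TensorProduct.comm k (Double k O) k).toLinearMap ∘ₗ
          (inlO (k := k) (O := O)).toLinearMap.rTensor k) (sum_tmul_counit_eq (ℛ k b))
        simp only [map_sum, LinearMap.comp_apply, LinearMap.rTensor_tmul, LinearEquiv.coe_coe,
          TensorProduct.comm_tmul, AlgHom.toLinearMap_apply] at h
        simpa [comulHom_inlO, comulO_apply (ℛ k b), counitHom_inlO] using h
      · simp [comulHom_inrA, comulA_apply (ℛ k u), counitHom_inrA])
    (by
      refine algHom_ext (fun b => ?_) (fun u => ?_)
      · have h := congrArg ((TensorProduct.comm k k (Double k O)).toLinearMap ∘ₗ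
          (inlO (k := k) (O := O)).toLinearMap.lTensor k) (sum_counit_tmul_eq (ℛ k b))
        simp only [map_sum, LinearMap.comp_apply, LinearMap.lTensor_tmul, LinearEquiv.coe_coe,
          TensorProduct.comm_tmul, AlgHom.toLinearMap_apply] at h
        simpa [comulHom_inlO, comulO_apply (ℛ k b), counitHom_inlO] using h
      · simp [comulHom_inrA, comulA_apply (ℛ k u), counitHom_inrA])

lemma comul_inlO (b : O) : comul (R := k) (inlO b : Double k O) = comulO b := comulHom_inlO b

lemma comul_inrA (u : GroupAlg k O) : comul (R := k) (inrA u : Double k O) = comulA u :=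
  comulHom_inrA u

lemma counit_inlO (b : O) : counit (R := k) (inlO b : Double k O) = counit (R := k) b :=
  counitHom_inlO b

lemma counit_inrA (u : GroupAlg k O) : counit (R := k) (inrA u : Double k O) = counit (R := k) u :=
  counitHom_inrA u

/-- `D(G)` is the coalgebra `O(G)^cop ⊗ k[G]`. -/
lemma comul_mk {ι κ : Type*} {b : O} {u : GroupAlg k O} (q : Coalgebra.Repr k b ι)
    (r : Coalgebra.Repr k u κ) : comul (R := k) (mk b u) = ∑ j ∈ q.index, ∑ i ∈ r.index,
      mk (q.right j) (r.left i) ⊗ₜ[k] mk (q.left j) (r.right i) := by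
  rw [mk_eq, Bialgebra.comul_mul, comul_inlO, comul_inrA, comulO_apply q, comulA_apply r,
    Finset.sum_mul_sum]
  simp [mk_eq]

/-! #### The antipode -/

open MulOpposite HopfAlgebra

/-- `ι(u ⇀ c) = ι(u₁) ι(c) ι(S(u₂))` -/
lemma inlO_coadj {ι : Type*} {u : GroupAlg k O} (r : Coalgebra.Repr k u ι) (c : O) :
    (inlO (coadj k O u c) : Double k O) =
      ∑ i ∈ r.index, inrA (r.left i) * inlO c * inrA (antipode k (r.right i)) := by
  have h := Coalgebra.sum_tmul_tmul_eq r (fun i => ℛ k (r.left i)) (fun i => ℛ k (r.right i))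
  let Ψ : GroupAlg k O ⊗[k] (GroupAlg k O ⊗[k] GroupAlg k O) →ₗ[k] Double k O :=
    LinearMap.mul' k _ ∘ₗ TensorProduct.map (inlO.toLinearMap ∘ₗ (coadj k O).flip c)
      (LinearMap.mul' k _ ∘ₗ TensorProduct.map inrA.toLinearMap
        (inrA.toLinearMap ∘ₗ antipode k))
  have h' := congrArg Ψ h
  simp only [Ψ, map_sum, LinearMap.comp_apply, LinearMap.mul'_apply, TensorProduct.map_tmul,
    AlgHom.toLinearMap_apply, LinearMap.flip_apply] at h'
  have h1 (i) : ∑ j ∈ (ℛ k (r.right i)).index, (inrA ((ℛ k (r.right i)).left j) *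
      inrA (antipode k ((ℛ k (r.right i)).right j)) : Double k O) =
      counit (R := k) (r.right i) • 1 := by
    have := congrArg (inrA (k := k) (O := O)) (sum_mul_antipode_eq_smul (ℛ k (r.right i)))
    simpa using this
  simp only [inrA_mul_inlO (ℛ k _), Finset.sum_mul]
  simp only [mul_assoc]
  rw [h']
  simp only [← Finset.mul_sum, h1]
  have h2 := congrArg (fun x => (inlO (coadj k O x c) : Double k O)) (sum_counit_smul (reprSwap r))
  simp only [reprSwap, map_sum, LinearMap.sum_apply, map_smul, LinearMap.smul_apply] at h2
  simp [← h2]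

lemma conj_inv' {R : Type*} [CommRing R] [Bialgebra k R] (a b : WithConv (O →ₐ[k] R)) :
    b⁻¹ * a⁻¹ * b = (b⁻¹ * a * b)⁻¹ := by group

lemma antipode_coadj (u : GroupAlg k O) (b : O) :
    antipode k (coadj k O u b) = coadj k O u (antipode k b) := by
  have h : (Algebra.TensorProduct.map (antipodeAlgHom k O) (AlgHom.id k O)).comp (adCoact k O) =
      (adCoact k O).comp (antipodeAlgHom k O) := by
    apply toConv_injective
    refine (toConv_comp_adCoact _).trans ?_
    have h1 : (Algebra.TensorProduct.map (antipodeAlgHom k O) (AlgHom.id k O)).comp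
        Algebra.TensorProduct.includeRight =
        (Algebra.TensorProduct.includeRight : O →ₐ[k] O ⊗[k] O) := by ext; simp
    have h2 : (Algebra.TensorProduct.map (antipodeAlgHom k O) (AlgHom.id k O)).comp
        Algebra.TensorProduct.includeLeft =
        (Algebra.TensorProduct.includeLeft : O →ₐ[k] O ⊗[k] O).comp (antipodeAlgHom k O) := by
      ext; simp
    rw [h1, h2]
    have h3 : toConv ((Algebra.TensorProduct.includeLeft : O →ₐ[k] O ⊗[k] O).comp
        (antipodeAlgHom k O)) = (toConv Algebra.TensorProduct.includeLeft)⁻¹ := rfl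
    have h4 : toConv ((adCoact k O).comp (antipodeAlgHom k O)) = (toConv (adCoact k O))⁻¹ := rfl
    have h5 := toConv_comp_adCoact (k := k) (O := O) (AlgHom.id k (O ⊗[k] O))
    rw [AlgHom.id_comp, AlgHom.id_comp, AlgHom.id_comp] at h5
    rw [h3, h4, h5]
    exact conj_inv' (R := O ⊗[k] O) _ _
  have h' : slice O u ((antipode k (A := O)).rTensor O (adCoact k O b)) =
      slice O u (adCoact k O (antipode k b)) := congr(slice O u ($h b))
  rw [slice_rTensor] at h'
  exact h'

lemma inrA_antipode_mul (u : GroupAlg k O) (c : O) :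
    inlO c * inrA (antipode k u) = ∑ i ∈ (ℛ k u).index,
      inrA (antipode k ((ℛ k u).right i)) * (inlO (coadj k O ((ℛ k u).left i) c) : Double k O) := by
  have hs : ∑ i ∈ (ℛ k u).index, inrA (antipode k ((ℛ k u).right i)) *
        (inlO (coadj k O ((ℛ k u).left i) c) : Double k O) =
      ∑ i ∈ (ℛ k u).index, inrA (antipode k ((ℛ k u).left i)) *
        inlO (coadj k O ((ℛ k u).right i) c) := by
    let Ψ : GroupAlg k O ⊗[k] GroupAlg k O →ₗ[k] Double k O :=
      LinearMap.mul' k _ ∘ₗ TensorProduct.map (inrA.toLinearMap ∘ₗ antipode k)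
        (inlO.toLinearMap ∘ₗ (coadj k O).flip c)
    have := congrArg Ψ ((reprSwap (ℛ k u)).eq.trans (ℛ k u).eq.symm)
    simpa only [Ψ, map_sum, LinearMap.comp_apply, LinearMap.mul'_apply, TensorProduct.map_tmul,
      AlgHom.toLinearMap_apply, LinearMap.flip_apply, reprSwap] using this
  rw [hs]
  let r := ℛ k u
  have h := Coalgebra.sum_tmul_tmul_eq r (fun i => ℛ k (r.left i)) (fun i => ℛ k (r.right i))
  let Ψ : GroupAlg k O ⊗[k] (GroupAlg k O ⊗[k] GroupAlg k O) →ₗ[k] Double k O :=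
    LinearMap.mul' k _ ∘ₗ TensorProduct.map (inrA.toLinearMap ∘ₗ antipode k)
      (LinearMap.mul' k _ ∘ₗ TensorProduct.map
        (LinearMap.mulRight k (inlO c) ∘ₗ inrA.toLinearMap) (inrA.toLinearMap ∘ₗ antipode k))
  have h' := congrArg Ψ h
  simp only [Ψ, map_sum, LinearMap.comp_apply, LinearMap.mul'_apply, TensorProduct.map_tmul,
    AlgHom.toLinearMap_apply, LinearMap.mulRight_apply] at h'
  simp only [inlO_coadj (ℛ k _), Finset.mul_sum]
  refine Eq.trans ?_ h'
  have h1 (i) : ∑ j ∈ (ℛ k (r.left i)).index, (inrA (antipode k ((ℛ k (r.left i)).left j)) *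
      inrA ((ℛ k (r.left i)).right j) : Double k O) = counit (R := k) (r.left i) • 1 := by
    have := congrArg (inrA (k := k) (O := O)) (sum_antipode_mul_eq_smul (ℛ k (r.left i)))
    simpa only [map_sum, map_mul, map_smul, map_one] using this
  simp only [← mul_assoc, ← Finset.sum_mul, h1]
  have h2 := congrArg (fun x => (inlO c * inrA (antipode k x) : Double k O)) (sum_counit_smul r)
  simp only [map_sum, map_smul] at h2
  rw [← h2, Finset.mul_sum]
  simp

lemma antipode_rel (u : GroupAlg k O) (b : O) :
    (AlgHom.op inrA).comp (antipodeAlgHomOp k (GroupAlg k O)) u *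
        (AlgHom.op (inlO (k := k) (O := O))).comp (antipodeAlgHomOp k O) b =
      ∑ i ∈ (ℛ k u).index,
        (AlgHom.op inlO).comp (antipodeAlgHomOp k O) (coadj k O ((ℛ k u).left i) b) *
        (AlgHom.op inrA).comp (antipodeAlgHomOp k (GroupAlg k O)) ((ℛ k u).right i) := by
  apply unop_injective
  have h := inrA_antipode_mul u (antipode k b)
  simp only [← antipode_coadj] at h
  rw [Finset.unop_sum]
  exact h

/-- The antipode of `D(G)` as an algebra map to the opposite algebra,
`b ⋈ u ↦ (1 ⋈ S(u)) (S(b) ⋈ 1)`. -/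
def antipodeHom : Double k O →ₐ[k] (Double k O)ᵐᵒᵖ :=
  lift ((AlgHom.op inlO).comp (antipodeAlgHomOp k O))
    ((AlgHom.op inrA).comp (antipodeAlgHomOp k (GroupAlg k O))) antipode_rel

/-- The antipode of `D(G)`. -/
def antipodeLin : Double k O →ₗ[k] Double k O :=
  (opLinearEquiv k).symm.toLinearMap ∘ₗ antipodeHom.toLinearMap

lemma antipodeLin_mul (x y : Double k O) :
    antipodeLin (x * y) = antipodeLin y * antipodeLin x := by
  simp [antipodeLin]

lemma antipodeLin_inlO (b : O) : antipodeLin (k := k) (inlO b) = inlO (antipode k b) :=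
  congrArg unop (lift_inlO _ _ antipode_rel b)

lemma antipodeLin_inrA (u : GroupAlg k O) : antipodeLin (inrA u) = inrA (antipode k u) :=
  congrArg unop (lift_inrA _ _ antipode_rel u)

lemma antipode_left (x : Double k O) :
    LinearMap.mul' k _ (antipodeLin.rTensor _ (comul (R := k) x)) =
      algebraMap k (Double k O) (counit (R := k) x) := by
  induction x using induction with
  | h0 => simp
  | hadd x y hx hy => simp only [map_add, hx, hy]
  | h b u =>
    have hb : ∑ j ∈ (ℛ k b).index, inlO (antipode k ((ℛ k b).right j)) *
        (inlO ((ℛ k b).left j) : Double k O) = counit (R := k) b • 1 := by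
      have := congrArg (inlO (k := k) (O := O)) (sum_mul_antipode_eq_smul (ℛ k b))
      simpa only [map_sum, map_mul, map_smul, map_one, mul_comm, ← map_mul] using this
    have hu : ∑ j ∈ (ℛ k u).index, inrA (antipode k ((ℛ k u).left j)) *
        (inrA ((ℛ k u).right j) : Double k O) = counit (R := k) u • 1 := by
      have := congrArg (inrA (k := k) (O := O)) (sum_antipode_mul_eq_smul (ℛ k u))
      simpa only [map_sum, map_mul, map_smul, map_one] using this
    rw [Bialgebra.comul_mul, comul_inlO, comul_inrA, comulO_apply (ℛ k b), comulA_apply (ℛ k u),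
      Finset.sum_mul_sum, Finset.sum_comm]
    simp only [map_sum, Algebra.TensorProduct.tmul_mul_tmul, LinearMap.rTensor_tmul,
      LinearMap.mul'_apply, antipodeLin_mul, antipodeLin_inlO, antipodeLin_inrA]
    have h (i j) : inrA (antipode k ((ℛ k u).left i)) * inlO (antipode k ((ℛ k b).right j)) *
        (inlO ((ℛ k b).left j) * inrA ((ℛ k u).right i) : Double k O) =
        inrA (antipode k ((ℛ k u).left i)) * (inlO (antipode k ((ℛ k b).right j)) *
        inlO ((ℛ k b).left j)) * inrA ((ℛ k u).right i) := by simp only [mul_assoc]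
    simp only [h, ← Finset.mul_sum, ← Finset.sum_mul, hb, mul_smul_comm, mul_one, smul_mul_assoc,
      ← Finset.smul_sum, hu]
    rw [Bialgebra.counit_mul, counit_inlO, counit_inrA, Algebra.algebraMap_eq_smul_one, smul_smul]

lemma antipode_right (x : Double k O) :
    LinearMap.mul' k _ (antipodeLin.lTensor _ (comul (R := k) x)) =
      algebraMap k (Double k O) (counit (R := k) x) := by
  induction x using induction with
  | h0 => simp
  | hadd x y hx hy => simp only [map_add, hx, hy]
  | h b u =>
    have hb : ∑ j ∈ (ℛ k b).index, inlO ((ℛ k b).right j) *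
        (inlO (antipode k ((ℛ k b).left j)) : Double k O) = counit (R := k) b • 1 := by
      have := congrArg (inlO (k := k) (O := O)) (sum_antipode_mul_eq_smul (ℛ k b))
      simpa only [map_sum, map_mul, map_smul, map_one, mul_comm, ← map_mul] using this
    have hu : ∑ j ∈ (ℛ k u).index, inrA ((ℛ k u).left j) *
        (inrA (antipode k ((ℛ k u).right j)) : Double k O) = counit (R := k) u • 1 := by
      have := congrArg (inrA (k := k) (O := O)) (sum_mul_antipode_eq_smul (ℛ k u))
      simpa only [map_sum, map_mul, map_smul, map_one] using this
    rw [Bialgebra.comul_mul, comul_inlO, comul_inrA, comulO_apply (ℛ k b), comulA_apply (ℛ k u),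
      Finset.sum_mul_sum]
    simp only [map_sum, Algebra.TensorProduct.tmul_mul_tmul, LinearMap.lTensor_tmul,
      LinearMap.mul'_apply, antipodeLin_mul, antipodeLin_inlO, antipodeLin_inrA]
    have h (i j) : inlO ((ℛ k b).right j) * inrA ((ℛ k u).left i) *
        (inrA (antipode k ((ℛ k u).right i)) * inlO (antipode k ((ℛ k b).left j)) : Double k O) =
        inlO ((ℛ k b).right j) * (inrA ((ℛ k u).left i) *
        inrA (antipode k ((ℛ k u).right i))) * inlO (antipode k ((ℛ k b).left j)) := by
      simp only [mul_assoc]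
    simp only [h, ← Finset.mul_sum, ← Finset.sum_mul, hu, mul_smul_comm, mul_one, smul_mul_assoc,
      ← Finset.smul_sum, hb]
    rw [Bialgebra.counit_mul, counit_inlO, counit_inrA, Algebra.algebraMap_eq_smul_one, smul_smul,
      mul_comm]

instance : HopfAlgebra k (Double k O) where
  antipode := antipodeLin
  mul_antipode_rTensor_comul := LinearMap.ext antipode_left
  mul_antipode_lTensor_comul := LinearMap.ext antipode_right

end Double

/-! ### Subgroup schemes -/

/-- A closed subgroup scheme `L` of `G`, given by the Hopf ideal of `O(G)` that defines it. -/
@[ext]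
structure ClosedSubgroup (k O : Type u) [Field k] [CommRing O] [HopfAlgebra k O] where
  /-- The ideal of `L` in `O(G)`. -/
  ideal : Ideal O
  isHopfIdeal : ideal.IsHopfIdeal k

attribute [instance] ClosedSubgroup.isHopfIdeal

namespace ClosedSubgroup

variable {k O : Type u} [Field k] [CommRing O] [HopfAlgebra k O]

/-- The coordinate algebra `O(L)`. -/
abbrev coord (L : ClosedSubgroup k O) : Type u := O ⧸ L.ideal

/-- The restriction map `q : O(G) → O(L)`. -/
def q (L : ClosedSubgroup k O) : O →ₐ[k] L.coord := Ideal.Quotient.mkₐ k L.ideal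

lemma q_surjective (L : ClosedSubgroup k O) : Function.Surjective L.q :=
  Ideal.Quotient.mk_surjective

/-- The group algebra `k[L]`. -/
abbrev groupAlg (L : ClosedSubgroup k O) : Type u := GroupAlg k L.coord

/-- The inclusion `k[L] → k[G]`, the transpose of `q`. -/
def incl (L : ClosedSubgroup k O) : L.groupAlg →ₗ[k] GroupAlg k O :=
  (GroupAlg.toDual k O).symm.toLinearMap ∘ₗ L.q.toLinearMap.dualMap ∘ₗ
    (GroupAlg.toDual k L.coord).toLinearMap

@[simp] lemma incl_apply (L : ClosedSubgroup k O) (v : L.groupAlg) (a : O) :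
    (L.incl v) a = v (L.q a) := by simp [incl]

lemma incl_injective (L : ClosedSubgroup k O) : Function.Injective L.incl := by
  intro v w h
  refine GroupAlg.ext fun a => ?_
  obtain ⟨a, rfl⟩ := L.q_surjective a
  rw [← incl_apply, h, incl_apply]

/-- `L` is normal in `G`: the conjugation `(g, f) ↦ f⁻¹ g f` maps `L × G` to `L`, that is, its
comorphism followed by restriction to `L × G` vanishes on the ideal of `L`. -/
def IsNormal (L : ClosedSubgroup k O) : Prop :=
  ∀ b ∈ L.ideal, Algebra.TensorProduct.map L.q (AlgHom.id k O) (adCoact k O b) = 0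

end ClosedSubgroup

/-- A normal subgroup scheme of `G`. -/
@[ext]
structure NormalSubgroup (k O : Type u) [Field k] [CommRing O] [HopfAlgebra k O] extends
    ClosedSubgroup k O where
  normal : toClosedSubgroup.IsNormal

namespace NormalSubgroup

variable {k O : Type u} [Field k] [CommRing O] [HopfAlgebra k O]

/-- The coaction `O(K) → O(K) ⊗ O(G)`, the comorphism of the conjugation `K × G → K`. -/
def coact (K : NormalSubgroup k O) : K.coord →ₐ[k] K.coord ⊗[k] O :=
  Ideal.Quotient.liftₐ K.ideal
    ((Algebra.TensorProduct.map K.q (AlgHom.id k O)).comp (adCoact k O)) K.normal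

/-- The action `u * a` of `k[G]` on `O(K)`. -/
def act (K : NormalSubgroup k O) : GroupAlg k O →ₗ[k] Module.End k K.coord :=
  actOfCoact K.coact.toLinearMap

/-- The action of `k[G]` on `O(K)` is induced by the coadjoint action: `u * q(b) = q(u ⇀ b)`. -/
lemma act_q (K : NormalSubgroup k O) (u : GroupAlg k O) (b : O) :
    K.act u (K.q b) = K.q (coadj k O u b) :=
  slice_rTensor K.q.toLinearMap u (adCoact k O b)

variable [Module.Finite k O]

lemma counit_incl (H : NormalSubgroup k O) (v : H.groupAlg) :
    counit (R := k) (H.incl v) = counit (R := k) v := by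
  rw [GroupAlg.counit_apply, GroupAlg.counit_apply, ClosedSubgroup.incl_apply, map_one]

lemma comul_incl (H : NormalSubgroup k O) (v : H.groupAlg) :
    comul (R := k) (H.incl v) = TensorProduct.map H.incl H.incl (comul (R := k) v) := by
  refine GroupAlg.pair₂_ext fun a b => ?_
  have h (t : H.groupAlg ⊗[k] H.groupAlg) :
      GroupAlg.pair₂ k O (TensorProduct.map H.incl H.incl t) (a ⊗ₜ b) =
        GroupAlg.pair₂ k H.coord t (H.q a ⊗ₜ H.q b) := by
    induction t with
    | zero => simp
    | add x y hx hy => simp_all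
    | tmul v w => simp
  rw [h, GroupAlg.pair₂_comul, GroupAlg.pair₂_comul, ClosedSubgroup.incl_apply, map_mul]

/-- The two-sided ideal of `k[G]` generated by the augmentation ideal `k[H]⁺` of `k[H]`.  As `H`
is normal, it is `k[G] k[H]⁺`. -/
def augIdeal (H : NormalSubgroup k O) : Ideal (GroupAlg k O) :=
  (TwoSidedIdeal.span (Set.range fun v : H.groupAlg =>
    H.incl v - algebraMap k (GroupAlg k O) (counit (R := k) v))).asIdeal

instance (H : NormalSubgroup k O) : H.augIdeal.IsTwoSided :=
  inferInstanceAs (TwoSidedIdeal.asIdeal _).IsTwoSided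

lemma map_eq_zero_of_mem_augIdeal (H : NormalSubgroup k O) {R : Type*} [Ring R] [Algebra k R]
    (f : GroupAlg k O →ₐ[k] R)
    (hf : ∀ v : H.groupAlg, f (H.incl v) = algebraMap k R (counit (R := k) v))
    {x : GroupAlg k O} (hx : x ∈ H.augIdeal) : f x = 0 := by
  have h : TwoSidedIdeal.span (Set.range fun v : H.groupAlg =>
      H.incl v - algebraMap k (GroupAlg k O) (counit (R := k) v)) ≤ TwoSidedIdeal.ker f := by
    rw [TwoSidedIdeal.span_le]
    rintro _ ⟨v, rfl⟩
    simp [TwoSidedIdeal.mem_ker, hf]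
  exact (TwoSidedIdeal.mem_ker f).mp (h (TwoSidedIdeal.mem_asIdeal.mp hx))

lemma mk_incl (H : NormalSubgroup k O) (v : H.groupAlg) :
    Ideal.Quotient.mkₐ k H.augIdeal (H.incl v) =
      algebraMap k (GroupAlg k O ⧸ H.augIdeal) (counit (R := k) v) := by
  rw [← AlgHom.commutes (Ideal.Quotient.mkₐ k H.augIdeal)]
  refine Ideal.Quotient.eq.mpr (TwoSidedIdeal.mem_asIdeal.mpr
    (TwoSidedIdeal.subset_span ⟨v, rfl⟩))

instance (H : NormalSubgroup k O) : (H.augIdeal.restrictScalars k).IsCoideal where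
  counit_eq_zero x hx :=
    H.map_eq_zero_of_mem_augIdeal (Bialgebra.counitAlgHom k _) (fun v => H.counit_incl v) hx
  map_mkQ_comul_eq_zero x hx := by
    let π := Ideal.Quotient.mkₐ k H.augIdeal
    refine H.map_eq_zero_of_mem_augIdeal ((Algebra.TensorProduct.map π π).comp
      (Bialgebra.comulAlgHom k _)) (fun v => ?_) hx
    rw [AlgHom.comp_apply, Bialgebra.comulAlgHom_apply, comul_incl, ← (ℛ k v).eq]
    have h1 : counit (R := k) (∑ i ∈ (ℛ k v).index,
        counit (R := k) ((ℛ k v).left i) • (ℛ k v).right i) = counit (R := k) v := by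
      rw [Coalgebra.sum_counit_smul]
    rw [← h1]
    simp only [map_sum, TensorProduct.map_tmul, Algebra.TensorProduct.map_tmul, π, mk_incl,
      map_smul, smul_eq_mul, map_mul]
    refine Finset.sum_congr rfl fun i _ => ?_
    simp [Algebra.algebraMap_eq_smul_one, TensorProduct.smul_tmul', TensorProduct.tmul_smul,
      Algebra.TensorProduct.one_def, smul_smul, mul_comm]

/-- The group algebra `k[G/H] = k[G] / k[G] k[H]⁺` of the quotient group scheme. -/
abbrev quotAlg (H : NormalSubgroup k O) : Type u := GroupAlg k O ⧸ H.augIdeal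

/-- The projection `π : k[G] → k[G/H]`. -/
def proj (H : NormalSubgroup k O) : GroupAlg k O →ₐc[k] H.quotAlg :=
  Bialgebra.Quotient.mkBialgHom H.augIdeal

end NormalSubgroup

/-- A section of `π : k[G] → k[G/H]`: a convolution invertible, right `k[G/H]`-colinear map
`γ` with `ε γ = ε`, `π γ = id` and `γ(1) = 1`. -/
structure Cleaving {k O : Type u} [Field k] [CommRing O] [HopfAlgebra k O] [Module.Finite k O]
    (H : NormalSubgroup k O) where
  /-- The section `γ`. -/
  γ : H.quotAlg →ₗ[k] GroupAlg k O
  /-- The convolution inverse `γ⁻¹`. -/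
  γinv : H.quotAlg →ₗ[k] GroupAlg k O
  γ_mul_γinv : toConv γ * toConv γinv = 1
  γinv_mul_γ : toConv γinv * toConv γ = 1
  colinear : ∀ x : H.quotAlg, γ.rTensor H.quotAlg (comul (R := k) x) =
    (H.proj : GroupAlg k O →ₗ[k] H.quotAlg).lTensor (GroupAlg k O) (comul (R := k) (γ x))
  counit_γ : ∀ x : H.quotAlg, counit (R := k) (γ x) = counit (R := k) x
  proj_γ : ∀ x : H.quotAlg, H.proj (γ x) = x
  γ_one : γ 1 = 1

namespace Cleaving

variable {k O : Type u} [Field k] [CommRing O] [HopfAlgebra k O] [Module.Finite k O]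
  {H : NormalSubgroup k O} (s : Cleaving H)

/-- `η(u) = u₁ γ⁻¹(π(u₂))`. -/
def η : GroupAlg k O →ₗ[k] GroupAlg k O :=
  (toConv LinearMap.id * toConv (s.γinv ∘ₗ (H.proj : GroupAlg k O →ₗ[k] H.quotAlg))).ofConv

/-- `η⁻¹(u) = γ(π(u₁)) S(u₂)`, the convolution inverse of `η`. -/
def ηinv : GroupAlg k O →ₗ[k] GroupAlg k O :=
  (toConv (s.γ ∘ₗ (H.proj : GroupAlg k O →ₗ[k] H.quotAlg)) *
    toConv (HopfAlgebra.antipode k)).ofConv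

/-- `x ⊗ y ↦ γ(x₁) γ(y₁) γ⁻¹(x₂ y₂)`. -/
def cocycle : H.quotAlg ⊗[k] H.quotAlg →ₗ[k] GroupAlg k O :=
  (toConv (LinearMap.mul' k (GroupAlg k O) ∘ₗ TensorProduct.map s.γ s.γ) *
    toConv (s.γinv ∘ₗ LinearMap.mul' k H.quotAlg)).ofConv

/-- `u ↦ η⁻¹(u₁)₁ η(u₂) ⊗ η⁻¹(u₁)₂ η(u₃)`. -/
def coTwist : GroupAlg k O →ₗ[k] GroupAlg k O ⊗[k] GroupAlg k O :=
  (toConv (comul ∘ₗ s.ηinv) * toConv (TensorProduct.map s.η s.η ∘ₗ comul)).ofConv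

end Cleaving

/-- The left adjoint action `ad_ℓ(u)(v) = u₁ v S(u₂)` of a Hopf algebra on itself. -/
def adL (k A : Type*) [Field k] [Ring A] [HopfAlgebra k A] : A →ₗ[k] Module.End k A :=
  LinearMap.mul' k (Module.End k A) ∘ₗ
    TensorProduct.map (LinearMap.mul k A)
      ((LinearMap.mul k A).flip ∘ₗ HopfAlgebra.antipode k) ∘ₗ comul

lemma adL_apply {k A ι : Type*} [Field k] [Ring A] [HopfAlgebra k A] {u : A}
    (r : Coalgebra.Repr k u ι) (v : A) :
    adL k A u v = ∑ i ∈ r.index, r.left i * v * HopfAlgebra.antipode k (r.right i) := by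
  simp [adL, ← r.eq, mul_assoc]

/-- A triple `(K, H, B)`: normal subgroup schemes `K` and `H` of `G` that centralize each other,
and a `G`-equivariant Hopf algebra map `B : k[H] → O(K)`. -/
@[ext]
structure Triple (k O : Type u) [Field k] [CommRing O] [HopfAlgebra k O] [Module.Finite k O] where
  K : NormalSubgroup k O
  H : NormalSubgroup k O
  /-- `v w = w v` in `k[G]` for `v ∈ k[H]` and `w ∈ k[K]`. -/
  centralize : ∀ (v : H.groupAlg) (w : K.groupAlg), H.incl v * K.incl w = K.incl w * H.incl v
  /-- The map `B`; a map of bialgebras between Hopf algebras respects the antipodes. -/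
  B : H.groupAlg →ₐc[k] K.coord
  /-- `u * B(v) = B(ad_ℓ(u)(v))`, where `w = ad_ℓ(u)(v)` lies in `k[H]`. -/
  equivariant : ∀ (u : GroupAlg k O) (v w : H.groupAlg),
    H.incl w = adL k (GroupAlg k O) u (H.incl v) → K.act u (B v) = B w

/-! ### The quotient Hopf algebra `D(K, H, B)` -/

namespace Triple

variable {k O : Type u} [Field k] [CommRing O] [HopfAlgebra k O] [Module.Finite k O]

/-- `B` as a linear map on `k[G]`.  It is only ever applied to elements of the subspace `k[H]`,
on which it is given by `B`. -/
def BExt (t : Triple k O) : GroupAlg k O →ₗ[k] t.K.coord :=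
  (t.B : t.H.groupAlg →ₗ[k] t.K.coord) ∘ₗ LinearMap.leftInverse t.H.incl

lemma BExt_incl (t : Triple k O) (v : t.H.groupAlg) : t.BExt (t.H.incl v) = t.B v :=
  congrArg t.B (LinearMap.leftInverse_apply_of_inj
    (LinearMap.ker_eq_bot.mpr t.H.incl_injective) v)

/-- The underlying vector space `O(K) ⊗ k[G/H]` of `D(K, H, B)`; its element `a ⊗ x` is
written `a # x`. -/
abbrev Carrier (t : Triple k O) : Type u := t.K.coord ⊗[k] t.H.quotAlg

variable (t : Triple k O) (s : Cleaving t.H)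

/-- The action `x · a = γ(x) * a` of `k[G/H]` on `O(K)`. -/
def dot : t.H.quotAlg →ₗ[k] Module.End k t.K.coord := t.K.act ∘ₗ s.γ

/-- `σ(x, y) = B(γ(x₁) γ(y₁) γ⁻¹(x₂ y₂))`. -/
def σ : t.H.quotAlg ⊗[k] t.H.quotAlg →ₗ[k] t.K.coord := t.BExt ∘ₗ s.cocycle

/-- `τ(x) = (B ⊗ B)(η⁻¹(γ(x)₁)₁ η(γ(x)₂) ⊗ η⁻¹(γ(x)₁)₂ η(γ(x)₃))`. -/
def τ : t.H.quotAlg →ₗ[k] t.K.coord ⊗[k] t.K.coord :=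
  TensorProduct.map t.BExt t.BExt ∘ₗ s.coTwist ∘ₗ s.γ

/-- `x ⊗ y ↦ σ(x₁, y₁) # x₂ y₂`. -/
def crossed : t.H.quotAlg ⊗[k] t.H.quotAlg →ₗ[k] t.Carrier :=
  TensorProduct.map (t.σ s) (LinearMap.mul' k t.H.quotAlg) ∘ₗ comul

/-- The map `x ↦ (b # y ↦ (x₁ · b) σ(x₂, y₁) # x₃ y₂)`. -/
def leftMul : t.H.quotAlg →ₗ[k] Module.End k t.Carrier :=
  ((LinearMap.mul' k t.K.coord).rTensor t.H.quotAlg ∘ₗ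
      (TensorProduct.assoc k t.K.coord t.K.coord t.H.quotAlg).symm.toLinearMap).compRight k ∘ₗ
    TensorProduct.map₂ (t.dot s) (TensorProduct.curry (t.crossed s)) ∘ₗ comul

/-- The multiplication of `D(K, H, B)`,
`(a # x)(b # y) = a (x₁ · b) σ(x₂, y₁) # x₃ y₂`. -/
def mulD : t.Carrier →ₗ[k] t.Carrier →ₗ[k] t.Carrier :=
  TensorProduct.lift ((LinearMap.mul k (Module.End k t.Carrier)).compl₁₂
    (Algebra.lsmul k k t.Carrier).toLinearMap (t.leftMul s))

/-- The comultiplication of `D(K, H, B)`,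
`a # x ↦ (a₂ τ(x₁)¹ # x₂) ⊗ (a₁ τ(x₁)² # x₃)`. -/
def comulD : t.Carrier →ₗ[k] t.Carrier ⊗[k] t.Carrier :=
  (TensorProduct.tensorTensorTensorComm k t.K.coord t.K.coord t.H.quotAlg t.H.quotAlg).toLinearMap
    ∘ₗ (LinearMap.mul' k (t.K.coord ⊗[k] t.K.coord)).rTensor (t.H.quotAlg ⊗[k] t.H.quotAlg)
    ∘ₗ (TensorProduct.assoc k _ _ _).symm.toLinearMap
    ∘ₗ TensorProduct.map ((TensorProduct.comm k _ _).toLinearMap ∘ₗ comul)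
      (TensorProduct.map (t.τ s) comul ∘ₗ comul)

/-- The counit of `D(K, H, B)`, `a # x ↦ ε(a) ε(x)`. -/
def counitD : t.Carrier →ₗ[k] k :=
  LinearMap.mul' k k ∘ₗ TensorProduct.map counit counit

/-- The map `θ : D(G) → D(K, H, B)`, `b ⋈ u ↦ q(b) B(η(u₁)) # π(u₂)`. -/
def θ : Double k O →ₗ[k] t.Carrier :=
  show O ⊗[k] GroupAlg k O →ₗ[k] t.Carrier from
  LinearMap.mul' k t.Carrier ∘ₗ TensorProduct.map
    ((Algebra.TensorProduct.includeLeft : t.K.coord →ₐ[k] t.Carrier).toLinearMap ∘ₗ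
      t.K.q.toLinearMap)
    (TensorProduct.map (t.BExt ∘ₗ s.η) (t.H.proj : GroupAlg k O →ₗ[k] t.H.quotAlg) ∘ₗ comul)

lemma crossed_tmul {ι κ : Type*} {x y : t.H.quotAlg} (r : Coalgebra.Repr k x ι)
    (r' : Coalgebra.Repr k y κ) : t.crossed s (x ⊗ₜ y) = ∑ i ∈ r.index, ∑ j ∈ r'.index,
      t.σ s (r.left i ⊗ₜ r'.left j) ⊗ₜ (r.right i * r'.right j) := by
  rw [Finset.sum_comm]
  simp [crossed, TensorProduct.comul_tmul, ← r.eq, ← r'.eq, TensorProduct.sum_tmul,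
    TensorProduct.tmul_sum]

/-- The multiplication of `D(K, H, B)` in Sweedler form. -/
lemma mulD_tmul {ι : Type*} {κ : ι → Type*} {l : Type*} (a b : t.K.coord) {x y : t.H.quotAlg}
    (r : Coalgebra.Repr k x ι) (r₂ : ∀ i, Coalgebra.Repr k (r.right i) (κ i))
    (r' : Coalgebra.Repr k y l) :
    t.mulD s (a ⊗ₜ x) (b ⊗ₜ y) = ∑ i ∈ r.index, ∑ i' ∈ (r₂ i).index, ∑ j ∈ r'.index,
      (a * (t.dot s (r.left i) b * t.σ s ((r₂ i).left i' ⊗ₜ r'.left j))) ⊗ₜ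
        ((r₂ i).right i' * r'.right j) := by
  have h : t.mulD s (a ⊗ₜ x) (b ⊗ₜ y) = a • t.leftMul s x (b ⊗ₜ y) := rfl
  rw [h, leftMul, LinearMap.comp_apply, LinearMap.comp_apply, ← r.eq]
  simp only [map_sum, LinearMap.sum_apply, Finset.smul_sum]
  refine Finset.sum_congr rfl fun i _ => ?_
  simp [crossed_tmul t s (r₂ i) r', TensorProduct.tmul_sum, Finset.smul_sum,
    TensorProduct.smul_tmul']

/-- The comultiplication of `D(K, H, B)` in Sweedler form. -/
lemma comulD_tmul {ι κ : Type*} {l : κ → Type*} {a : t.K.coord} {x : t.H.quotAlg}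
    (p : Coalgebra.Repr k a ι) (r : Coalgebra.Repr k x κ)
    (r₂ : ∀ i, Coalgebra.Repr k (r.right i) (l i)) :
    t.comulD s (a ⊗ₜ x) = ∑ j ∈ p.index, ∑ i ∈ r.index, ∑ i' ∈ (r₂ i).index,
      TensorProduct.tensorTensorTensorComm k _ _ _ _
        (((p.right j ⊗ₜ p.left j) * t.τ s (r.left i)) ⊗ₜ ((r₂ i).left i' ⊗ₜ (r₂ i).right i')) := by
  simp only [comulD, LinearMap.comp_apply, TensorProduct.map_tmul, ← p.eq, ← r.eq, map_sum,
    TensorProduct.sum_tmul, TensorProduct.tmul_sum]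
  rw [Finset.sum_comm]
  refine Finset.sum_congr rfl fun j _ => Finset.sum_congr rfl fun i _ => ?_
  rw [← (r₂ i).eq]
  simp [TensorProduct.tmul_sum]

lemma θ_mk {ι : Type*} (b : O) {u : GroupAlg k O} (r : Coalgebra.Repr k u ι) :
    t.θ s (Double.mk b u) = ∑ i ∈ r.index,
      (t.K.q b * t.BExt (s.η (r.left i))) ⊗ₜ t.H.proj (r.right i) := by
  have h : t.θ s (Double.mk b u) = t.K.q b ⊗ₜ 1 * TensorProduct.map (t.BExt ∘ₗ s.η)
    (t.H.proj : GroupAlg k O →ₗ[k] t.H.quotAlg) (comul (R := k) u) := rfl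
  rw [h, ← r.eq]
  simp [Finset.mul_sum]

end Triple

/-! ### Representations and tensor subcategories -/

/-- A finite dimensional representation of the algebra `A`. -/
structure FDRep (k A : Type u) [Field k] [Ring A] [Algebra k A] where
  /-- The underlying vector space. -/
  V : Type u
  [addCommGroup : AddCommGroup V]
  [module : Module k V]
  [finite : Module.Finite k V]
  /-- The action of `A`. -/
  ρ : A →ₐ[k] Module.End k V

namespace FDRep

attribute [instance] addCommGroup module finite

section Algebra

variable {k A : Type u} [Field k] [Ring A] [Algebra k A]

/-- `f` is a homomorphism of representations. -/
def IsHom (X Y : FDRep k A) (f : X.V →ₗ[k] Y.V) : Prop :=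
  ∀ (a : A) (v : X.V), f (X.ρ a v) = Y.ρ a (f v)

/-- The direct sum of two representations. -/
def sum (X Y : FDRep k A) : FDRep k A where
  V := X.V × Y.V
  ρ := AlgHom.ofLinearMap
    (LinearMap.prodMapLinear k X.V Y.V X.V Y.V k ∘ₗ X.ρ.toLinearMap.prod Y.ρ.toLinearMap)
    (by ext <;> simp) (fun a b => by ext <;> simp)

end Algebra

section Hopf

variable {k A : Type u} [Field k] [Ring A] [HopfAlgebra k A]

variable (k A) in
/-- The unit object `k`, on which `A` acts through the counit. -/
def unit : FDRep k A where
  V := k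
  ρ := (Algebra.lmul k k).comp (Bialgebra.counitAlgHom k A)

/-- The tensor product, with action `a (v ⊗ w) = a₁ v ⊗ a₂ w`. -/
def tensor (X Y : FDRep k A) : FDRep k A where
  V := X.V ⊗[k] Y.V
  ρ := (Module.endTensorEndAlgHom (R := k) (S := k) (A := k) (M := X.V) (N := Y.V)).comp
    ((Algebra.TensorProduct.map X.ρ Y.ρ).comp (Bialgebra.comulAlgHom k A))

/-- The (left) dual, with action `⟨a f, v⟩ = ⟨f, S(a) v⟩`. -/
def dual (X : FDRep k A) : FDRep k A where
  V := Module.Dual k X.V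
  ρ := AlgHom.ofLinearMap
    (Module.Dual.transpose (R := k) (M := X.V) (M' := X.V) ∘ₗ X.ρ.toLinearMap ∘ₗ
      HopfAlgebra.antipode k)
    (by
      ext f v
      change f (X.ρ (HopfAlgebra.antipode k 1) v) = f v
      simp)
    (fun a b => by
      ext f v
      change f (X.ρ (HopfAlgebra.antipode k (a * b)) v) =
        f (X.ρ (HopfAlgebra.antipode k b) (X.ρ (HopfAlgebra.antipode k a) v))
      simp [HopfAlgebra.antipode_mul_antidistrib])

lemma unit_ρ (a : A) (c : k) : (unit k A).ρ a c = (counit (R := k) a * c : k) := rfl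

lemma tensor_ρ {ι : Type*} (X Y : FDRep k A) {a : A} (r : Coalgebra.Repr k a ι) (v : X.V)
    (w : Y.V) : (X.tensor Y).ρ a (v ⊗ₜ[k] w : X.V ⊗[k] Y.V) =
      (∑ i ∈ r.index, X.ρ (r.left i) v ⊗ₜ[k] Y.ρ (r.right i) w : X.V ⊗[k] Y.V) := by
  change Module.endTensorEndAlgHom (R := k) (S := k) (A := k) (M := X.V) (N := Y.V)
    (Algebra.TensorProduct.map X.ρ Y.ρ (comul a)) (v ⊗ₜ[k] w) = _
  simp only [← r.eq, map_sum, LinearMap.sum_apply]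
  rfl

lemma dual_ρ (X : FDRep k A) (a : A) (f : Module.Dual k X.V) (v : X.V) :
    (show Module.Dual k X.V from X.dual.ρ a f) v = f (X.ρ (HopfAlgebra.antipode k a) v) := rfl

end Hopf

end FDRep

/-- A tensor subcategory of `Rep(A)`: a full subcategory, given by its objects, that contains the
unit object and is closed under finite direct sums, subobjects and quotient objects (in
particular under isomorphism), tensor products, and left and right duals. -/
@[ext]
structure TensorSubcategory (k A : Type u) [Field k] [Ring A] [HopfAlgebra k A] where
  /-- The objects of the subcategory. -/
  obj : Set (FDRep k A)
  unit_mem : FDRep.unit k A ∈ obj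
  sum_mem : ∀ X ∈ obj, ∀ Y ∈ obj, X.sum Y ∈ obj
  sub_mem : ∀ Y ∈ obj, ∀ (X : FDRep k A) (f : X.V →ₗ[k] Y.V), X.IsHom Y f →
    Function.Injective f → X ∈ obj
  quot_mem : ∀ X ∈ obj, ∀ (Y : FDRep k A) (f : X.V →ₗ[k] Y.V), X.IsHom Y f →
    Function.Surjective f → Y ∈ obj
  tensor_mem : ∀ X ∈ obj, ∀ Y ∈ obj, X.tensor Y ∈ obj
  dual_mem : ∀ X ∈ obj, X.dual ∈ obj
  /-- Closure under right duals: `X` is the right dual of its left dual. -/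
  mem_of_dual_mem : ∀ X : FDRep k A, X.dual ∈ obj → X ∈ obj

namespace Triple

variable {k O : Type u} [Field k] [CommRing O] [HopfAlgebra k O] [Module.Finite k O]

/-- A representation of `D(K, H, B)` on the finite dimensional vector space `V`. -/
structure Action (t : Triple k O) (s : Cleaving t.H) (V : Type u) [AddCommGroup V]
    [Module k V] where
  /-- The action. -/
  act : t.Carrier →ₗ[k] Module.End k V
  act_one : act (1 ⊗ₜ 1) = 1
  act_mul : ∀ d e : t.Carrier, act (t.mulD s d e) = act d * act e

/-- The objects of `Z(K, H, B) = Rep(D(K, H, B))`, viewed in `Rep(D(G))` through `θ`: the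
representations of `D(G)` that are obtained from one of `D(K, H, B)` by restriction along `θ`. -/
def zObj (t : Triple k O) (s : Cleaving t.H) : Set (FDRep k (Double k O)) :=
  {X | ∃ α : t.Action s X.V, ∀ d : Double k O, X.ρ d = α.act (t.θ s d)}

/-- `θ : D(G) → D(K, H, B)` is a surjective map of Hopf algebras. -/
structure IsHopfQuotient (t : Triple k O) (s : Cleaving t.H) : Prop where
  surjective : Function.Surjective (t.θ s)
  map_one : t.θ s 1 = 1 ⊗ₜ 1
  map_mul : ∀ d e : Double k O, t.θ s (d * e) = t.mulD s (t.θ s d) (t.θ s e)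
  map_counit : ∀ d : Double k O, t.counitD (t.θ s d) = counit (R := k) d
  map_comul : ∀ d : Double k O, t.comulD s (t.θ s d) =
    TensorProduct.map (t.θ s) (t.θ s) (comul (R := k) d)
  antipode : ∃ S : t.Carrier →ₗ[k] t.Carrier, ∀ d : Double k O,
    S (t.θ s d) = t.θ s (HopfAlgebra.antipode k d)

end Triple

end

end FiniteGroupScheme

namespace FiniteGroupScheme

open scoped TensorProduct
open Coalgebra WithConv

noncomputable section

set_option linter.unusedSectionVars false

/-! ### The pairing of the group algebra with the coordinate algebra -/

section Pairing

variable {k O : Type*} [Field k] [CommRing O] [HopfAlgebra k O]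

/-! The problem is first turned into one about ideals. For `A = D(G)`, whose antipode is an
involution, tensor subcategories of `Rep(A)` are the same as Hopf ideals `J` of `A`. An object `X`
with the smallest annihilator `J` exists by finite dimensionality and closure under sums. The unit
object, `X ⊗ X` and the dual of `X` force `J` to be a Hopf ideal. As `A/J` embeds in a power of `X`,
every representation killed by `J` is a quotient of a sum of copies of a subobject of a power of `X`
(`exists_hopfIdeal`). Conversely `J` is recovered from the representation `A/J`
(`le_of_forall_mem`). What remains is that the kernels of the maps `θ` are exactly the Hopf ideals
of `D(G)`, each arising from one triple.

That `θ` is a Hopf map rests on a normal form: `D(G)` is spanned by the products `b v γ(x)` with `b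
∈ O(G)`, `v ∈ k[H]`, and `θ` sends such a product to `q(b) B(v) # x` (`θ_apply`). The rules for
moving `u ∈ k[G]` past `b` and past `v` become the action of `k[G]` on `O(K)`, the second one by
equivariance of `B`; this gives the product (`θ_mul`). The coproduct comes from a formula for
`Δ(γ(x))` (`comul_γ`). A triple is read off from `ker θ`: the ideal of `K` is `ker θ ∩ O(G)`, the
ideal of `H` is the image of `ker θ` in `k[G]`, and `B(v) = q(b)` exactly when `v - b ∈ ker θ`
(`eq_of_kerIdeal_eq`).

For surjectivity let `J` be a Hopf ideal. Then `J ∩ O(G)` defines a normal `K`, and the image of `J`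
in `k[G]` is a Hopf ideal, which belongs to a normal subgroup scheme `M` (`exists_augIdeal_eq`). The
coinvariants of `D(G)/J → k[G/M]` contain the images of `O(G)` and of `k[M]`. The main point is that
they equal the image of `O(G)`, which is `O(K)` (`coinvariants_le_range_quotO`). Hence `k[M]` maps
into `O(K)`; this map is `B`, and commutativity of `O(K)` makes `K` and `M` centralize each other. A
section of `k[G] → k[G/M]` then identifies `D(G)/J` with `O(K) ⊗ k[G/M]`, compatibly with `θ`, so
that `ker θ = J` (`kerIdeal_eq`).

Two general facts carry the weight. The first is the existence of sections (`nonempty_cleaving`):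
dually, one needs a convolution invertible retraction of `O(G)` onto the invariant functions. It is
obtained by interpolating over the finitely many points and inverting up to a nilpotent error
(`exists_retraction`). The second is a criterion for a commutative left coideal subalgebra `A` to
fill a left coideal `C ⊇ A`: it suffices that `C = A + A⁺C` (`le_of_le_sup_augmentation_mul`). A
character of `A` occurring in `C/A` would make its maximal ideal generate the unit left ideal,
against Nakayama. The criterion is used for `M` and for the coinvariants of `D(G)/J`; in both cases
a section supplies its hypothesis. -/

lemma adCoact_apply {ι : Type*} {κ : ι → Type*} {b : O} (r : Coalgebra.Repr k b ι)
    (r₂ : ∀ i, Coalgebra.Repr k (r.left i) (κ i)) :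
    adCoact k O b = ∑ i ∈ r.index, ∑ j ∈ (r₂ i).index,
      (r₂ i).right j ⊗ₜ[k] (HopfAlgebra.antipode k ((r₂ i).left j) * r.right i) := by
  set f : WithConv (O →ₐ[k] O ⊗[k] O) :=
    toConv (Algebra.TensorProduct.includeRight.comp (HopfAlgebra.antipodeAlgHom k O)) with hf
  set g : WithConv (O →ₐ[k] O ⊗[k] O) := toConv Algebra.TensorProduct.includeLeft with hg
  set h : WithConv (O →ₐ[k] O ⊗[k] O) := toConv Algebra.TensorProduct.includeRight with hh
  have e : adCoact k O b =
      (toConv (f * g).ofConv.toLinearMap * toConv h.ofConv.toLinearMap) b :=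
    congr($(AlgHom.toLinearMap_convMul (f * g) h).ofConv b)
  have e' (x : O) : (f * g).ofConv.toLinearMap x =
      (toConv f.ofConv.toLinearMap * toConv g.ofConv.toLinearMap) x :=
    congr($(AlgHom.toLinearMap_convMul f g).ofConv x)
  rw [e, r.convMul_apply]
  refine Finset.sum_congr rfl fun i _ => ?_
  change (f * g).ofConv.toLinearMap _ * _ = _
  rw [e', (r₂ i).convMul_apply, Finset.sum_mul]
  refine Finset.sum_congr rfl fun j _ => ?_
  simp [hf, hg, hh]

variable [Module.Finite k O]

/-- The coadjoint action is dual to conjugation. -/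
lemma pair_coadj {ι : Type*} {u : GroupAlg k O} (r : Coalgebra.Repr k u ι) (w : GroupAlg k O)
    (b : O) : w (coadj k O u b) =
      ∑ i ∈ r.index, (HopfAlgebra.antipode k (r.left i) * w * r.right i) b := by
  rw [coadj_apply, adCoact_apply (ℛ k b) (fun i => ℛ k _)]
  simp only [map_sum, slice_tmul, map_smul, smul_eq_mul, GroupAlg.apply_mul r,
    GroupAlg.mul_apply _ _ (ℛ k b), GroupAlg.mul_apply _ _ (ℛ k _), GroupAlg.antipode_apply,
    Finset.sum_mul]
  conv_rhs => rw [Finset.sum_comm]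
  refine Finset.sum_congr rfl fun i _ => ?_
  conv_rhs => rw [Finset.sum_comm]
  exact Finset.sum_congr rfl fun j _ => Finset.sum_congr rfl fun l _ => by ring

-- The antipode of a commutative Hopf algebra is the inverse of the identity in the group of algebra
-- endomorphisms under convolution, and inversion in a group is an involution.
omit [Module.Finite k O] in
lemma antipode_antipode_coord (a : O) :
    HopfAlgebra.antipode k (HopfAlgebra.antipode k a) = a := by
  have h := inv_inv (toConv (AlgHom.id k O))
  exact congr($(h).ofConv a)

lemma antipode_antipode_groupAlg (u : GroupAlg k O) :
    HopfAlgebra.antipode k (HopfAlgebra.antipode k u) = u :=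
  GroupAlg.ext fun a => by
    rw [GroupAlg.antipode_apply, GroupAlg.antipode_apply, antipode_antipode_coord]

/-- The antipode of the cocommutative Hopf algebra `k[G]` is a map of coalgebras. -/
def reprAntipode {ι : Type*} {u : GroupAlg k O} (r : Coalgebra.Repr k u ι) :
    Coalgebra.Repr k (HopfAlgebra.antipode k u) ι where
  index := r.index
  left i := HopfAlgebra.antipode k (r.left i)
  right i := HopfAlgebra.antipode k (r.right i)
  eq := GroupAlg.pair₂_ext fun a b => by
    rw [GroupAlg.pair₂_comul, GroupAlg.antipode_apply, HopfAlgebra.antipode_mul_distrib,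
      GroupAlg.apply_mul r]
    simp [GroupAlg.antipode_apply]

/-- The left adjoint action is dual to the coadjoint action. -/
lemma pair_adL (u w : GroupAlg k O) (b : O) :
    (adL k (GroupAlg k O) u w) b = w (coadj k O (HopfAlgebra.antipode k u) b) := by
  rw [pair_coadj (reprAntipode (ℛ k u)), adL_apply (ℛ k u), GroupAlg.sum_apply]
  exact Finset.sum_congr rfl fun i _ => by
    simp only [reprAntipode, antipode_antipode_groupAlg]

end Pairing

/-! ### The adjoint action and the commutation rule it gives -/

section Adjoint

variable {k A : Type*} [Field k] [Ring A] [HopfAlgebra k A]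

/-- `u v = ad(u₁)(v) u₂` -/
lemma mul_eq_sum_adL_mul {ι : Type*} {u : A} (r : Coalgebra.Repr k u ι) (v : A) :
    u * v = ∑ i ∈ r.index, adL k A (r.left i) v * r.right i := by
  -- Both bracketings of `u₁ v S(u₂) u₃` are compared: one groups the first two legs into the
  -- adjoint action, the other cancels `S(u₂) u₃`.
  have h := Coalgebra.sum_tmul_tmul_eq r (fun i => ℛ k (r.left i)) (fun i => ℛ k (r.right i))
  let Ψ : A ⊗[k] (A ⊗[k] A) →ₗ[k] A :=
    LinearMap.mul' k A ∘ₗ TensorProduct.map (LinearMap.mulRight k v)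
      (LinearMap.mul' k A ∘ₗ (HopfAlgebra.antipode k).rTensor A)
  have h' := congrArg Ψ h
  simp only [Ψ, map_sum, LinearMap.comp_apply, TensorProduct.map_tmul, LinearMap.mul'_apply,
    LinearMap.mulRight_apply, LinearMap.rTensor_tmul] at h'
  have h1 (i) : ∑ j ∈ (ℛ k (r.left i)).index, (ℛ k (r.left i)).left j * v *
      (HopfAlgebra.antipode k ((ℛ k (r.left i)).right j) * r.right i) =
      adL k A (r.left i) v * r.right i := by
    rw [adL_apply (ℛ k (r.left i)), Finset.sum_mul]
    simp only [mul_assoc]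
  have h2 (i) : ∑ j ∈ (ℛ k (r.right i)).index, r.left i * v *
      (HopfAlgebra.antipode k ((ℛ k (r.right i)).left j) * (ℛ k (r.right i)).right j) =
      counit (R := k) (r.right i) • (r.left i * v) := by
    rw [← Finset.mul_sum, HopfAlgebra.sum_antipode_mul_eq_smul, mul_smul_comm, mul_one]
  simp only [h1, h2] at h'
  rw [h']
  have h3 := congrArg (LinearMap.mulRight k v ∘ₗ (TensorProduct.rid k A).toLinearMap)
    (sum_tmul_counit_eq r)
  simp only [map_sum, LinearMap.comp_apply, LinearEquiv.coe_coe, TensorProduct.rid_tmul, map_smul,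
    LinearMap.mulRight_apply, one_smul] at h3
  exact h3.symm

end Adjoint

/-! ### Subgroups -/

namespace ClosedSubgroup

variable {k O : Type u} [Field k] [CommRing O] [HopfAlgebra k O] (L : ClosedSubgroup k O)

lemma q_eq_zero_iff {a : O} : L.q a = 0 ↔ a ∈ L.ideal := Ideal.Quotient.eq_zero_iff_mem

/-- The restriction map as a map of bialgebras. -/
def qBialg : O →ₐc[k] L.coord := Bialgebra.Quotient.mkBialgHom L.ideal

lemma qBialg_apply (a : O) : L.qBialg a = L.q a := rfl

lemma counit_q (a : O) : counit (R := k) (L.q a) = counit (R := k) a := rfl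

lemma comul_q (a : O) :
    comul (R := k) (L.q a) = TensorProduct.map L.q.toLinearMap L.q.toLinearMap (comul (R := k) a) :=
  rfl

lemma antipode_q (a : O) : HopfAlgebra.antipode k (L.q a) = L.q (HopfAlgebra.antipode k a) := rfl

/-- The inclusion `k[L] → k[G]` as a map of algebras. -/
def inclHom : L.groupAlg →ₐ[k] GroupAlg k O :=
  AlgHom.ofLinearMap L.incl (GroupAlg.ext fun a => by
      rw [incl_apply, GroupAlg.one_apply, GroupAlg.one_apply, counit_q]) fun v w =>
    GroupAlg.ext fun a => by
      rw [incl_apply, GroupAlg.mul_apply _ _ (ℛ k a), ← qBialg_apply,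
        GroupAlg.mul_apply v w ((ℛ k a).induced L.qBialg)]
      simp [Coalgebra.Repr.induced, qBialg_apply]

lemma inclHom_apply (v : L.groupAlg) : L.inclHom v = L.incl v := rfl

lemma incl_one : L.incl 1 = 1 := map_one L.inclHom

lemma incl_mul (v w : L.groupAlg) : L.incl (v * w) = L.incl v * L.incl w := map_mul L.inclHom v w

/-- A functional on `O(G)` descends to `O(L)` exactly when it kills the ideal of `L`. This makes
membership in `k[L]` a matter of testing on functions. -/
lemma mem_range_incl {u : GroupAlg k O} :
    u ∈ LinearMap.range L.incl ↔ ∀ a ∈ L.ideal, u a = 0 := by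
  constructor
  · rintro ⟨v, rfl⟩ a ha
    rw [incl_apply, L.q_eq_zero_iff.mpr ha, map_zero]
  · intro h
    let f : L.coord →ₗ[k] k :=
      (L.ideal.restrictScalars k).liftQ (GroupAlg.toDual k O u) h
    exact ⟨(GroupAlg.toDual k L.coord).symm f, GroupAlg.ext fun a => by
      rw [incl_apply, LinearEquiv.apply_symm_apply]; rfl⟩

/-- A subgroup is normal if its ideal is stable under the coadjoint action. -/
lemma isNormal_of_coadj_mem [Module.Finite k O]
    (h : ∀ (u : GroupAlg k O), ∀ b ∈ L.ideal, coadj k O u b ∈ L.ideal) : L.IsNormal := by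
  intro b hb
  have h1 (u : GroupAlg k O) : slice L.coord u (L.q.toLinearMap.rTensor O (adCoact k O b)) = 0 := by
    rw [slice_rTensor]
    exact L.q_eq_zero_iff.mpr (h u b hb)
  change L.q.toLinearMap.rTensor O (adCoact k O b) = 0
  generalize L.q.toLinearMap.rTensor O (adCoact k O b) = t at h1
  let β := Module.finBasis k O
  -- A tensor is rebuilt from its slices along a dual basis, so it vanishes once all slices do.
  have h2 : t = ∑ i, slice L.coord ((GroupAlg.toDual k O).symm (β.coord i)) t ⊗ₜ[k] β i := by
    clear h1
    induction t with
    | zero => simp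
    | add x y hx hy =>
      simp only [map_add, TensorProduct.add_tmul, Finset.sum_add_distrib, ← hx, ← hy]
    | tmul m a =>
      simp only [slice_tmul, LinearEquiv.apply_symm_apply, Module.Basis.coord_apply,
        TensorProduct.smul_tmul, ← TensorProduct.tmul_sum, β.sum_repr]
  rw [h2]
  simp [h1]

end ClosedSubgroup

namespace NormalSubgroup

variable {k O : Type u} [Field k] [CommRing O] [HopfAlgebra k O] (H : NormalSubgroup k O)

lemma coadj_mem (u : GroupAlg k O) {b : O} (hb : b ∈ H.ideal) : coadj k O u b ∈ H.ideal := by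
  rw [← H.q_eq_zero_iff, ← act_q, H.q_eq_zero_iff.mpr hb, map_zero]

variable [Module.Finite k O]

lemma antipode_incl (v : H.groupAlg) :
    HopfAlgebra.antipode k (H.incl v) = H.incl (HopfAlgebra.antipode k v) :=
  GroupAlg.ext fun a => by
    rw [GroupAlg.antipode_apply, ClosedSubgroup.incl_apply, ClosedSubgroup.incl_apply,
      GroupAlg.antipode_apply, ClosedSubgroup.antipode_q]

/-- The adjoint action is dual to the coadjoint one, which preserves the ideal of a normal `H`;
hence it preserves the annihilator `k[H]` of that ideal. -/
lemma exists_incl_eq_adL (u : GroupAlg k O) (v : H.groupAlg) :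
    ∃ w : H.groupAlg, H.incl w = adL k (GroupAlg k O) u (H.incl v) := by
  refine H.mem_range_incl.mpr fun a ha => ?_
  rw [pair_adL]
  exact H.mem_range_incl.mp ⟨v, rfl⟩ _ (H.coadj_mem _ ha)

lemma counit_adL (u v : GroupAlg k O) : counit (R := k) (adL k (GroupAlg k O) u v) =
    counit (R := k) u * counit (R := k) v := by
  rw [GroupAlg.counit_apply, pair_adL, coadj_one, map_smul, HopfAlgebra.counit_antipode,
    GroupAlg.counit_apply, GroupAlg.counit_apply, smul_eq_mul]

/-- A representation of `Δ(v)` in `k[H] ⊗ k[H]` gives one in `k[G] ⊗ k[G]`. -/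
def reprIncl {ι : Type*} {v : H.groupAlg} (r : Coalgebra.Repr k v ι) :
    Coalgebra.Repr k (H.incl v) ι where
  index := r.index
  left i := H.incl (r.left i)
  right i := H.incl (r.right i)
  eq := by rw [comul_incl, ← r.eq]; simp

/-- The group algebra of `H` as a subalgebra of the group algebra of `G`. -/
def sub : Subalgebra k (GroupAlg k O) := H.inclHom.range

lemma mem_sub_iff {u : GroupAlg k O} : u ∈ H.sub ↔ ∀ a ∈ H.ideal, u a = 0 := H.mem_range_incl

end NormalSubgroup

/-! ### Points of finite dimensional commutative algebras -/

section Points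

variable {k A : Type*} [Field k] [CommRing A] [Algebra k A] [Module.Finite k A]

/-- Distinct characters are linearly independent in a finite dimensional space. -/
instance finite_points : Finite (A →ₐ[k] k) :=
  (linearIndependent_toLinearMap k A k).finite

/-- Interpolation is dual to the independence of characters: a functional that vanishes on the image
of the joint evaluation map is a linear relation between the points. -/
lemma exists_point_eq (f : (A →ₐ[k] k) → k) : ∃ a : A, ∀ x : A →ₐ[k] k, x a = f x := by
  have hli := linearIndependent_toLinearMap k A k
  have hs : Function.Surjective (LinearMap.pi fun x : A →ₐ[k] k => x.toLinearMap) := by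
    have := Fintype.ofFinite (A →ₐ[k] k)
    classical
    rw [← LinearMap.dualMap_injective_iff, ← LinearMap.ker_eq_bot, LinearMap.ker_eq_bot']
    intro φ hφ
    have h1 := Fintype.linearIndependent_iff.mp hli (fun x => φ (Pi.single x 1)) (by
      refine LinearMap.ext fun a => ?_
      rw [LinearMap.zero_apply, ← show φ (LinearMap.pi (fun x : A →ₐ[k] k => x.toLinearMap) a) = 0
        from congr($hφ a), LinearMap.pi_apply_eq_sum_univ φ]
      simp only [LinearMap.sum_apply, LinearMap.smul_apply, AlgHom.toLinearMap_apply, smul_eq_mul,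
        LinearMap.pi_apply]
      refine Finset.sum_congr rfl fun x _ => ?_
      rw [mul_comm]
      congr 2
      ext y
      simp [Pi.single_apply, eq_comm])
    refine LinearMap.pi_ext' fun x => LinearMap.ext_ring ?_
    simpa using h1 x
  obtain ⟨a, ha⟩ := hs f
  exact ⟨a, fun x => congrFun ha x⟩

variable [IsAlgClosed k]

/-- The residue field is finite over the algebraically closed `k`, hence equal to it. -/
lemma exists_point_ker_eq (m : Ideal A) [hm : m.IsMaximal] :
    ∃ x : A →ₐ[k] k, ∀ a, x a = 0 ↔ a ∈ m := by
  let := Ideal.Quotient.field m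
  let e : k ≃ₐ[k] A ⧸ m := AlgEquiv.ofBijective (Algebra.ofId k (A ⧸ m))
    (IsAlgClosed.algebraMap_bijective_of_isIntegral (k := k) (K := A ⧸ m))
  refine ⟨e.symm.toAlgHom.comp (Ideal.Quotient.mkₐ k m), fun a => ?_⟩
  simp [Ideal.Quotient.eq_zero_iff_mem]

lemma isUnit_of_point_ne_zero {a : A} (h : ∀ x : A →ₐ[k] k, x a ≠ 0) : IsUnit a := by
  by_contra ha
  obtain ⟨m, hm, ham⟩ := exists_max_ideal_of_mem_nonunits ha
  obtain ⟨x, hx⟩ := exists_point_ker_eq (k := k) m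
  exact h x ((hx a).mpr ham)

/-- The ideal of functions that vanish at all points is nilpotent. -/
lemma exists_pow_eq_bot_of_point_eq_zero :
    ∃ n : ℕ, (⨅ x : A →ₐ[k] k, RingHom.ker x) ^ n = ⊥ := by
  have : IsArtinianRing A := IsArtinianRing.of_finite k A
  -- A function that vanishes at all points lies in every maximal ideal, since each of these is the
  -- kernel of a point; so it lies in the nilpotent Jacobson radical.
  obtain ⟨n, hn⟩ := IsArtinianRing.isNilpotent_jacobson_bot (R := A)
  refine ⟨n, ?_⟩
  rw [eq_bot_iff, ← Ideal.zero_eq_bot, ← hn]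
  refine Ideal.pow_right_mono ?_ n
  rw [Ideal.jacobson, le_sInf_iff]
  rintro m ⟨-, hm⟩ a ha
  obtain ⟨x, hx⟩ := exists_point_ker_eq (k := k) m
  exact (hx a).mp (by simpa using (Ideal.mem_iInf.mp ha) x)

/-- The extension is integral, so a maximal ideal lies over the kernel of `x`; its residue field is
again `k`. -/
lemma exists_point_extending (A₀ : Subalgebra k A) (x : A₀ →ₐ[k] k) :
    ∃ y : A →ₐ[k] k, ∀ a : A₀, y a = x a := by
  have : Algebra.IsIntegral k A := inferInstance
  have : Algebra.IsIntegral A₀ A := Algebra.IsIntegral.tower_top k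
  have hker : (RingHom.ker x).IsMaximal :=
    RingHom.ker_isMaximal_of_surjective x (fun c => ⟨algebraMap k A₀ c, by simp⟩)
  obtain ⟨P, hP, hP'⟩ := Ideal.exists_ideal_over_maximal_of_isIntegral (S := A) (RingHom.ker x)
    (by
      have : RingHom.ker (algebraMap A₀ A) = ⊥ :=
        (RingHom.injective_iff_ker_eq_bot _).mp Subtype.val_injective
      rw [this]; exact bot_le)
  obtain ⟨y, hy⟩ := exists_point_ker_eq (k := k) P
  refine ⟨y, fun a => ?_⟩
  have h1 : a - algebraMap k A₀ (x a) ∈ RingHom.ker x := by simp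
  rw [← hP', Ideal.mem_comap, ← hy, map_sub, map_sub, sub_eq_zero] at h1
  refine h1.trans ?_
  change y (algebraMap k A (x a)) = x a
  simp

end Points

/-- Over an infinite field, finitely many surjective maps onto the same space have a common
family of vectors whose images are bases. -/
lemma exists_forall_linearIndependent {k V W ι : Type*} [Field k] [Infinite k] [AddCommGroup V]
    [Module k V] [AddCommGroup W] [Module k W] [Module.Finite k W] [Finite ι]
    (f : ι → V →ₗ[k] W) (hf : ∀ i, Function.Surjective (f i)) (n : ℕ)
    (hn : n ≤ Module.finrank k W) :
    ∃ v : Fin n → V, ∀ i, LinearIndependent k (f i ∘ v) := by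
  induction n with
  | zero => exact ⟨Fin.elim0, fun i => linearIndependent_empty_type⟩
  | succ n ih =>
    obtain ⟨v, hv⟩ := ih (by omega)
    have h : ∃ w : V, ∀ i, f i w ∉ Submodule.span k (Set.range (f i ∘ v)) := by
      by_contra! hcon
      -- A vector space over an infinite field is not a finite union of proper subspaces. If no new
      -- vector worked for all maps at once, one of the spans would be all of `W`, although it has
      -- dimension `n < dim W`.
      obtain ⟨i, hi⟩ := Subspace.exists_eq_top_of_iUnion_eq_univ
        (p := fun i => (Submodule.span k (Set.range (f i ∘ v))).comap (f i))
        (Set.eq_univ_of_forall fun w => by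
          obtain ⟨i, hi⟩ := hcon w
          exact Set.mem_iUnion.mpr ⟨i, hi⟩)
      have h1 : Submodule.span k (Set.range (f i ∘ v)) = ⊤ := by
        rw [eq_top_iff]
        intro w _
        obtain ⟨w, rfl⟩ := hf i w
        have : w ∈ (Submodule.span k (Set.range (f i ∘ v))).comap (f i) := hi ▸ Submodule.mem_top
        exact this
      have h2 := finrank_span_eq_card (hv i)
      rw [h1, finrank_top, Fintype.card_fin] at h2
      omega
    obtain ⟨w, hw⟩ := h
    refine ⟨Fin.cons w v, fun i => ?_⟩
    have : f i ∘ (Fin.cons w v : Fin (n + 1) → V) = Fin.cons (f i w) (f i ∘ v) := by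
      ext j
      refine Fin.cases ?_ (fun j => ?_) j <;> simp
    rw [this]
    exact linearIndependent_finCons.mpr ⟨hv i, hw i⟩

/-! ### Invariant functions -/

namespace ClosedSubgroup

variable {k O : Type u} [Field k] [CommRing O] [HopfAlgebra k O] (L : ClosedSubgroup k O)

/-- The coaction `b ↦ b₁ ⊗ q(b₂)` of `O(L)` on `O(G)`, the comorphism of `G × L → G`. -/
def coactR : O →ₐ[k] O ⊗[k] L.coord :=
  (Algebra.TensorProduct.map (AlgHom.id k O) L.q).comp (Bialgebra.comulAlgHom k O)

lemma coactR_apply (b : O) : L.coactR b = L.q.toLinearMap.lTensor O (comul (R := k) b) := rfl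

/-- The functions on `G` that are invariant under right translation by `L`. -/
def invariants : Subalgebra k O :=
  AlgHom.equalizer L.coactR Algebra.TensorProduct.includeLeft

lemma mem_invariants {b : O} : b ∈ L.invariants ↔ L.coactR b = b ⊗ₜ 1 := Iff.rfl

lemma coactR_coassoc (b : O) :
    L.coactR.toLinearMap.rTensor L.coord (L.coactR b) =
      (TensorProduct.assoc k O L.coord L.coord).symm
        ((comul (R := k) (A := L.coord)).lTensor O (L.coactR b)) := by
  let Ψ : (O ⊗[k] O) ⊗[k] O →ₗ[k] (O ⊗[k] L.coord) ⊗[k] L.coord :=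
    TensorProduct.map (L.q.toLinearMap.lTensor O) L.q.toLinearMap
  have h := congrArg Ψ (coassoc_symm_apply (R := k) b)
  have h1 (t : O ⊗[k] O) : Ψ (comul.rTensor O t) =
      L.coactR.toLinearMap.rTensor L.coord (L.q.toLinearMap.lTensor O t) := by
    induction t with
    | zero => simp
    | add x y hx hy => simp only [map_add, hx, hy]
    | tmul x y => rfl
  have h2 (t : O ⊗[k] O) : Ψ ((TensorProduct.assoc k O O O).symm (comul.lTensor O t)) =
      (TensorProduct.assoc k O L.coord L.coord).symm
        ((comul (R := k) (A := L.coord)).lTensor O (L.q.toLinearMap.lTensor O t)) := by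
    have h3 (s : O ⊗[k] (O ⊗[k] O)) : Ψ ((TensorProduct.assoc k O O O).symm s) =
        (TensorProduct.assoc k O L.coord L.coord).symm (TensorProduct.map LinearMap.id
          (TensorProduct.map L.q.toLinearMap L.q.toLinearMap) s) := by
      have : Ψ ∘ₗ (TensorProduct.assoc k O O O).symm.toLinearMap =
          (TensorProduct.assoc k O L.coord L.coord).symm.toLinearMap ∘ₗ
          (TensorProduct.map LinearMap.id
            (TensorProduct.map L.q.toLinearMap L.q.toLinearMap)) := by
        ext x y z; rfl
      exact congr($this s)
    rw [h3]
    induction t with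
    | zero => simp
    | add x y hx hy => simp only [map_add, hx, hy]
    | tmul x y => rfl
  rw [h1, h2] at h
  exact h.symm

lemma counit_lTensor_coactR (b : O) :
    TensorProduct.rid k O ((counit (R := k) (A := L.coord)).lTensor O (L.coactR b)) = b := by
  have h1 (t : O ⊗[k] O) : (counit (R := k) (A := L.coord)).lTensor O
      (L.q.toLinearMap.lTensor O t) = (counit (R := k) (A := O)).lTensor O t := by
    induction t with
    | zero => simp
    | add x y hx hy => simp only [map_add, hx, hy]
    | tmul x y => rfl
  rw [coactR_apply, h1, lTensor_counit_comul]
  simp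

lemma counit_rTensor_coactR (b : O) :
    TensorProduct.lid k L.coord ((counit (R := k) (A := O)).rTensor L.coord (L.coactR b)) =
      L.q b := by
  have h1 (t : O ⊗[k] O) : (counit (R := k) (A := O)).rTensor L.coord
      (L.q.toLinearMap.lTensor O t) =
      L.q.toLinearMap.lTensor k ((counit (R := k) (A := O)).rTensor O t) := by
    induction t with
    | zero => simp
    | add x y hx hy => simp only [map_add, hx, hy]
    | tmul x y => rfl
  rw [coactR_apply, h1, rTensor_counit_comul]
  simp

/-- The restriction to `L` of the translate of a function by a point `g`. -/
def translate (g : O →ₐ[k] k) : O →ₗ[k] L.coord :=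
  (TensorProduct.lid k L.coord).toLinearMap ∘ₗ g.toLinearMap.rTensor L.coord ∘ₗ
    L.coactR.toLinearMap

lemma translate_apply (g : O →ₐ[k] k) {ι : Type*} {b : O} (r : Coalgebra.Repr k b ι) :
    L.translate g b = ∑ i ∈ r.index, g (r.left i) • L.q (r.right i) := by
  simp [translate, coactR_apply, ← r.eq]

/-- Translation by the point `g` is inverted by translation by `g ∘ S`, and restriction to `L` is
onto. -/
lemma translate_surjective (g : O →ₐ[k] k) : Function.Surjective (L.translate g) := by
  intro y
  obtain ⟨b, rfl⟩ := L.q_surjective y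
  let r := ℛ k b
  refine ⟨∑ i ∈ r.index, g (HopfAlgebra.antipode k (r.left i)) • r.right i, ?_⟩
  let Ψ : O ⊗[k] (O ⊗[k] O) →ₗ[k] L.coord := TensorProduct.lift
    ((LinearMap.lsmul k (O ⊗[k] O →ₗ[k] L.coord)).flip
      (TensorProduct.lift ((LinearMap.lsmul k (O →ₗ[k] L.coord)).flip
        L.q.toLinearMap ∘ₗ g.toLinearMap)) ∘ₗ g.toLinearMap ∘ₗ HopfAlgebra.antipode k)
  have h := congrArg Ψ
    (Coalgebra.sum_tmul_tmul_eq r (fun i => ℛ k (r.left i)) (fun i => ℛ k (r.right i)))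
  have hΨ (x y z : O) : Ψ (x ⊗ₜ (y ⊗ₜ z)) =
      g (HopfAlgebra.antipode k x) • g y • L.q z := rfl
  simp only [map_sum, hΨ] at h
  rw [map_sum]
  have h0 (i) : L.translate g (g (HopfAlgebra.antipode k (r.left i)) • r.right i) =
      ∑ j ∈ (ℛ k (r.right i)).index, g (HopfAlgebra.antipode k (r.left i)) •
        g ((ℛ k (r.right i)).left j) • L.q ((ℛ k (r.right i)).right j) := by
    rw [map_smul, L.translate_apply g (ℛ k _), Finset.smul_sum]
  simp only [h0]
  rw [← h]
  have h2 (i) : ∑ j ∈ (ℛ k (r.left i)).index,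
      g (HopfAlgebra.antipode k ((ℛ k (r.left i)).left j)) * g ((ℛ k (r.left i)).right j) =
      counit (R := k) (r.left i) := by
    have := congrArg g (HopfAlgebra.sum_antipode_mul_eq_smul (ℛ k (r.left i)))
    simpa using this
  simp only [smul_smul, ← Finset.sum_smul, h2]
  simp only [← map_smul]
  rw [← map_sum, sum_counit_smul]

variable [Module.Finite k O]

/-- The basis of `O(G) ⊗ O(L)` over `O(G)` given by a basis of `O(L)`. -/
abbrev coordBasis (R : Type*) [CommRing R] [Algebra k R] :
    Module.Basis (Fin (Module.finrank k L.coord)) R (R ⊗[k] L.coord) :=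
  Algebra.TensorProduct.basis R (Module.finBasis k L.coord)

/-- The coefficients of the coaction of `O(L)` on `O(G)`. -/
def coeff (b : O) : Fin (Module.finrank k L.coord) → O :=
  (L.coordBasis O).equivFun (L.coactR b)

lemma sum_coeff_tmul (b : O) :
    ∑ j, L.coeff b j ⊗ₜ[k] Module.finBasis k L.coord j = L.coactR b := by
  have := (L.coordBasis O).sum_equivFun (L.coactR b)
  simpa [TensorProduct.smul_tmul', coeff] using this

lemma coeff_mul {c : O} (hc : c ∈ L.invariants) (b : O) (j) :
    L.coeff (c * b) j = c * L.coeff b j := by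
  have h : L.coactR (c * b) = c • L.coactR b := by
    rw [map_mul, L.mem_invariants.mp hc]
    generalize L.coactR b = t
    induction t with
    | zero => simp
    | add x y hx hy => rw [mul_add, smul_add, hx, hy]
    | tmul x y => simp [TensorProduct.smul_tmul']
  simp only [coeff, h, map_smul]
  rfl

lemma coeff_add (b c : O) : L.coeff (b + c) = L.coeff b + L.coeff c := by
  simp [coeff]

lemma coeff_smul (x : k) (c : O) : L.coeff (x • c) = x • L.coeff c := by
  simp only [coeff, map_smul]
  ext j
  rw [← algebraMap_smul O x, map_smul]
  simp [Algebra.smul_def]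

/-- The matrix coefficients of the comultiplication of `O(L)`. -/
def comulMatrix : Matrix (Fin (Module.finrank k L.coord)) (Fin (Module.finrank k L.coord)) L.coord :=
  fun l => (L.coordBasis L.coord).equivFun (comul (R := k) (Module.finBasis k L.coord l))

/-- Coassociativity of the coaction, read in a basis of `O(L)`. The coefficient vectors of all `b`
transform by the same matrix, and this common factor can be cancelled when invariants are
constructed. -/
lemma coactR_coeff (b : O) (j) : L.coactR (L.coeff b j) =
    ∑ l, L.coeff b l ⊗ₜ[k] L.comulMatrix l j := by
  have h := L.coactR_coassoc b
  have h1 (l) : comul (R := k) (Module.finBasis k L.coord l) =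
      ∑ j, L.comulMatrix l j ⊗ₜ[k] Module.finBasis k L.coord j := by
    have := (L.coordBasis L.coord).sum_equivFun (comul (R := k) (Module.finBasis k L.coord l))
    rw [← this]
    simp [TensorProduct.smul_tmul', comulMatrix]
  simp only [← L.sum_coeff_tmul b, map_sum, LinearMap.rTensor_tmul, LinearMap.lTensor_tmul, h1,
    TensorProduct.tmul_sum, TensorProduct.assoc_symm_tmul] at h
  rw [Finset.sum_comm] at h
  simp only [← TensorProduct.sum_tmul] at h
  have h2 (t : Fin (Module.finrank k L.coord) → O ⊗[k] L.coord) :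
      (L.coordBasis (O ⊗[k] L.coord)).equivFun
        (∑ j, t j ⊗ₜ[k] Module.finBasis k L.coord j) = t := by
    have : ∑ j, t j ⊗ₜ[k] Module.finBasis k L.coord j =
        ∑ j, t j • L.coordBasis (O ⊗[k] L.coord) j := by
      simp [TensorProduct.smul_tmul']
    rw [this, Module.Basis.equivFun_apply, Module.Basis.repr_sum_self]
  have h3 := congrArg (L.coordBasis (O ⊗[k] L.coord)).equivFun h
  rw [h2, h2] at h3
  exact congrFun h3 j

end ClosedSubgroup

namespace ClosedSubgroup

variable {k O : Type u} [Field k] [CommRing O] [HopfAlgebra k O] [Module.Finite k O]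
  (L : ClosedSubgroup k O)

lemma translate_eq_sum_coeff (g : O →ₐ[k] k) (b : O) :
    L.translate g b = ∑ j, g (L.coeff b j) • Module.finBasis k L.coord j := by
  have : L.translate g b = TensorProduct.lid k L.coord
    (g.toLinearMap.rTensor L.coord (L.coactR b)) := rfl
  rw [this, ← L.sum_coeff_tmul b]
  simp

/-- There are functions `aᵢ` whose images under the coaction form a basis of `O(G) ⊗ O(L)`
over `O(G)`. -/
lemma exists_isUnit_coeff [IsAlgClosed k] :
    ∃ a : Fin (Module.finrank k L.coord) → O,
      IsUnit (Matrix.of fun i => L.coeff (a i) :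
        Matrix (Fin (Module.finrank k L.coord)) (Fin (Module.finrank k L.coord)) O) := by
  -- The functions are chosen once for all points: their translates by every `g` form a basis of
  -- `O(L)`. The determinant of the coefficient matrix is then nonzero at every point, hence a unit.
  obtain ⟨a, ha⟩ := exists_forall_linearIndependent (fun g : O →ₐ[k] k => L.translate g)
    (fun g => L.translate_surjective g) _ le_rfl
  refine ⟨a, (Matrix.isUnit_iff_isUnit_det _).mpr
    (isUnit_of_point_ne_zero (k := k) fun g => ?_)⟩
  have h := (ha g).map' (Module.finBasis k L.coord).equivFun.toLinearMap (LinearEquiv.ker _)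
  have h1 : (Module.finBasis k L.coord).equivFun.toLinearMap ∘ (L.translate g ∘ a) =
      (Matrix.of fun i => L.coeff (a i)).map g := by
    ext i j
    simp [translate_eq_sum_coeff, Finsupp.single_apply]
  rw [h1] at h
  have h2 : IsUnit ((Matrix.of fun i => L.coeff (a i)).map g) :=
    Matrix.linearIndependent_rows_iff_isUnit.mp h
  rw [AlgHom.map_det]
  exact ((Matrix.isUnit_iff_isUnit_det _).mp h2).ne_zero

/-- `O(G)` is a projective module over the subalgebra of `L`-invariants, and the ideal of `L` is
generated by invariant functions that vanish at the origin. -/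
lemma exists_dualBasis [IsAlgClosed k] :
    ∃ (n : ℕ) (a : Fin n → O) (l : Fin n → O →ₗ[k] O),
      (∀ i b, l i b ∈ L.invariants) ∧
      (∀ i, ∀ c ∈ L.invariants, ∀ b, l i (c * b) = c * l i b) ∧
      (∀ b, ∑ i, l i b * a i = b) ∧
      ∀ b ∈ L.ideal, ∀ i, counit (R := k) (l i b) = 0 := by
  obtain ⟨a, ha⟩ := L.exists_isUnit_coeff
  set m := (Matrix.of fun i => L.coeff (a i) :
        Matrix (Fin (Module.finrank k L.coord)) (Fin (Module.finrank k L.coord)) O) with hm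
  obtain ⟨m', hm', hm''⟩ := isUnit_iff_exists.mp ha
  have hl (b : O) : Matrix.vecMul (Matrix.vecMul (L.coeff b) m') m = L.coeff b := by
    rw [Matrix.vecMul_vecMul, hm'', Matrix.vecMul_one]
  refine ⟨_, a, fun i =>
    { toFun := fun b => Matrix.vecMul (L.coeff b) m' i
      map_add' := fun b c => by simp [coeff_add, Matrix.add_vecMul]
      map_smul' := fun x c => by simp [coeff_smul, Matrix.smul_vecMul] }, ?_, ?_, ?_, ?_⟩
  · intro i b
    let d : Matrix (Fin (Module.finrank k L.coord)) (Fin (Module.finrank k L.coord))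
      (O ⊗[k] L.coord) := fun l j => 1 ⊗ₜ L.comulMatrix l j
    let ι : O →ₐ[k] O ⊗[k] L.coord := Algebra.TensorProduct.includeLeft
    have h1 (b : O) : L.coactR ∘ L.coeff b = Matrix.vecMul (ι ∘ L.coeff b) d := by
      ext j
      simp [coactR_coeff, Matrix.vecMul, dotProduct, d, ι]
    have h2 : m.map L.coactR = m.map ι * d := by
      ext i j
      exact congrFun (h1 (a i)) j
    -- With `v` the row `coeff(b) m⁻¹`, both sides are the image of `coeff(b)` under the coaction:
    -- it multiplies `coeff(b)` and `m` by the same matrix `d`. Cancelling the invertible image of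
    -- `m` shows that the entries of `v` are invariant.
    have h3 : Matrix.vecMul (L.coactR ∘ Matrix.vecMul (L.coeff b) m') (m.map L.coactR) =
        Matrix.vecMul (ι ∘ Matrix.vecMul (L.coeff b) m') (m.map L.coactR) := by
      have h4 := RingHom.map_vecMul (L.coactR : O →+* O ⊗[k] L.coord) m
        (Matrix.vecMul (L.coeff b) m')
      have h5 := RingHom.map_vecMul (ι : O →+* O ⊗[k] L.coord) m
        (Matrix.vecMul (L.coeff b) m')
      rw [hl] at h4 h5
      have h6 : Matrix.vecMul (ι ∘ Matrix.vecMul (L.coeff b) m') (m.map ι) = ι ∘ L.coeff b :=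
        (funext h5).symm
      refine (funext h4).symm.trans ((h1 b).trans ?_)
      rw [h2, ← Matrix.vecMul_vecMul, h6]
    have h7 : m.map L.coactR * m'.map L.coactR = 1 := by
      rw [← Matrix.map_mul, hm', Matrix.map_one _ (map_zero _) (map_one _)]
    have h8 := congrArg (fun v => Matrix.vecMul v (m'.map L.coactR)) h3
    simp only [Matrix.vecMul_vecMul, h7, Matrix.vecMul_one] at h8
    exact congrFun h8 i
  · intro i c hc b
    have : L.coeff (c * b) = c • L.coeff b := funext fun j => L.coeff_mul hc b j
    simp [this, Matrix.smul_vecMul]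
  · intro b
    -- Counitality of the coaction recovers a function from its coefficients; applied to `b` and to
    -- the `a i`, it turns `v m = coeff(b)` into the expansion of `b`.
    have h1 (b : O) : ∑ j, L.coeff b j * algebraMap k O
        (counit (R := k) (Module.finBasis k L.coord j)) = b := by
      have := L.counit_lTensor_coactR b
      rw [← L.sum_coeff_tmul b] at this
      simpa [Algebra.smul_def, mul_comm] using this
    have h2 (i) : a i = ∑ j, m i j * algebraMap k O
        (counit (R := k) (Module.finBasis k L.coord j)) := (h1 (a i)).symm
    calc _ = ∑ j, Matrix.vecMul (Matrix.vecMul (L.coeff b) m') m j * algebraMap k O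
          (counit (R := k) (Module.finBasis k L.coord j)) := by
          simp only [LinearMap.coe_mk, AddHom.coe_mk]
          conv_lhs => enter [2, i]; rw [h2 i, Finset.mul_sum]
          rw [Finset.sum_comm]
          refine Finset.sum_congr rfl fun j _ => ?_
          rw [Matrix.vecMul, dotProduct, Finset.sum_mul]
          simp only [mul_assoc]
      _ = b := by rw [hl, h1]
  · intro b hb i
    -- At the origin the coefficients of `b` are the coordinates of `q(b)`, which is zero.
    have h1 := L.counit_rTensor_coactR b
    rw [← L.sum_coeff_tmul b, L.q_eq_zero_iff.mpr hb] at h1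
    simp only [map_sum, LinearMap.rTensor_tmul, TensorProduct.lid_tmul] at h1
    have h2 := Fintype.linearIndependent_iff.mp (Module.finBasis k L.coord).linearIndependent _ h1
    simp [Matrix.vecMul, dotProduct, h2]

end ClosedSubgroup

/-- A linear map from a coalgebra to a commutative algebra whose values at all points vanish is
nilpotent for the convolution product. -/
lemma isNilpotent_conv {k C A : Type*} [Field k] [IsAlgClosed k] [CommRing A] [Algebra k A]
    [Module.Finite k A] [AddCommGroup C] [Module k C] [Coalgebra k C]
    (f : WithConv (C →ₗ[k] A)) (hf : ∀ (x : A →ₐ[k] k) c, x (f c) = 0) : IsNilpotent f := by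
  obtain ⟨n, hn⟩ := exists_pow_eq_bot_of_point_eq_zero (k := k) (A := A)
  have key (m : ℕ) (c : C) : (f ^ m) c ∈ (⨅ x : A →ₐ[k] k, RingHom.ker x) ^ m := by
    induction m generalizing c with
    | zero => simp
    | succ m ih =>
      rw [pow_succ, pow_succ, (ℛ k c).convMul_apply]
      exact Ideal.sum_mem _ fun i _ => Ideal.mul_mem_mul (ih _)
        (Ideal.mem_iInf.mpr fun x => hf x _)
  refine ⟨n, WithConv.ext (LinearMap.ext fun c => ?_)⟩
  have := key n c
  rw [hn] at this
  exact this

/-! ### A convolution invertible retraction onto the invariant functions -/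

namespace ClosedSubgroup

variable {k O : Type u} [Field k] [CommRing O] [HopfAlgebra k O] [Module.Finite k O]
  (L : ClosedSubgroup k O)

/-- The ideal of `L` is generated by invariant functions that vanish at the origin. -/
lemma mem_span_of_mem_ideal [IsAlgClosed k] {b : O} (hb : b ∈ L.ideal) :
    b ∈ Ideal.span {a | a ∈ L.invariants ∧ counit (R := k) a = 0} := by
  obtain ⟨n, a, l, h1, -, h3, h4⟩ := L.exists_dualBasis
  rw [← h3 b]
  exact Ideal.sum_mem _ fun i _ => Ideal.mul_mem_right _ _ (Ideal.subset_span ⟨h1 i b, h4 b hb i⟩)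

/-- The inclusion of the invariant functions in all functions has a convolution invertible
retraction. -/
lemma exists_retraction [IsAlgClosed k] :
    ∃ E F : O →ₗ[k] L.invariants, (∀ (c : L.invariants) (b : O), E (c * b) = c * E b) ∧ E 1 = 1 ∧
      (∀ b, counit (R := k) (E b : O) = counit (R := k) b) ∧
      toConv E * toConv F = 1 ∧ toConv F * toConv E = 1 := by
  classical
  obtain ⟨n, a, l, h1, h2, h3, -⟩ := L.exists_dualBasis
  let ε₀ : L.invariants →ₐ[k] k := (Bialgebra.counitAlgHom k O).comp L.invariants.val
  -- Every point of the algebra of invariants is lifted to a point of `G`. The base point is lifted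
  -- to the identity of `G`, which later makes the retraction preserve the counit.
  have hy (x : L.invariants →ₐ[k] k) : ∃ y : O →ₐ[k] k, (∀ c : L.invariants, y c = x c) ∧
      (x = ε₀ → y = Bialgebra.counitAlgHom k O) := by
    by_cases h : x = ε₀
    · exact ⟨Bialgebra.counitAlgHom k O, fun c => by rw [h]; rfl, fun _ => rfl⟩
    · obtain ⟨y, hy⟩ := exists_point_extending L.invariants x
      exact ⟨y, hy, fun h' => absurd h' h⟩
  choose y hy hyε using hy
  -- Each `a i` in the expansion of `b` is replaced by an invariant `c i` with the same values at
  -- the chosen lifts. The result `E₀` is linear over the invariants, and composed with a point `x`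
  -- it becomes the algebra map `y x`.
  have hc (i : Fin n) := exists_point_eq (k := k) (A := L.invariants) (fun x => y x (a i))
  choose c hc using hc
  let l' (i : Fin n) : O →ₗ[k] L.invariants :=
    (l i).codRestrict (Subalgebra.toSubmodule L.invariants) (h1 i)
  let E₀ : O →ₗ[k] L.invariants := ∑ i, LinearMap.mulRight k (c i) ∘ₗ l' i
  have hE₀ (b : O) : E₀ b = ∑ i, l' i b * c i := by simp [E₀]
  have hE₀x (x : L.invariants →ₐ[k] k) (b : O) : x (E₀ b) = y x b := by
    conv_rhs => rw [← h3 b]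
    rw [hE₀, map_sum, map_sum]
    refine Finset.sum_congr rfl fun i _ => ?_
    rw [map_mul, map_mul, hc, ← hy]
    rfl
  have hu : IsUnit (E₀ 1) := isUnit_of_point_ne_zero (k := k) fun x => by
    rw [hE₀x, map_one]; exact one_ne_zero
  obtain ⟨u, hu⟩ := hu
  -- Dividing by the unit `E₀ 1` normalizes the value at `1`; it changes nothing at the points,
  -- where this unit is `1`.
  let E : O →ₗ[k] L.invariants := LinearMap.mulLeft k (u⁻¹ : L.invariantsˣ).1 ∘ₗ E₀
  have hE (b : O) : E b = (u⁻¹ : L.invariantsˣ).1 * E₀ b := rfl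
  have hEx (x : L.invariants →ₐ[k] k) (b : O) : x (E b) = y x b := by
    have h4 : x u.1 = 1 := by rw [hu, hE₀x, map_one]
    have h5 : x (u⁻¹ : L.invariantsˣ).1 = 1 := by
      have := congrArg x u.inv_mul
      rwa [map_mul, h4, mul_one, map_one] at this
    rw [hE, map_mul, h5, one_mul, hE₀x]
  -- At each point `E` becomes multiplicative, so `E ∘ S` becomes its convolution inverse. The
  -- products of `E` and `G` therefore differ from `1` by maps that vanish at all points, which are
  -- nilpotent.
  let G : O →ₗ[k] L.invariants := E ∘ₗ HopfAlgebra.antipode k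
  have hEG : IsUnit (toConv E * toConv G) := by
    have : IsNilpotent (1 - toConv E * toConv G) := isNilpotent_conv _ fun x b => by
      have h4 := congrArg (y x) (HopfAlgebra.sum_mul_antipode_eq_smul (ℛ k b))
      change x ((1 : WithConv (O →ₗ[k] L.invariants)) b - (toConv E * toConv G) b) = 0
      rw [map_sub, sub_eq_zero, (ℛ k b).convMul_apply, map_sum]
      simp only [map_mul, LinearMap.convOne_apply, AlgHom.commutes]
      simp only [map_sum, map_mul, map_smul, map_one, smul_eq_mul, mul_one] at h4
      simp only [Algebra.algebraMap_self, RingHom.id_apply]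
      rw [← h4]
      exact (Finset.sum_congr rfl fun i _ => by
        rw [← hEx, ← hEx]; rfl)
    have h5 := this.isUnit_one_sub
    rwa [sub_sub_cancel] at h5
  have hGE : IsUnit (toConv G * toConv E) := by
    have : IsNilpotent (1 - toConv G * toConv E) := isNilpotent_conv _ fun x b => by
      have h4 := congrArg (y x) (HopfAlgebra.sum_antipode_mul_eq_smul (ℛ k b))
      change x ((1 : WithConv (O →ₗ[k] L.invariants)) b - (toConv G * toConv E) b) = 0
      rw [map_sub, sub_eq_zero, (ℛ k b).convMul_apply, map_sum]
      simp only [map_mul, LinearMap.convOne_apply, AlgHom.commutes]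
      simp only [map_sum, map_mul, map_smul, map_one, smul_eq_mul, mul_one] at h4
      simp only [Algebra.algebraMap_self, RingHom.id_apply]
      rw [← h4]
      exact (Finset.sum_congr rfl fun i _ => by
        rw [← hEx, ← hEx]; rfl)
    have h5 := this.isUnit_one_sub
    rwa [sub_sub_cancel] at h5
  have hEu : IsUnit (toConv E) := by
    obtain ⟨v, hv⟩ := hEG
    obtain ⟨w, hw⟩ := hGE
    refine isUnit_iff_exists_and_exists.mpr
      ⟨⟨toConv G * (v⁻¹ : (WithConv (O →ₗ[k] L.invariants))ˣ).1, ?_⟩,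
        ⟨(w⁻¹ : (WithConv (O →ₗ[k] L.invariants))ˣ).1 * toConv G, ?_⟩⟩
    · rw [← mul_assoc, ← hv, Units.mul_inv]
    · rw [mul_assoc, ← hw, Units.inv_mul]
  obtain ⟨F, hF, hF'⟩ := isUnit_iff_exists.mp hEu
  refine ⟨E, F.ofConv, fun c b => ?_, ?_, fun b => ?_, hF, hF'⟩
  · have : ∀ i, l' i (c * b) = c * l' i b := fun i => Subtype.ext (h2 i c c.2 b)
    simp only [hE, hE₀, this, mul_assoc, ← Finset.mul_sum]
    exact mul_left_comm _ _ _
  · rw [hE, ← hu, Units.inv_mul]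
  · exact (hEx ε₀ b).trans (by rw [hyε ε₀ rfl]; rfl)

end ClosedSubgroup

/-! ### Invariant functions and the augmentation ideal as mutual annihilators; existence of sections
-/

namespace NormalSubgroup

variable {k O : Type u} [Field k] [CommRing O] [HopfAlgebra k O] [Module.Finite k O]
  (H : NormalSubgroup k O)

/-- This is `a₁ ⊗ q(a₂) = a ⊗ 1` paired with `u ⊗ v`. Together with the converse that follows, which
holds as such pairings separate `O(G) ⊗ O(H)`, it expresses invariance through the product of
`k[G]`. -/
lemma mul_incl_apply {a : O} (ha : a ∈ H.invariants) (u : GroupAlg k O) (v : H.groupAlg) :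
    (u * H.incl v) a = counit (R := k) v * u a := by
  let Ψ : O ⊗[k] H.coord →ₗ[k] k := TensorProduct.lift
    ((LinearMap.mul k k).compl₁₂ (GroupAlg.toDual k O u) (GroupAlg.toDual k H.coord v))
  have h := congrArg Ψ (H.mem_invariants.mp ha)
  rw [ClosedSubgroup.coactR_apply, ← (ℛ k a).eq] at h
  simp only [Ψ, map_sum, LinearMap.lTensor_tmul, TensorProduct.lift.tmul, LinearMap.compl₁₂_apply,
    LinearMap.mul_apply_apply] at h
  rw [GroupAlg.mul_apply _ _ (ℛ k a), GroupAlg.counit_apply, mul_comm, ← h]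
  exact Finset.sum_congr rfl fun i _ => by rw [ClosedSubgroup.incl_apply]; rfl

lemma mem_invariants_of_mul_incl_apply {a : O}
    (ha : ∀ (u : GroupAlg k O) (v : H.groupAlg), (u * H.incl v) a = counit (R := k) v * u a) :
    a ∈ H.invariants := by
  rw [ClosedSubgroup.mem_invariants]
  refine (Module.forall_dual_apply_eq_zero_iff k (H.coactR a - a ⊗ₜ 1)).mp (fun φ => ?_) |>
    sub_eq_zero.mp
  obtain ⟨t, rfl⟩ := (TensorProduct.dualDistribEquiv k O H.coord).surjective φ
  induction t with
  | zero => simp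
  | add x y hx hy => rw [map_add, LinearMap.add_apply, hx, hy, add_zero]
  | tmul f g =>
    have h := ha ((GroupAlg.toDual k O).symm f) ((GroupAlg.toDual k H.coord).symm g)
    rw [GroupAlg.mul_apply _ _ (ℛ k a), GroupAlg.counit_apply] at h
    simp only [ClosedSubgroup.incl_apply, LinearEquiv.apply_symm_apply] at h
    rw [ClosedSubgroup.coactR_apply, map_sub, sub_eq_zero, ← (ℛ k a).eq]
    simp only [map_sum, LinearMap.lTensor_tmul]
    change ∑ i ∈ (ℛ k a).index, f _ * g _ = f a * g 1
    rw [mul_comm, ← h]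
    rfl

/-- As `H` is normal, elements of `k[H]` can be moved past elements of `k[G]`. -/
lemma exists_incl_mul {ι : Type*} {w : GroupAlg k O} (r : Coalgebra.Repr k w ι) (v : H.groupAlg) :
    ∃ v' : ι → H.groupAlg, (∀ i, counit (R := k) (v' i) =
      counit (R := k) (r.left i) * counit (R := k) v) ∧
      H.incl v * w = ∑ i ∈ r.index, r.right i * H.incl (v' i) := by
  have h1 (i : ι) := H.exists_incl_eq_adL (HopfAlgebra.antipode k (r.left i))
    (HopfAlgebra.antipode k v)
  choose v' hv' using h1
  refine ⟨fun i => HopfAlgebra.antipode k (v' i), fun i => ?_, ?_⟩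
  · rw [HopfAlgebra.counit_antipode, ← counit_incl, hv', counit_adL, HopfAlgebra.counit_antipode,
      counit_incl, HopfAlgebra.counit_antipode]
  · have h2 := congrArg (HopfAlgebra.antipode k) (mul_eq_sum_adL_mul (reprAntipode r)
      (H.incl (HopfAlgebra.antipode k v)))
    rw [HopfAlgebra.antipode_mul_antidistrib, antipode_antipode_groupAlg, ← antipode_incl,
      antipode_antipode_groupAlg, map_sum] at h2
    rw [h2]
    refine Finset.sum_congr rfl fun i _ => ?_
    rw [HopfAlgebra.antipode_mul_antidistrib, ← antipode_incl, hv', ← antipode_incl]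
    simp only [reprAntipode, antipode_antipode_groupAlg]

lemma incl_mul_apply {a : O} (ha : a ∈ H.invariants) (u w : GroupAlg k O) (v : H.groupAlg) :
    (u * (H.incl v * w)) a = counit (R := k) v * (u * w) a := by
  obtain ⟨v', h1, h2⟩ := H.exists_incl_mul (ℛ k w) v
  have h3 := sum_counit_smul (ℛ k w)
  conv_rhs => rw [← h3]
  rw [h2, Finset.mul_sum, Finset.mul_sum, GroupAlg.sum_apply, GroupAlg.sum_apply, Finset.mul_sum]
  refine Finset.sum_congr rfl fun i _ => ?_
  rw [← mul_assoc, H.mul_incl_apply ha, h1, mul_smul_comm, map_smul, LinearMap.smul_apply,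
    smul_eq_mul]
  ring

lemma apply_eq_zero_of_mem_augIdeal {a : O} (ha : a ∈ H.invariants) {x : GroupAlg k O}
    (hx : x ∈ H.augIdeal) : x a = 0 := by
  -- The claim is strengthened to all multiples on both sides so that the induction over a two-sided
  -- ideal goes through.
  have key : ∀ u w : GroupAlg k O, (u * x * w) a = 0 := by
    refine TwoSidedIdeal.span_induction (p := fun x _ => ∀ u w : GroupAlg k O, (u * x * w) a = 0)
      ?_ ?_ ?_ ?_ ?_ ?_ (TwoSidedIdeal.mem_asIdeal.mp hx)
    · rintro _ ⟨v, rfl⟩ u w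
      rw [mul_sub, sub_mul, map_sub, LinearMap.sub_apply, mul_assoc, H.incl_mul_apply ha,
        Algebra.algebraMap_eq_smul_one, mul_smul_comm, mul_one, smul_mul_assoc, map_smul,
        LinearMap.smul_apply, smul_eq_mul, sub_self]
    · intro u w; simp
    · intro x y _ _ hx hy u w
      rw [mul_add, add_mul, map_add, LinearMap.add_apply, hx, hy, add_zero]
    · intro x _ hx u w
      rw [mul_neg, neg_mul, map_neg, LinearMap.neg_apply, hx, neg_zero]
    · intro z x _ hx u w
      rw [← mul_assoc, hx]
    · intro x z _ hx u w
      rw [← mul_assoc, mul_assoc, hx]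
  simpa using key 1 1

lemma mem_invariants_iff {a : O} : a ∈ H.invariants ↔ ∀ x ∈ H.augIdeal, x a = 0 := by
  refine ⟨fun ha x hx => H.apply_eq_zero_of_mem_augIdeal ha hx, fun h => ?_⟩
  refine H.mem_invariants_of_mul_incl_apply fun u v => ?_
  have := h (u * (H.incl v - algebraMap k (GroupAlg k O) (counit (R := k) v)))
    (H.augIdeal.mul_mem_left _ (TwoSidedIdeal.mem_asIdeal.mpr
      (TwoSidedIdeal.subset_span ⟨v, rfl⟩)))
  rw [mul_sub, map_sub, LinearMap.sub_apply, sub_eq_zero, Algebra.algebraMap_eq_smul_one,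
    mul_smul_comm, mul_one, map_smul, LinearMap.smul_apply, smul_eq_mul] at this
  exact this

/-- A subspace of `k[G]` is determined by the functions on which it vanishes. -/
lemma _root_.FiniteGroupScheme.GroupAlg.mem_of_forall_apply_eq_zero
    (W : Submodule k (GroupAlg k O)) {x : GroupAlg k O}
    (h : ∀ a : O, (∀ y ∈ W, y a = 0) → x a = 0) : x ∈ W := by
  let W' : Submodule k (Module.Dual k O) := W.map (GroupAlg.toDual k O).toLinearMap
  have h1 : GroupAlg.toDual k O x ∈ W'.dualCoannihilator.dualAnnihilator := by
    rw [Submodule.mem_dualAnnihilator]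
    intro a ha
    rw [Submodule.mem_dualCoannihilator] at ha
    exact h a fun y hy => ha _ (Submodule.mem_map_of_mem hy)
  rw [Subspace.dualCoannihilator_dualAnnihilator_eq] at h1
  obtain ⟨y, hy, hxy⟩ := h1
  rwa [← (GroupAlg.toDual k O).injective hxy]

/-- The invariants are the annihilator of the augmentation ideal, and in finite dimension the double
annihilator of a subspace is the subspace. Hence `k[G/H]` is dual to the algebra of invariants. -/
lemma mem_augIdeal_iff {x : GroupAlg k O} : x ∈ H.augIdeal ↔ ∀ a ∈ H.invariants, x a = 0 :=
  ⟨fun hx _ ha => H.apply_eq_zero_of_mem_augIdeal ha hx, fun h =>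
    GroupAlg.mem_of_forall_apply_eq_zero (H.augIdeal.restrictScalars k) fun a ha =>
      h a (H.mem_invariants_iff.mpr ha)⟩

lemma proj_surjective : Function.Surjective H.proj := Ideal.Quotient.mk_surjective

lemma proj_eq_zero_iff {x : GroupAlg k O} : H.proj x = 0 ↔ x ∈ H.augIdeal :=
  Ideal.Quotient.eq_zero_iff_mem

lemma proj_eq_iff {x y : GroupAlg k O} : H.proj x = H.proj y ↔ ∀ a ∈ H.invariants, x a = y a := by
  rw [← sub_eq_zero, ← map_sub, proj_eq_zero_iff, mem_augIdeal_iff]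
  simp [sub_eq_zero]

/-- The map `k[G/H] → k[G]` that is the transpose of a map from `O(G)` to the invariants. -/
def transpose (E : O →ₗ[k] H.invariants) : H.quotAlg →ₗ[k] GroupAlg k O :=
  (H.augIdeal.restrictScalars k).liftQ ((GroupAlg.toDual k O).symm.toLinearMap ∘ₗ
    (H.invariants.val.toLinearMap ∘ₗ E).dualMap ∘ₗ (GroupAlg.toDual k O).toLinearMap)
    fun x hx => GroupAlg.ext fun a => by
      simpa using H.apply_eq_zero_of_mem_augIdeal (E a).2 hx

lemma transpose_proj_apply (E : O →ₗ[k] H.invariants) (u : GroupAlg k O) (a : O) :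
    (H.transpose E (H.proj u)) a = u (E a : O) := by
  change (GroupAlg.toDual k O ((GroupAlg.toDual k O).symm _)) a = _
  rw [LinearEquiv.apply_symm_apply]
  rfl

/-- Under the duality the product of `O(G)` becomes the coproduct of `k[G]` and conversely, so
transposition respects convolution. -/
lemma transpose_conv {E F : O →ₗ[k] H.invariants} (h : toConv E * toConv F = 1) :
    toConv (H.transpose E) * toConv (H.transpose F) = 1 := by
  refine WithConv.ext (LinearMap.ext fun x => ?_)
  obtain ⟨u, rfl⟩ := H.proj_surjective x
  refine GroupAlg.ext fun a => ?_
  have h1 := congr($h a)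
  rw [(ℛ k a).convMul_apply] at h1
  have h2 : (toConv (H.transpose E) * toConv (H.transpose F)) (H.proj u) = _ :=
    ((ℛ k u).induced H.proj).convMul_apply _ _
  change ((toConv (H.transpose E) * toConv (H.transpose F)) (H.proj u)) a =
    ((1 : WithConv (H.quotAlg →ₗ[k] GroupAlg k O)) (H.proj u)) a
  rw [h2, GroupAlg.sum_apply, LinearMap.convOne_apply, GroupAlg.algebraMap_apply]
  have h3 : ∀ i, (((toConv (H.transpose E)) (((ℛ k u).induced H.proj).left i)) *
      ((toConv (H.transpose F)) (((ℛ k u).induced H.proj).right i))) a =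
      ∑ j ∈ (ℛ k a).index, (ℛ k u).left i (E ((ℛ k a).left j) : O) *
        (ℛ k u).right i (F ((ℛ k a).right j) : O) := fun i => by
    rw [GroupAlg.mul_apply _ _ (ℛ k a)]
    exact Finset.sum_congr rfl fun j _ => by
      rw [← transpose_proj_apply, ← transpose_proj_apply]; rfl
  refine (Finset.sum_congr rfl fun i _ => h3 i).trans ?_
  rw [Finset.sum_comm]
  refine (Finset.sum_congr rfl fun j _ => (GroupAlg.apply_mul (ℛ k u) _ _).symm).trans ?_
  rw [← map_sum]
  have h4 : ∑ j ∈ (ℛ k a).index, (E ((ℛ k a).left j) : O) * (F ((ℛ k a).right j) : O) =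
      counit (R := k) a • (1 : O) := by
    have h5 := congrArg (H.invariants.val) h1
    rw [map_sum] at h5
    refine h5.trans ?_
    rw [LinearMap.convOne_apply, AlgHom.commutes, Algebra.algebraMap_eq_smul_one]
  rw [h4, map_smul, smul_eq_mul, mul_comm]
  rfl

lemma comul_proj (u : GroupAlg k O) : comul (R := k) (H.proj u) =
    TensorProduct.map (H.proj : GroupAlg k O →ₗ[k] H.quotAlg)
      (H.proj : GroupAlg k O →ₗ[k] H.quotAlg) (comul (R := k) u) := rfl

/-- The projection `k[G] → k[G/H]` is cleft. -/
theorem nonempty_cleaving [IsAlgClosed k] : Nonempty (Cleaving H) := by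
  -- The section is the transpose of `E`. Each axiom is dual to a property of `E`: `π γ = id` to `E`
  -- fixing the invariants, colinearity to linearity over the invariants, `ε γ = ε` to `E 1 = 1`,
  -- and `γ(1) = 1` to `ε E = ε`.
  obtain ⟨E, F, hmul, h1, hε, hEF, hFE⟩ := H.exists_retraction
  have hE (c : H.invariants) : E c = c := by
    have := hmul c 1
    rwa [mul_one, h1, mul_one] at this
  have hproj (x : H.quotAlg) : H.proj (H.transpose E x) = x := by
    obtain ⟨u, rfl⟩ := H.proj_surjective x
    rw [proj_eq_iff]
    intro a ha
    rw [transpose_proj_apply, hE ⟨a, ha⟩]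
  refine ⟨⟨H.transpose E, H.transpose F, H.transpose_conv hEF, H.transpose_conv hFE, fun x => ?_,
    fun x => ?_, hproj, ?_⟩⟩
  · obtain ⟨u, rfl⟩ := H.proj_surjective x
    -- As `π` is a left inverse of the section, nothing is lost by applying the section to the
    -- second leg. The identity then lives in `k[G] ⊗ k[G]` and can be tested by the perfect
    -- pairing.
    have hinj : Function.Injective ((H.transpose E).lTensor (GroupAlg k O)) := by
      refine Function.LeftInverse.injective
        (g := (H.proj : GroupAlg k O →ₗ[k] H.quotAlg).lTensor (GroupAlg k O)) fun t => ?_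
      rw [← LinearMap.comp_apply, ← LinearMap.lTensor_comp]
      have : (H.proj : GroupAlg k O →ₗ[k] H.quotAlg) ∘ₗ H.transpose E = LinearMap.id :=
        LinearMap.ext hproj
      rw [this, LinearMap.lTensor_id, LinearMap.id_apply]
    refine hinj (GroupAlg.pair₂_ext fun a b => ?_)
    have h2 (t : GroupAlg k O ⊗[k] GroupAlg k O) : GroupAlg.pair₂ k O
        ((H.transpose E).lTensor (GroupAlg k O) ((H.transpose E).rTensor H.quotAlg
          (TensorProduct.map (H.proj : GroupAlg k O →ₗ[k] H.quotAlg)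
          (H.proj : GroupAlg k O →ₗ[k] H.quotAlg) t))) (a ⊗ₜ b) =
        GroupAlg.pair₂ k O t ((E a : O) ⊗ₜ (E b : O)) := by
      induction t with
      | zero => simp
      | add x y hx hy => simp only [map_add, LinearMap.add_apply, hx, hy]
      | tmul x y =>
        simp only [TensorProduct.map_tmul, LinearMap.rTensor_tmul, LinearMap.lTensor_tmul,
          GroupAlg.pair₂_tmul]
        exact congrArg₂ (· * ·) (transpose_proj_apply ..) (transpose_proj_apply ..)
    have h3 (t : GroupAlg k O ⊗[k] GroupAlg k O) : GroupAlg.pair₂ k O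
        ((H.transpose E).lTensor (GroupAlg k O)
          ((H.proj : GroupAlg k O →ₗ[k] H.quotAlg).lTensor (GroupAlg k O) t)) (a ⊗ₜ b) =
        GroupAlg.pair₂ k O t (a ⊗ₜ (E b : O)) := by
      induction t with
      | zero => simp
      | add x y hx hy => simp only [map_add, LinearMap.add_apply, hx, hy]
      | tmul x y =>
        simp only [LinearMap.lTensor_tmul, GroupAlg.pair₂_tmul]
        exact congrArg₂ (· * ·) rfl (transpose_proj_apply ..)
    rw [comul_proj, h2, h3, GroupAlg.pair₂_comul, GroupAlg.pair₂_comul, transpose_proj_apply,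
      mul_comm a, hmul, mul_comm (E b)]
    rfl
  · obtain ⟨u, rfl⟩ := H.proj_surjective x
    rw [GroupAlg.counit_apply, transpose_proj_apply, h1]
    rfl
  · refine GroupAlg.ext fun a => ?_
    rw [← map_one H.proj, transpose_proj_apply, GroupAlg.one_apply, GroupAlg.one_apply, hε]

end NormalSubgroup

/-! ### Commutative Hopf subalgebras as algebras of coinvariants -/

section Coinvariants

variable {k Q : Type*} [Field k] [Ring Q]

/-- A maximal ideal of a commutative subalgebra does not generate the unit left ideal. -/
lemma one_notMem_span_of_isMaximal [Algebra k Q] [Module.Finite k Q] (A : Subalgebra k Q)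
    (hcomm : ∀ a ∈ A, ∀ b ∈ A, a * b = b * a) (x : A →ₐ[k] k) :
    (1 : Q) ∉ Ideal.span ((fun a : A => (a : Q)) '' {a | x a = 0}) := by
  -- The left ideal generated by `ker x` is `Q · ker x`, so `Q` has to be viewed as a right module
  -- over `A`. This is encoded as a left module structure of `A.op` on the opposite ring.
  let : CommRing A.op := { (inferInstance : Ring A.op) with
    mul_comm := fun a b => Subtype.ext (MulOpposite.unop_injective
      (hcomm b.1.unop b.2 a.1.unop a.2)) }
  intro h1
  let y : A.op →ₐ[k] k := AlgHom.ofLinearMap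
    { toFun := fun a => x ⟨a.1.unop, a.2⟩
      map_add' := fun a b => map_add x ⟨a.1.unop, a.2⟩ ⟨b.1.unop, b.2⟩
      map_smul' := fun c a => map_smul x c ⟨a.1.unop, a.2⟩ }
    (map_one x)
    (fun a b => (map_mul x ⟨b.1.unop, b.2⟩ ⟨a.1.unop, a.2⟩).trans (mul_comm _ _))
  have : Module.Finite k Qᵐᵒᵖ := Module.Finite.equiv (MulOpposite.opLinearEquiv k)
  have : Module.Finite A.op Qᵐᵒᵖ := .of_restrictScalars_finite k A.op Qᵐᵒᵖ
  have hsmul (a : A.op) (q : Qᵐᵒᵖ) : a • q = a * q := rfl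
  have h2 (q : Q) (hq : q ∈ Ideal.span ((fun a : A => (a : Q)) '' {a | x a = 0})) :
      MulOpposite.op q ∈ (RingHom.ker y : Ideal A.op) • (⊤ : Submodule A.op Qᵐᵒᵖ) := by
    induction hq using Submodule.span_induction with
    | mem q hq =>
      obtain ⟨a, ha, rfl⟩ := hq
      have : MulOpposite.op (a : Q) = (⟨MulOpposite.op (a : Q), a.2⟩ : A.op) • (1 : Qᵐᵒᵖ) := by
        rw [hsmul, mul_one]
      rw [this]
      exact Submodule.smul_mem_smul ha Submodule.mem_top
    | zero => exact Submodule.zero_mem _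
    | add y z _ _ hy hz => exact Submodule.add_mem _ hy hz
    | smul c z _ hz =>
      rw [smul_eq_mul, MulOpposite.op_mul]
      refine Submodule.smul_induction_on (p := fun w => w * MulOpposite.op c ∈ _) hz ?_ ?_
      · intro a ha w _
        rw [hsmul, mul_assoc]
        exact Submodule.smul_mem_smul (n := w * MulOpposite.op c) ha Submodule.mem_top
      · intro w w' hw hw'
        rw [add_mul]
        exact Submodule.add_mem _ hw hw'
  have h3 : (⊤ : Submodule A.op Qᵐᵒᵖ) ≤
      (RingHom.ker y : Ideal A.op) • (⊤ : Submodule A.op Qᵐᵒᵖ) := by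
    intro q _
    refine h2 q.unop ?_
    have := Ideal.mul_mem_left _ q.unop h1
    rwa [mul_one] at this
  -- Nakayama: if `ker x` generated everything, some `r ≡ 1` modulo `ker x` would annihilate `Q`.
  -- Applied to `1` this gives `r = 0`, whereas `x(r) = 1`.
  obtain ⟨r, hr, hr'⟩ := Submodule.exists_sub_one_mem_and_smul_eq_zero_of_fg_of_le_smul _ _
    (Module.finite_def.mp inferInstance) h3
  have h4 : r = 0 := by
    have := hr' 1 Submodule.mem_top
    rw [hsmul, mul_one] at this
    exact Subtype.ext this
  rw [h4, zero_sub, RingHom.mem_ker, map_neg, map_one] at hr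
  exact one_ne_zero (neg_eq_zero.mp hr)

/-- A proper inclusion of modules over a commutative subalgebra is detected by a functional that
transforms under a character. -/
lemma exists_semiinvariant_functional [IsAlgClosed k] [Algebra k Q] [Module.Finite k Q]
    (A : Subalgebra k Q) (hcomm : ∀ a ∈ A, ∀ b ∈ A, a * b = b * a) (C : Submodule k Q)
    (hAC : ∀ a ∈ A, ∀ c ∈ C, a * c ∈ C) (hC : ¬ C ≤ Subalgebra.toSubmodule A) :
    ∃ (x : A →ₐ[k] k) (φ : Q →ₗ[k] k), (∀ a : A, ∀ c ∈ C, φ (a * c) = x a * φ c) ∧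
      (∀ a ∈ A, a ∈ C → φ a = 0) ∧ ∃ c ∈ C, φ c ≠ 0 := by
  let : CommRing A := { (inferInstance : Ring A) with
    mul_comm := fun a b => Subtype.ext (hcomm a a.2 b b.2) }
  have hsmul (a : A) (q : Q) : a • q = a * q := rfl
  let C' : Submodule A Q := { C with smul_mem' := fun a c hc => hAC a a.2 c hc }
  let A' : Submodule A C' :=
    { carrier := {c | (c : Q) ∈ A}
      zero_mem' := A.zero_mem
      add_mem' := fun ha hb => A.add_mem ha hb
      smul_mem' := fun a c hc => A.mul_mem a.2 hc }
  have hnoeth : IsNoetherian A Q := isNoetherian_of_tower k inferInstance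
  have hne : Nontrivial (C' ⧸ A') := by
    rw [Submodule.Quotient.nontrivial_iff]
    intro h
    exact hC fun c hc => (h ▸ Submodule.mem_top : (⟨c, hc⟩ : C') ∈ A')
  -- The nonzero finitely generated module `C/A` has a simple quotient `A/m`. As `k` is
  -- algebraically closed, `A/m` is `k` with `A` acting through a character `x`.
  obtain ⟨N, hN, -⟩ := (eq_top_or_exists_le_coatom (⊥ : Submodule A (C' ⧸ A'))).resolve_left
    bot_ne_top
  have hsimple : IsSimpleModule A ((C' ⧸ A') ⧸ N) := isSimpleModule_iff_isCoatom.mpr hN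
  obtain ⟨m, hm, ⟨e⟩⟩ := isSimpleModule_iff_quot_maximal.mp hsimple
  have : Module.Finite k A := inferInstanceAs (Module.Finite k (Subalgebra.toSubmodule A))
  obtain ⟨x, hx⟩ := exists_point_ker_eq (k := k) m
  let xbar : (A ⧸ m) →ₐ[k] k := Ideal.Quotient.liftₐ m x fun a ha => (hx a).mpr ha
  have hxbar (a : A) (y : A ⧸ m) : xbar (a • y) = x a * xbar y := by
    obtain ⟨b, rfl⟩ := Ideal.Quotient.mk_surjective y
    exact map_mul x a b
  have hinj : ∀ y, xbar y = 0 → y = 0 := by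
    intro y hy
    obtain ⟨b, rfl⟩ := Ideal.Quotient.mk_surjective y
    exact Ideal.Quotient.eq_zero_iff_mem.mpr ((hx b).mp hy)
  let Λ : C' →ₗ[A] (A ⧸ m) := e.toLinearMap ∘ₗ N.mkQ ∘ₗ A'.mkQ
  have hΛ : Function.Surjective Λ :=
    e.surjective.comp (N.mkQ_surjective.comp A'.mkQ_surjective)
  let φ₀ : C →ₗ[k] k :=
    { toFun := fun c => xbar (Λ c)
      map_add' := fun c d => by
        rw [← map_add, ← map_add]
      map_smul' := fun t c => by
        have : Λ (t • c : C) = algebraMap k A t • Λ c := by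
          rw [← map_smul]
          congr 1
          exact Subtype.ext (Algebra.smul_def t (c : Q))
        rw [this, hxbar, AlgHom.commutes]
        rfl }
  obtain ⟨φ, hφ⟩ := φ₀.exists_extend
  have hφ' (c : C) : φ c = xbar (Λ c) := congr($hφ c)
  refine ⟨x, φ, fun a c hc => ?_, fun a ha haC => ?_, ?_⟩
  · rw [hφ' ⟨c, hc⟩, hφ' ⟨a * c, hAC a a.2 c hc⟩, ← hxbar, ← map_smul]
    rfl
  · rw [hφ' ⟨a, haC⟩]
    have : Λ ⟨a, haC⟩ = 0 := by
      have h1 : A'.mkQ ⟨a, haC⟩ = 0 := (Submodule.Quotient.mk_eq_zero A').mpr ha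
      simp only [Λ, LinearMap.comp_apply, h1, map_zero]
    rw [this, map_zero]
  · obtain ⟨c, hc⟩ := hΛ 1
    refine ⟨c, c.2, ?_⟩
    rw [hφ' ⟨c, c.2⟩]
    intro h
    have h5 := hinj _ h
    change Λ c = 0 at h5
    have hm1 : (1 : A ⧸ m) = 0 := by rw [← hc, h5]
    rw [← map_one (Ideal.Quotient.mk m), Ideal.Quotient.eq_zero_iff_mem] at hm1
    exact hm.ne_top ((Ideal.eq_top_iff_one m).mpr hm1)

variable [HopfAlgebra k Q] [Module.Finite k Q]

/-- Let `A` be a commutative left coideal subalgebra of `Q`, and `C ⊇ A` a left coideal that is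
stable under multiplication by `A`, with `C = A + A⁺C`.  Then `C = A`. -/
theorem le_of_le_sup_augmentation_mul [IsAlgClosed k] (A : Subalgebra k Q)
    (hcomm : ∀ a ∈ A, ∀ b ∈ A, a * b = b * a)
    (hΔA : ∀ a ∈ A, comul (R := k) a ∈
      LinearMap.range ((Subalgebra.toSubmodule A).subtype.lTensor Q))
    (C : Submodule k Q) (hAC : ∀ a ∈ A, ∀ c ∈ C, a * c ∈ C) (hA : Subalgebra.toSubmodule A ≤ C)
    (hΔC : ∀ c ∈ C, comul (R := k) c ∈ LinearMap.range (C.subtype.lTensor Q))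
    (hC : C ≤ Subalgebra.toSubmodule A ⊔
      Submodule.span k {y | ∃ a ∈ A, counit (R := k) a = 0 ∧ ∃ c ∈ C, a * c = y}) :
    C ≤ Subalgebra.toSubmodule A := by
  by_contra hcon
  obtain ⟨x, φ, h1, h2, c₀, hc₀, hφ⟩ := exists_semiinvariant_functional A hcomm C hAC hcon
  refine one_notMem_span_of_isMaximal A hcomm x ?_
  set N := Ideal.span ((fun a : A => (a : Q)) '' {a | x a = 0}) with hN
  -- the map `y ⊗ z ↦ S(y) φ(z)`
  let ψ : Q ⊗[k] Q →ₗ[k] Q := TensorProduct.lift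
    ((LinearMap.lsmul k Q).flip.compl₁₂ (HopfAlgebra.antipode k) φ)
  have hψ (y z : Q) : ψ (y ⊗ₜ z) = φ z • HopfAlgebra.antipode k y := rfl
  have hsmulN (t : k) {y : Q} (hy : y ∈ N) : t • y ∈ N := by
    rw [← one_mul y, ← smul_mul_assoc]; exact N.mul_mem_left _ hy
  -- The second leg of `Δ(a)` stays in `A`, where `φ` vanishes.
  have hψA (a : Q) (ha : a ∈ A) : ψ (comul (R := k) a) = 0 := by
    obtain ⟨t, ht⟩ := hΔA a ha
    rw [← ht]
    clear ht
    induction t with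
    | zero => simp
    | add y z hy hz => rw [map_add, map_add, hy, hz, add_zero]
    | tmul y b => rw [LinearMap.lTensor_tmul, hψ, Submodule.subtype_apply, h2 b b.2 (hA b.2),
        zero_smul]
  have hψAC (a : Q) (ha : a ∈ A) (hεa : counit (R := k) a = 0) (c : Q) (hc : c ∈ C) :
      ψ (comul (R := k) (a * c)) ∈ N := by
    obtain ⟨t, ht⟩ := hΔC c hc
    obtain ⟨s, hs⟩ := hΔA a ha
    -- In `S(z) S(a₁) φ(a₂ w) = S(z) S(a₁) x(a₂) φ(w)` the scalar `x(a₂)` may be replaced by `a₂`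
    -- modulo `N`. Then `S(a₁) a₂ = ε(a)` appears, which is zero for `a` in the augmentation ideal.
    have key (s : Q ⊗[k] (Subalgebra.toSubmodule A)) (z : Q) (w : C) :
        ψ ((Subalgebra.toSubmodule A).subtype.lTensor Q s * z ⊗ₜ (w : Q)) -
          φ w • (HopfAlgebra.antipode k z * LinearMap.mul' k Q ((HopfAlgebra.antipode k).rTensor Q
            ((Subalgebra.toSubmodule A).subtype.lTensor Q s))) ∈ N := by
      induction s with
      | zero => simp
      | add s s' hs hs' =>
        simp only [map_add, add_mul, mul_add, smul_add]
        rw [add_sub_add_comm]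
        exact N.add_mem hs hs'
      | tmul y b =>
        rw [LinearMap.lTensor_tmul, Submodule.subtype_apply, Algebra.TensorProduct.tmul_mul_tmul,
          hψ, LinearMap.rTensor_tmul, LinearMap.mul'_apply, h1 ⟨b, b.2⟩ w w.2,
          HopfAlgebra.antipode_mul_antidistrib, mul_comm (x _), mul_smul, ← smul_sub]
        refine hsmulN _ ?_
        have h3 : x ⟨b, b.2⟩ • (HopfAlgebra.antipode k z * HopfAlgebra.antipode k y) -
            HopfAlgebra.antipode k z * (HopfAlgebra.antipode k y * (b : Q)) =
            (HopfAlgebra.antipode k z * HopfAlgebra.antipode k y) *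
              ((algebraMap k A (x ⟨b, b.2⟩) - ⟨b, b.2⟩ : A) : Q) := by
          rw [AddSubgroupClass.coe_sub, mul_sub, mul_assoc _ _ (b : Q)]
          congr 1
          rw [Subalgebra.coe_algebraMap, Algebra.algebraMap_eq_smul_one, mul_smul_comm, mul_one]
        rw [h3]
        exact N.mul_mem_left _ (Ideal.subset_span ⟨_, by simp, rfl⟩)
    rw [Bialgebra.comul_mul, ← ht, ← hs]
    clear ht
    induction t with
    | zero => simp
    | add y z hy hz => rw [map_add, mul_add, map_add]; exact N.add_mem hy hz
    | tmul z w =>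
      have h3 := key s z w
      rw [hs, HopfAlgebra.mul_antipode_rTensor_comul_apply, hεa, map_zero, mul_zero, smul_zero,
        sub_zero] at h3
      rwa [LinearMap.lTensor_tmul, hs]
  have hψC (c : Q) (hc : c ∈ C) : ψ (comul (R := k) c) ∈ N := by
    obtain ⟨a, ha, y, hy, rfl⟩ := Submodule.mem_sup.mp (hC hc)
    rw [map_add, map_add, hψA a ha, zero_add]
    clear hc
    induction hy using Submodule.span_induction with
    | mem y hy =>
      obtain ⟨b, hb, hεb, c, hc, rfl⟩ := hy
      exact hψAC b hb hεb c hc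
    | zero => simp
    | add y z _ _ hy hz => rw [map_add, map_add]; exact N.add_mem hy hz
    | smul t y _ hy => rw [map_smul, map_smul]; exact hsmulN t hy
  -- This is `φ(c) 1 = c₁ S(c₂) φ(c₃)`. Since `c₂` stays in the left coideal `C`, the right side
  -- lies in the left ideal `N`, so the unit does too.
  have h3 : φ c₀ • (1 : Q) = LinearMap.mul' k Q ((ψ ∘ₗ comul).lTensor Q (comul (R := k) c₀)) := by
    let Ψ : Q ⊗[k] (Q ⊗[k] Q) →ₗ[k] Q := LinearMap.mul' k Q ∘ₗ ψ.lTensor Q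
    have h4 := congrArg Ψ (Coalgebra.sum_tmul_tmul_eq (ℛ k c₀) (fun i => ℛ k ((ℛ k c₀).left i))
      (fun i => ℛ k ((ℛ k c₀).right i)))
    simp only [Ψ, map_sum, LinearMap.comp_apply, LinearMap.lTensor_tmul, LinearMap.mul'_apply,
      hψ, mul_smul_comm, ← Finset.smul_sum] at h4
    simp only [HopfAlgebra.sum_mul_antipode_eq_smul] at h4
    conv_rhs => rw [← (ℛ k c₀).eq]
    simp only [map_sum, LinearMap.lTensor_tmul, LinearMap.mul'_apply, LinearMap.comp_apply]
    have h5 (i) : (ℛ k c₀).left i * ψ (comul (R := k) ((ℛ k c₀).right i)) =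
        ∑ j ∈ (ℛ k ((ℛ k c₀).right i)).index, φ ((ℛ k ((ℛ k c₀).right i)).right j) •
          ((ℛ k c₀).left i * HopfAlgebra.antipode k ((ℛ k ((ℛ k c₀).right i)).left j)) := by
      rw [← (ℛ k ((ℛ k c₀).right i)).eq, map_sum, Finset.mul_sum]
      simp only [hψ, mul_smul_comm]
    simp only [h5, ← h4]
    have h6 := congrArg φ (sum_counit_smul (ℛ k c₀))
    rw [← h6, map_sum, Finset.sum_smul]
    simp only [map_smul, smul_smul, smul_eq_mul, mul_comm]
  have h4 : φ c₀ • (1 : Q) ∈ N := by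
    obtain ⟨t, ht⟩ := hΔC c₀ hc₀
    rw [h3, ← ht]
    clear ht
    induction t with
    | zero => simp
    | add y z hy hz => simp only [map_add]; exact N.add_mem hy hz
    | tmul z w =>
      simp only [LinearMap.lTensor_tmul, LinearMap.mul'_apply]
      exact N.mul_mem_left _ (hψC w w.2)
  have h5 := hsmulN (φ c₀)⁻¹ h4
  rwa [smul_smul, inv_mul_cancel₀ hφ, one_smul] at h5

end Coinvariants

/-! ### Coinvariants, and Hopf ideals of the group algebra -/

section Annihilator

variable {k O : Type*} [Field k] [CommRing O] [HopfAlgebra k O]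

/-- The functional on `k[G] / P` given by a function that vanishes on `P`. -/
def GroupAlg.evalMkQ (P : Submodule k (GroupAlg k O)) (a : O) (ha : ∀ x ∈ P, x a = 0) :
    GroupAlg k O ⧸ P →ₗ[k] k :=
  P.liftQ (LinearMap.applyₗ a ∘ₗ (GroupAlg.toDual k O).toLinearMap) ha

variable [Module.Finite k O]

/-- The functions that vanish on a left ideal form a left coideal. -/
lemma comul_mem_of_forall_apply_eq_zero (P : Ideal (GroupAlg k O)) (C : Submodule k O)
    (hC : ∀ a, a ∈ C ↔ ∀ x ∈ P, x a = 0) {a : O} (ha : a ∈ C) :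
    comul (R := k) a ∈ LinearMap.range (C.subtype.lTensor O) := by
  let β := Module.finBasis k O
  let sl (i) : O ⊗[k] O →ₗ[k] O := (TensorProduct.lid k O).toLinearMap ∘ₗ (β.coord i).rTensor O
  have h1 (t : O ⊗[k] O) : t = ∑ i, β i ⊗ₜ[k] sl i t := by
    induction t with
    | zero => simp
    | add x y hx hy =>
      simp only [map_add, TensorProduct.tmul_add, Finset.sum_add_distrib, ← hx, ← hy]
    | tmul m a =>
      simp only [sl, LinearMap.comp_apply, LinearMap.rTensor_tmul, LinearEquiv.coe_coe,
        TensorProduct.lid_tmul, Module.Basis.coord_apply, ← TensorProduct.smul_tmul,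
        ← TensorProduct.sum_tmul, β.sum_repr]
  -- The value of `x` at the slice along `βᵢ*` is the value of `βᵢ* x` at `a`, and `βᵢ* x` is again
  -- in the left ideal `P`.
  have h2 (i) : sl i (comul (R := k) a) ∈ C := by
    rw [hC]
    intro x hx
    have h3 := (hC a).mp ha _ (P.mul_mem_left ((GroupAlg.toDual k O).symm (β.coord i)) hx)
    rw [GroupAlg.mul_apply _ _ (ℛ k a)] at h3
    rw [← h3, ← (ℛ k a).eq]
    simp [sl]
  rw [h1 (comul (R := k) a)]
  exact Submodule.sum_mem _ fun i _ => ⟨β i ⊗ₜ ⟨_, h2 i⟩, rfl⟩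

end Annihilator

namespace NormalSubgroup

variable {k O : Type u} [Field k] [CommRing O] [HopfAlgebra k O] [Module.Finite k O]

/-- The coinvariants of the projection `k[G] → k[G/H]` are the elements of `k[H]`. -/
theorem mem_sub_of_coinvariant [IsAlgClosed k] (H : NormalSubgroup k O) {u : GroupAlg k O}
    (hu : (H.proj : GroupAlg k O →ₗ[k] H.quotAlg).lTensor (GroupAlg k O) (comul (R := k) u) =
      u ⊗ₜ 1) : u ∈ H.sub := by
  rw [mem_sub_iff]
  intro b hb
  have h1 : ∀ a ∈ H.invariants, counit (R := k) a = 0 → ∀ c, u (c * a) = 0 := by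
    intro a ha hε c
    -- Evaluation at an invariant `a` descends to `k[G/H]`. Paired with `c ⊗ a`, coinvariance of `u`
    -- reads `u(c a) = u(c) ε(a)`, so `u` kills the ideal generated by the invariants that vanish at
    -- the origin; this is the ideal of `H`.
    let ψ : GroupAlg k O ⊗[k] H.quotAlg →ₗ[k] k := TensorProduct.lift
      ((LinearMap.mul k k).compl₁₂ (LinearMap.applyₗ c ∘ₗ (GroupAlg.toDual k O).toLinearMap)
        (GroupAlg.evalMkQ (H.augIdeal.restrictScalars k) a
          fun x hx => H.apply_eq_zero_of_mem_augIdeal ha hx))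
    have h2 := congrArg ψ hu
    rw [← (ℛ k u).eq] at h2
    simp only [map_sum, LinearMap.lTensor_tmul] at h2
    rw [GroupAlg.apply_mul (ℛ k u)]
    refine Eq.trans h2 ?_
    change u c * counit (R := k) a = 0
    rw [hε, mul_zero]
  have h2 : ∀ c, u (c * b) = 0 := by
    refine Submodule.span_induction (p := fun b _ => ∀ c, u (c * b) = 0) ?_ ?_ ?_ ?_
      (H.mem_span_of_mem_ideal hb)
    · rintro a ⟨ha, hε⟩
      exact h1 a ha hε
    · simp
    · intro x y _ _ hx hy c
      rw [mul_add, map_add, hx, hy, add_zero]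
    · intro o x _ hx c
      rw [smul_eq_mul, ← mul_assoc, hx]
  simpa using h2 1

/-- The functions that vanish on a biideal form a subalgebra. -/
def annihilator (P : Ideal (GroupAlg k O)) (h : (P.restrictScalars k).IsCoideal) :
    Subalgebra k O where
  carrier := {a | ∀ x ∈ P, x a = 0}
  mul_mem' {a b} ha hb x hx := by
    let ψ := TensorProduct.lift ((LinearMap.mul k k).compl₁₂
      (GroupAlg.evalMkQ (P.restrictScalars k) a ha) (GroupAlg.evalMkQ (P.restrictScalars k) b hb))
    have h1 := congrArg ψ (h.map_mkQ_comul_eq_zero hx)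
    rw [← (ℛ k x).eq] at h1
    simp only [map_sum, TensorProduct.map_tmul, map_zero] at h1
    rw [GroupAlg.apply_mul (ℛ k x)]
    exact h1
  add_mem' ha hb x hx := by rw [map_add, ha x hx, hb x hx, add_zero]
  algebraMap_mem' c x hx := by
    rw [Algebra.algebraMap_eq_smul_one, map_smul, ← GroupAlg.counit_apply, h.counit_eq_zero hx,
      smul_zero]

/-- Every Hopf ideal of `k[G]` is the kernel of the projection to the group algebra of a
quotient of `G`. -/
theorem exists_augIdeal_eq [IsAlgClosed k] (P : Ideal (GroupAlg k O)) [P.IsTwoSided]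
    [hP : P.IsHopfIdeal k] : ∃ M : NormalSubgroup k O, M.augIdeal = P := by
  -- `A` plays the role of the functions on the quotient group to be found. The subgroup scheme `M`
  -- is the fibre over the origin, cut out by the ideal `I` that the augmentation ideal of `A`
  -- generates.
  let A := annihilator P hP.toIsCoideal
  let I : Ideal O := Ideal.span {a | a ∈ A ∧ counit (R := k) a = 0}
  let q := Ideal.Quotient.mkₐ k I
  have hq {a : O} (ha : a ∈ A) : q a = counit (R := k) a • 1 := by
    have h1 : a - counit (R := k) a • 1 ∈ I := Ideal.subset_span
      ⟨A.sub_mem ha (A.smul_mem A.one_mem _), by simp⟩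
    have h2 := Ideal.Quotient.eq_zero_iff_mem.mpr h1
    change q (a - counit (R := k) a • 1) = 0 at h2
    rwa [map_sub, map_smul, map_one, sub_eq_zero] at h2
  have hIε : I ≤ RingHom.ker (Bialgebra.counitAlgHom k O) :=
    Ideal.span_le.mpr fun a ha => ha.2
  have hIΔ : I ≤ RingHom.ker ((Algebra.TensorProduct.map q q).comp (Bialgebra.comulAlgHom k O)) := by
    refine Ideal.span_le.mpr ?_
    rintro a ⟨ha, hε⟩
    obtain ⟨t, ht⟩ := comul_mem_of_forall_apply_eq_zero P (Subalgebra.toSubmodule A)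
      (fun _ => Iff.rfl) ha
    have h1 (t : O ⊗[k] (Subalgebra.toSubmodule A)) : Algebra.TensorProduct.map q q
        ((Subalgebra.toSubmodule A).subtype.lTensor O t) = (q (TensorProduct.rid k O
          ((counit (R := k)).lTensor O ((Subalgebra.toSubmodule A).subtype.lTensor O t)))) ⊗ₜ 1 := by
      induction t with
      | zero => simp
      | add x y hx hy => simp only [map_add, TensorProduct.add_tmul, hx, hy]
      | tmul c a =>
        simp only [LinearMap.lTensor_tmul, Submodule.subtype_apply, Algebra.TensorProduct.map_tmul,
          hq a.2, TensorProduct.rid_tmul, map_smul, TensorProduct.tmul_smul,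
          TensorProduct.smul_tmul']
    change Algebra.TensorProduct.map q q (comul a) = 0
    rw [← ht, h1, ht, lTensor_counit_comul, TensorProduct.rid_tmul, one_smul, hq ha, hε, zero_smul,
      TensorProduct.zero_tmul]
  have hIS : I ≤ I.comap (HopfAlgebra.antipodeAlgHom k O) := by
    refine Ideal.span_le.mpr ?_
    rintro a ⟨ha, hε⟩
    refine Ideal.subset_span ⟨fun x hx => ?_, ?_⟩
    · exact (GroupAlg.antipode_apply x a).symm.trans (ha _ (hP.antipode_mem hx))
    · exact (HopfAlgebra.counit_antipode a).trans hε
  have hI : I.IsHopfIdeal k :=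
    { counit_eq_zero := fun x hx => hIε hx
      map_mkQ_comul_eq_zero := fun x hx => hIΔ hx
      antipode_mem := fun x hx => hIS hx }
  let L : ClosedSubgroup k O := ⟨I, hI⟩
  have hcoadj (u : GroupAlg k O) (b : O) (hb : b ∈ I) : coadj k O u b ∈ I := by
    have : ∀ u : GroupAlg k O, coadj k O u b ∈ I := by
      refine Submodule.span_induction (p := fun b _ => ∀ u, coadj k O u b ∈ I) ?_ ?_ ?_ ?_ hb
      · rintro a ⟨ha, hε⟩ u
        refine Ideal.subset_span ⟨fun x hx => ?_, by rw [counit_coadj, hε, mul_zero]⟩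
        rw [pair_coadj (ℛ k u)]
        exact Finset.sum_eq_zero fun i _ => ha _
          (P.mul_mem_right _ (P.mul_mem_left _ hx))
      · simp
      · intro x y _ _ hx hy u
        rw [map_add]; exact I.add_mem (hx u) (hy u)
      · intro c x _ hx u
        rw [smul_eq_mul, coadj_mul (ℛ k u)]
        exact I.sum_mem fun i _ => I.mul_mem_left _ (hx _)
    exact this u
  let M : NormalSubgroup k O := ⟨L, L.isNormal_of_coadj_mem hcoadj⟩
  -- Functions in `A` are constant on `M`, so `v - ε(v)` is annihilated by `A` for `v ∈ k[M]`; by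
  -- the double annihilator it lies in `P`.
  have hle : M.augIdeal ≤ P := by
    have : TwoSidedIdeal.span (Set.range fun v : M.groupAlg =>
        M.incl v - algebraMap k (GroupAlg k O) (counit (R := k) v)) ≤ P.toTwoSided := by
      rw [TwoSidedIdeal.span_le]
      rintro _ ⟨v, rfl⟩
      rw [SetLike.mem_coe, Ideal.mem_toTwoSided]
      refine GroupAlg.mem_of_forall_apply_eq_zero (P.restrictScalars k) fun a ha => ?_
      have h1 : M.q a = counit (R := k) a • 1 := hq ha
      rw [map_sub, LinearMap.sub_apply, ClosedSubgroup.incl_apply, h1, GroupAlg.algebraMap_apply,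
        map_smul, GroupAlg.counit_apply, smul_eq_mul, mul_comm, sub_self]
    intro x hx
    exact Ideal.mem_toTwoSided.mp (this (TwoSidedIdeal.mem_asIdeal.mp hx))
  obtain ⟨E, -, hE, hE1, -⟩ := M.exists_retraction
  have hAM : A ≤ M.invariants := fun a ha =>
    M.mem_invariants_iff.mpr fun x hx => ha x (hle hx)
  have hMI {c : O} (hc : c ∈ M.invariants) (hε : counit (R := k) c = 0) : c ∈ I := by
    have h1 := M.counit_rTensor_coactR c
    rw [M.mem_invariants.mp hc, LinearMap.rTensor_tmul, TensorProduct.lid_tmul, hε,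
      zero_smul] at h1
    exact M.q_eq_zero_iff.mp h1.symm
  let W := Submodule.span k {y | ∃ a ∈ A, counit (R := k) a = 0 ∧
    ∃ c ∈ Subalgebra.toSubmodule M.invariants, a * c = y}
  -- The retraction is linear over the invariants, hence over `A`, and so sends `O(G) A⁺` into `A⁺`
  -- times the invariants.
  have hEI {b : O} (hb : b ∈ I) : (E b : O) ∈ W := by
    have : ∀ o : O, (E (o * b) : O) ∈ W := by
      refine Submodule.span_induction (p := fun b _ => ∀ o : O, (E (o * b) : O) ∈ W) ?_ ?_ ?_ ?_ hb
      · rintro a ⟨ha, hε⟩ o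
        have := hE ⟨a, hAM ha⟩ o
        rw [mul_comm, this]
        exact Submodule.subset_span ⟨a, ha, hε, E o, (E o).2, rfl⟩
      · simp
      · intro x y _ _ hx hy o
        rw [mul_add, map_add]; exact W.add_mem (hx o) (hy o)
      · intro c x _ hx o
        rw [smul_eq_mul, ← mul_assoc]; exact hx _
    simpa using this 1
  -- The remaining hypothesis of the criterion: for an invariant `c` the function `c - ε(c)`
  -- vanishes on `M`, so it lies in `I`, and the retraction fixes it. By `hEI` it lies in `A⁺` times
  -- the invariants.
  have hC : Subalgebra.toSubmodule M.invariants ≤ Subalgebra.toSubmodule A :=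
    le_of_le_sup_augmentation_mul A (fun a _ b _ => mul_comm a b)
      (fun a ha => comul_mem_of_forall_apply_eq_zero P _ (fun _ => Iff.rfl) ha) _
      (fun a ha c hc => M.invariants.mul_mem (hAM ha) hc) hAM
      (fun c hc => comul_mem_of_forall_apply_eq_zero M.augIdeal _ (fun _ => M.mem_invariants_iff) hc)
      (fun c hc => by
        have h1 : c - counit (R := k) c • 1 ∈ M.invariants :=
          M.invariants.sub_mem hc (M.invariants.smul_mem M.invariants.one_mem _)
        have h2 := hEI (hMI h1 (by simp))
        have h3 := hE ⟨_, h1⟩ 1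
        rw [mul_one, hE1, mul_one] at h3
        rw [h3] at h2
        exact Submodule.mem_sup.mpr ⟨_, A.smul_mem A.one_mem (counit (R := k) c), _, h2, by simp⟩)
  exact ⟨M, le_antisymm hle fun x hx => M.mem_augIdeal_iff.mpr fun a ha => hC ha x hx⟩

end NormalSubgroup

/-! ### Convolution algebras -/

section Convolution

variable {k A B C D : Type*} [Field k] [Ring A] [Algebra k A] [Ring B] [Algebra k B]
  [AddCommGroup C] [Module k C] [Coalgebra k C] [AddCommGroup D] [Module k D] [Coalgebra k D]

/-- Composition with a map of algebras, as a map of convolution algebras. -/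
def convPostcomp (C : Type*) [AddCommGroup C] [Module k C] [Coalgebra k C] (h : A →ₐ[k] B) :
    WithConv (C →ₗ[k] A) →* WithConv (C →ₗ[k] B) where
  toFun f := toConv (h.toLinearMap ∘ₗ f.ofConv)
  map_one' := WithConv.ext (LinearMap.ext fun c => by
    change h ((1 : WithConv (C →ₗ[k] A)) c) = (1 : WithConv (C →ₗ[k] B)) c
    simp)
  map_mul' f g := congrArg toConv (LinearMap.algHom_comp_convMul_distrib h f g)

/-- Composition with a map of coalgebras, as a map of convolution algebras. -/
def convPrecomp (A : Type*) [Ring A] [Algebra k A] (g : C →ₗc[k] D) :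
    WithConv (D →ₗ[k] A) →* WithConv (C →ₗ[k] A) where
  toFun f := toConv (f.ofConv ∘ₗ g.toLinearMap)
  map_one' := WithConv.ext (LinearMap.ext fun c => by
    change (1 : WithConv (D →ₗ[k] A)) (g c) = (1 : WithConv (C →ₗ[k] A)) c
    simp)
  map_mul' f f' := congrArg toConv (LinearMap.convMul_comp_coalgHom_distrib f f' g)

/-- A map of bialgebras between Hopf algebras respects the antipodes. -/
lemma map_antipode {A B : Type*} [Ring A] [HopfAlgebra k A] [Ring B] [HopfAlgebra k B]
    (f : A →ₐc[k] B) (a : A) :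
    f (HopfAlgebra.antipode k a) = HopfAlgebra.antipode k (f a) := by
  have h1 := congrArg (convPostcomp A (f : A →ₐ[k] B)) (LinearMap.antipode_mul_id (R := k) (C := A))
  have h2 := congrArg (convPrecomp B (f : A →ₗc[k] B)) (LinearMap.id_mul_antipode (R := k) (C := B))
  rw [map_mul, map_one] at h1 h2
  exact congr($(left_inv_eq_right_inv h1 h2) a)

end Convolution

/-! ### Cleft projections -/

section Cleft

variable {k R Q : Type*} [Field k] [Ring R] [Bialgebra k R] [Ring Q] [Bialgebra k Q]
  (p : R →ₐc[k] Q)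

/-- The coaction `r ↦ r₁ ⊗ p(r₂)` of `Q` on `R` given by a map of bialgebras `p : R → Q`. -/
def coactAlong : R →ₐ[k] R ⊗[k] Q :=
  (Algebra.TensorProduct.map (AlgHom.id k R) (p : R →ₐ[k] Q)).comp (Bialgebra.comulAlgHom k R)

lemma coactAlong_apply (r : R) : coactAlong p r =
    (p : R →ₗ[k] Q).lTensor R (comul (R := k) r) := rfl

lemma coactAlong_repr {ι : Type*} {u : R} (r : Coalgebra.Repr k u ι) :
    coactAlong p u = ∑ i ∈ r.index, r.left i ⊗ₜ p (r.right i) := by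
  rw [coactAlong_apply, ← r.eq, map_sum]; rfl

/-- The map `r ↦ r₁ g'(p(r₂))`. -/
def cleftRetraction (g' : Q →ₗ[k] R) : R →ₗ[k] R :=
  (toConv LinearMap.id * toConv (g' ∘ₗ (p : R →ₗ[k] Q))).ofConv

lemma cleftRetraction_eq (g' : Q →ₗ[k] R) (r : R) :
    cleftRetraction p g' r = LinearMap.mul' k R (g'.lTensor R (coactAlong p r)) := by
  refine ((ℛ k r).convMul_apply _ _).trans ?_
  rw [coactAlong_repr p (ℛ k r)]
  simp

/-- The coaction is multiplicative, so a coinvariant on the left stays in the first leg and factors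
out. -/
lemma cleftRetraction_mul (g' : Q →ₗ[k] R) {a : R} (ha : coactAlong p a = a ⊗ₜ 1) (r : R) :
    cleftRetraction p g' (a * r) = a * cleftRetraction p g' r := by
  rw [cleftRetraction_eq, cleftRetraction_eq, map_mul, ha]
  induction coactAlong p r with
  | zero => simp
  | add x y hx hy => simp only [mul_add, map_add, hx, hy]
  | tmul x y => simp [mul_assoc]

/-- If `g : Q → R` is convolution invertible and colinear, then the retraction takes values in
the coinvariants. -/
lemma coactAlong_cleftRetraction {g g' : Q →ₗ[k] R} (h : toConv g * toConv g' = 1)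
    (h' : toConv g' * toConv g = 1)
    (hg : ∀ x, coactAlong p (g x) = g.rTensor Q (comul (R := k) x)) (r : R) :
    coactAlong p (cleftRetraction p g' r) = cleftRetraction p g' r ⊗ₜ 1 := by
  let I := convPostcomp R (Algebra.TensorProduct.includeLeft : R →ₐ[k] R ⊗[k] Q)
  let P := convPostcomp R (coactAlong p)
  let T := convPrecomp R (p : R →ₗc[k] Q)
  let j : WithConv (R →ₗ[k] R ⊗[k] Q) := toConv
    ((Algebra.TensorProduct.includeRight : Q →ₐ[k] R ⊗[k] Q).toLinearMap ∘ₗ (p : R →ₗ[k] Q))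
  -- In convolution form the coaction multiplies the identity on the right by `j = 1 ⊗ p`. It does
  -- the same to `g p` by colinearity, so `j` cancels in the quotient of the two, which is the
  -- retraction.
  have hid : P (toConv LinearMap.id) = I (toConv LinearMap.id) * j := by
    refine WithConv.ext (LinearMap.ext fun u => ?_)
    refine Eq.trans (coactAlong_repr p (ℛ k u)) (Eq.trans ?_ ((ℛ k u).convMul_apply _ _).symm)
    exact Finset.sum_congr rfl fun i _ => by simp [I, j, convPostcomp]
  have hγ : P (T (toConv g)) = I (T (toConv g)) * j := by
    refine WithConv.ext (LinearMap.ext fun u => ?_)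
    refine Eq.trans (hg (p u)) (Eq.trans ?_ ((ℛ k u).convMul_apply _ _).symm)
    rw [← ((ℛ k u).induced p).eq, map_sum]
    exact Finset.sum_congr rfl fun i _ => by
      simp [I, j, T, convPostcomp, convPrecomp, Coalgebra.Repr.induced]
  have h1 : j = I (T (toConv g')) * P (T (toConv g)) := by
    rw [hγ, ← mul_assoc, ← map_mul, ← map_mul, h', map_one, map_one, one_mul]
  have h2 : P (toConv LinearMap.id * T (toConv g')) = I (toConv LinearMap.id * T (toConv g')) := by
    rw [map_mul, map_mul, hid, h1, mul_assoc, mul_assoc, ← map_mul P, ← map_mul, h,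
      map_one, map_one, mul_one]
  exact congr($h2 r)

/-- By colinearity the left side is `g(x₁) g'(x₂)`. -/
lemma cleftRetraction_apply {g g' : Q →ₗ[k] R} (h : toConv g * toConv g' = 1)
    (hg : ∀ x, coactAlong p (g x) = g.rTensor Q (comul (R := k) x)) (x : Q) :
    cleftRetraction p g' (g x) = counit (R := k) x • 1 := by
  rw [cleftRetraction_eq, hg, ← (ℛ k x).eq]
  have h1 := congr($h x)
  rw [(ℛ k x).convMul_apply, LinearMap.convOne_apply, Algebra.algebraMap_eq_smul_one] at h1
  rw [← h1]
  simp

end Cleft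

/-! ### Sections -/

namespace NormalSubgroup

variable {k O : Type u} [Field k] [CommRing O] [HopfAlgebra k O] [Module.Finite k O]
  (H : NormalSubgroup k O)

/-- The coaction `u ↦ u₁ ⊗ π(u₂)` of `k[G/H]` on `k[G]`. -/
def projCoact : GroupAlg k O →ₐ[k] GroupAlg k O ⊗[k] H.quotAlg := coactAlong H.proj

lemma projCoact_repr {ι : Type*} {u : GroupAlg k O} (r : Coalgebra.Repr k u ι) :
    H.projCoact u = ∑ i ∈ r.index, r.left i ⊗ₜ H.proj (r.right i) := coactAlong_repr _ r

lemma proj_incl (v : H.groupAlg) : H.proj (H.incl v) = counit (R := k) v • 1 :=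
  (H.mk_incl v).trans (Algebra.algebraMap_eq_smul_one _)

lemma projCoact_incl (v : H.groupAlg) : H.projCoact (H.incl v) = H.incl v ⊗ₜ 1 := by
  rw [projCoact_repr H (H.reprIncl (ℛ k v))]
  simp only [reprIncl, proj_incl, TensorProduct.tmul_smul, TensorProduct.smul_tmul',
    ← TensorProduct.sum_tmul, ← map_smul, ← map_sum]
  have h1 := congrArg (TensorProduct.rid k H.groupAlg) (sum_tmul_counit_eq (ℛ k v))
  simp only [map_sum, TensorProduct.rid_tmul, one_smul] at h1
  rw [h1]

lemma mem_sub_iff_projCoact [IsAlgClosed k] {u : GroupAlg k O} :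
    u ∈ H.sub ↔ H.projCoact u = u ⊗ₜ 1 :=
  ⟨fun ⟨v, hv⟩ => hv ▸ H.projCoact_incl v, H.mem_sub_of_coinvariant⟩

/-- The projection `π` as a map of coalgebras. -/
def projCoalg : GroupAlg k O →ₗc[k] H.quotAlg := (H.proj : GroupAlg k O →ₗc[k] H.quotAlg)

end NormalSubgroup

/-! ### The decomposition `u = η(u₁) γ(π(u₂))` given by a section -/

namespace Cleaving

variable {k O : Type u} [Field k] [CommRing O] [HopfAlgebra k O] [Module.Finite k O]
  {H : NormalSubgroup k O} (s : Cleaving H)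

/-- `γ π` as an element of the convolution algebra. -/
def γπ : WithConv (GroupAlg k O →ₗ[k] GroupAlg k O) :=
  toConv (s.γ ∘ₗ (H.proj : GroupAlg k O →ₗ[k] H.quotAlg))

/-- `γ⁻¹ π` as an element of the convolution algebra. -/
def γinvπ : WithConv (GroupAlg k O →ₗ[k] GroupAlg k O) :=
  toConv (s.γinv ∘ₗ (H.proj : GroupAlg k O →ₗ[k] H.quotAlg))

lemma γπ_mul_γinvπ : s.γπ * s.γinvπ = 1 := by
  have := congrArg (convPrecomp (GroupAlg k O) H.projCoalg) s.γ_mul_γinv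
  rwa [map_mul, map_one] at this

lemma γinvπ_mul_γπ : s.γinvπ * s.γπ = 1 := by
  have := congrArg (convPrecomp (GroupAlg k O) H.projCoalg) s.γinv_mul_γ
  rwa [map_mul, map_one] at this

lemma toConv_η : toConv s.η = toConv LinearMap.id * s.γinvπ := rfl

lemma toConv_ηinv : toConv s.ηinv = s.γπ * toConv (HopfAlgebra.antipode k) := rfl

lemma η_mul_γπ : toConv s.η * s.γπ = toConv LinearMap.id := by
  rw [toConv_η, mul_assoc, γinvπ_mul_γπ, mul_one]

lemma ηinv_mul_id : toConv s.ηinv * toConv LinearMap.id = s.γπ := by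
  rw [toConv_ηinv, mul_assoc, LinearMap.antipode_mul_id, mul_one]

lemma η_mul_ηinv : toConv s.η * toConv s.ηinv = 1 := by
  rw [toConv_ηinv, ← mul_assoc, η_mul_γπ, LinearMap.id_mul_antipode]

lemma ηinv_mul_η : toConv s.ηinv * toConv s.η = 1 := by
  rw [toConv_η, ← mul_assoc, ηinv_mul_id, γπ_mul_γinvπ]

lemma projCoact_γ (x : H.quotAlg) :
    H.projCoact (s.γ x) = s.γ.rTensor H.quotAlg (comul (R := k) x) := (s.colinear x).symm

lemma projCoact_γ_repr {ι : Type*} {x : H.quotAlg} (r : Coalgebra.Repr k x ι) :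
    H.projCoact (s.γ x) = ∑ i ∈ r.index, s.γ (r.left i) ⊗ₜ r.right i := by
  rw [projCoact_γ, ← r.eq, map_sum]; rfl

lemma projCoact_η (u : GroupAlg k O) : H.projCoact (s.η u) = s.η u ⊗ₜ 1 :=
  coactAlong_cleftRetraction H.proj s.γ_mul_γinv s.γinv_mul_γ s.projCoact_γ u

/-- Both sides are convolution inverses of the same map, because `η` takes coinvariant values. -/
lemma projCoact_ηinv (u : GroupAlg k O) : H.projCoact (s.ηinv u) = s.ηinv u ⊗ₜ 1 := by
  let I := convPostcomp (GroupAlg k O)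
    (Algebra.TensorProduct.includeLeft : GroupAlg k O →ₐ[k] GroupAlg k O ⊗[k] H.quotAlg)
  let P := convPostcomp (GroupAlg k O) H.projCoact
  have h0 : P (toConv s.η) = I (toConv s.η) := WithConv.ext (LinearMap.ext s.projCoact_η)
  have h1 : P (toConv s.ηinv) * I (toConv s.η) = 1 := by
    rw [← h0, ← map_mul, ηinv_mul_η, map_one]
  have h2 : I (toConv s.η) * I (toConv s.ηinv) = 1 := by
    rw [← map_mul, η_mul_ηinv, map_one]
  exact congr($(left_inv_eq_right_inv h1 h2) u)

lemma η_mem [IsAlgClosed k] (u : GroupAlg k O) : s.η u ∈ H.sub :=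
  H.mem_sub_iff_projCoact.mpr (s.projCoact_η u)

lemma ηinv_mem [IsAlgClosed k] (u : GroupAlg k O) : s.ηinv u ∈ H.sub :=
  H.mem_sub_iff_projCoact.mpr (s.projCoact_ηinv u)

lemma η_eq (u : GroupAlg k O) :
    s.η u = LinearMap.mul' k (GroupAlg k O) (s.γinv.lTensor (GroupAlg k O) (H.projCoact u)) :=
  cleftRetraction_eq H.proj s.γinv u

lemma η_incl_mul (v : H.groupAlg) (u : GroupAlg k O) :
    s.η (H.incl v * u) = H.incl v * s.η u :=
  cleftRetraction_mul H.proj s.γinv (H.projCoact_incl v) u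

lemma η_γ (x : H.quotAlg) : s.η (s.γ x) = counit (R := k) x • 1 :=
  cleftRetraction_apply H.proj s.γ_mul_γinv s.projCoact_γ x

/-- The coaction is multiplicative and `γ` is colinear, so the coaction of `γ(x) γ(y)` is `γ(x₁)
γ(y₁) ⊗ x₂ y₂`. Thus `σ` is the value of `B η` on products of section values, and it takes values in
`B(k[H])`. -/
lemma η_γ_mul_γ (x y : H.quotAlg) : s.η (s.γ x * s.γ y) = s.cocycle (x ⊗ₜ y) := by
  have h := ((ℛ k x).tmul (ℛ k y)).convMul_apply
    (toConv (LinearMap.mul' k (GroupAlg k O) ∘ₗ TensorProduct.map s.γ s.γ))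
    (toConv (s.γinv ∘ₗ LinearMap.mul' k H.quotAlg))
  refine Eq.trans ?_ h.symm
  rw [η_eq, map_mul, s.projCoact_γ_repr (ℛ k x), s.projCoact_γ_repr (ℛ k y), Finset.sum_mul_sum]
  simp [Finset.sum_product]

/-- `u = η(u₁) γ(π(u₂))` -/
lemma eq_sum_η_mul {ι : Type*} {u : GroupAlg k O} (r : Coalgebra.Repr k u ι) :
    u = ∑ i ∈ r.index, s.η (r.left i) * s.γ (H.proj (r.right i)) := by
  have h := congr($(s.η_mul_γπ) u)
  rw [r.convMul_apply] at h
  exact h.symm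

/-- `k[G]` is spanned by the products of elements of `k[H]` and of the image of `γ`. -/
lemma induction [IsAlgClosed k] {P : GroupAlg k O → Prop} (u : GroupAlg k O) (h0 : P 0)
    (hadd : ∀ x y, P x → P y → P (x + y)) (h : ∀ v x, P (H.incl v * s.γ x)) : P u := by
  rw [s.eq_sum_η_mul (ℛ k u)]
  refine Finset.sum_induction _ P hadd h0 fun i _ => ?_
  obtain ⟨v, hv⟩ := s.η_mem ((ℛ k u).left i)
  have := h v (H.proj ((ℛ k u).right i))
  rwa [← H.inclHom_apply, show H.inclHom v = _ from hv] at this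

end Cleaving

/-! ### The map `θ` -/

lemma comm_map {k M N M' N' : Type*} [Field k] [AddCommGroup M] [Module k M] [AddCommGroup N]
    [Module k N] [AddCommGroup M'] [Module k M'] [AddCommGroup N'] [Module k N']
    (f : M →ₗ[k] M') (g : N →ₗ[k] N') (z : M ⊗[k] N) :
    TensorProduct.comm k M' N' (TensorProduct.map f g z) =
      TensorProduct.map g f (TensorProduct.comm k M N z) := by
  induction z with
  | zero => simp
  | add x y hx hy => simp only [map_add, hx, hy]
  | tmul x y => rfl

lemma rTensor_mul_assoc_symm {k A M : Type*} [Field k] [CommRing A] [Algebra k A] [AddCommGroup M]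
    [Module k M] (a : A) (c : A ⊗[k] M) : (LinearMap.mul' k A).rTensor M
      ((TensorProduct.assoc k A A M).symm (a ⊗ₜ c)) = a • c := by
  induction c with
  | zero => simp
  | add x y hx hy => rw [TensorProduct.tmul_add, map_add, map_add, hx, hy, smul_add]
  | tmul b x => simp [TensorProduct.smul_tmul']

namespace NormalSubgroup

variable {k O : Type u} [Field k] [CommRing O] [HopfAlgebra k O] [Module.Finite k O]
  (K : NormalSubgroup k O)

/-- The action of `k[G]` on `O(K)` as a map of algebras. -/
def actHom : GroupAlg k O →ₐ[k] Module.End k K.coord :=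
  AlgHom.ofLinearMap K.act
    (LinearMap.ext fun a => by
      obtain ⟨b, rfl⟩ := K.q_surjective a
      rw [act_q, ← coadjAlgHom_apply, map_one]; rfl)
    (fun u w => LinearMap.ext fun a => by
      obtain ⟨b, rfl⟩ := K.q_surjective a
      rw [Module.End.mul_apply, act_q, act_q, act_q, ← coadjAlgHom_apply, map_mul]; rfl)

lemma actHom_apply (u : GroupAlg k O) : K.actHom u = K.act u := rfl

lemma act_mul {ι : Type*} {u : GroupAlg k O} (r : Coalgebra.Repr k u ι) (a b : K.coord) :
    K.act u (a * b) = ∑ i ∈ r.index, K.act (r.left i) a * K.act (r.right i) b := by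
  obtain ⟨a, rfl⟩ := K.q_surjective a
  obtain ⟨b, rfl⟩ := K.q_surjective b
  rw [← map_mul, act_q, coadj_mul r, map_sum]
  simp only [map_mul, act_q]

end NormalSubgroup

namespace Triple

variable {k O : Type u} [Field k] [CommRing O] [HopfAlgebra k O] [Module.Finite k O]
  (t : Triple k O) (s : Cleaving t.H)

/-- Dually, `S(v₁) w v₂ = S(v₁) v₂ w = ε(v) w` for `w ∈ k[K]`, as `H` and `K` centralize each other.
-/
lemma act_incl (v : t.H.groupAlg) (a : t.K.coord) :
    t.K.act (t.H.incl v) a = counit (R := k) v • a := by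
  obtain ⟨b, rfl⟩ := t.K.q_surjective a
  have h : t.K.q (coadj k O (t.H.incl v) b) - counit (R := k) v • t.K.q b = 0 := by
    refine (Module.forall_dual_apply_eq_zero_iff k _).mp fun f => ?_
    obtain ⟨w, rfl⟩ := (GroupAlg.toDual k t.K.coord).surjective f
    rw [map_sub, sub_eq_zero, map_smul, ← ClosedSubgroup.incl_apply, ← ClosedSubgroup.incl_apply,
      pair_coadj (t.H.reprIncl (ℛ k v)), ← GroupAlg.sum_apply]
    have h1 (i) : HopfAlgebra.antipode k ((t.H.reprIncl (ℛ k v)).left i) * t.K.incl w *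
        (t.H.reprIncl (ℛ k v)).right i = HopfAlgebra.antipode k ((t.H.reprIncl (ℛ k v)).left i) *
        (t.H.reprIncl (ℛ k v)).right i * t.K.incl w := by
      have := t.centralize ((ℛ k v).right i) w
      rw [mul_assoc, mul_assoc]
      exact congrArg _ this.symm
    simp only [h1]
    rw [← Finset.sum_mul, HopfAlgebra.sum_antipode_mul_eq_smul, smul_mul_assoc, one_mul,
      NormalSubgroup.counit_incl, map_smul]
    rfl
  rw [NormalSubgroup.act_q, sub_eq_zero.mp h]

/-- The action of `k[G]` on `O(K)` factors through `k[G/H]`. -/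
lemma dot_proj (u : GroupAlg k O) : t.dot s (t.H.proj u) = t.K.act u := by
  have h1 : u - s.γ (t.H.proj u) ∈ t.H.augIdeal := by
    rw [← t.H.proj_eq_zero_iff, map_sub, s.proj_γ, sub_self]
  have h2 := t.H.map_eq_zero_of_mem_augIdeal t.K.actHom (fun v => LinearMap.ext fun a => by
    rw [NormalSubgroup.actHom_apply, act_incl, Algebra.algebraMap_eq_smul_one]; rfl) h1
  rw [map_sub, sub_eq_zero] at h2
  exact h2.symm

/-- The inclusion of `O(K)` in `D(K, H, B)`. -/
def inl : t.K.coord →ₐ[k] t.Carrier := Algebra.TensorProduct.includeLeft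

lemma inl_apply (a : t.K.coord) : t.inl a = a ⊗ₜ 1 := rfl

lemma inl_mul_tmul (a b : t.K.coord) (x : t.H.quotAlg) : t.inl a * b ⊗ₜ[k] x = (a * b) ⊗ₜ x := by
  rw [inl_apply, Algebra.TensorProduct.tmul_mul_tmul, one_mul]

lemma inl_mul (a : t.K.coord) (c : t.Carrier) : t.inl a * c = a • c := by
  induction c using TensorProduct.induction_on with
  | zero => simp
  | add x y hx hy => rw [mul_add, hx, hy, smul_add]
  | tmul b x => rw [inl_mul_tmul, TensorProduct.smul_tmul', smul_eq_mul]

lemma θ_inrA (u : GroupAlg k O) :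
    t.θ s (Double.inrA u) = (t.BExt ∘ₗ s.η).rTensor t.H.quotAlg (t.H.projCoact u) := by
  change t.θ s (Double.mk 1 u) = _
  rw [θ_mk t s 1 (ℛ k u), t.H.projCoact_repr (ℛ k u)]
  simp

lemma θ_inlO_mul_inrA (b : O) (u : GroupAlg k O) :
    t.θ s (Double.inlO b * Double.inrA u) = t.inl (t.K.q b) * t.θ s (Double.inrA u) := by
  rw [← Double.mk_eq, θ_mk t s b (ℛ k u), θ_inrA, t.H.projCoact_repr (ℛ k u)]
  simp [Finset.mul_sum, inl_mul_tmul]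

lemma θ_inlO_mul (b : O) (d : Double k O) :
    t.θ s (Double.inlO b * d) = t.inl (t.K.q b) * t.θ s d := by
  induction d using Double.induction with
  | h0 => simp
  | hadd x y hx hy => simp only [mul_add, map_add, hx, hy]
  | h c u => rw [← mul_assoc, ← map_mul, θ_inlO_mul_inrA, θ_inlO_mul_inrA, map_mul, map_mul,
      mul_assoc]

lemma θ_γ (x : t.H.quotAlg) : t.θ s (Double.inrA (s.γ x)) = 1 ⊗ₜ x := by
  rw [θ_inrA, s.projCoact_γ_repr (ℛ k x)]
  have h1 : t.BExt 1 = 1 := by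
    rw [← t.H.incl_one, BExt_incl, map_one]
  simp only [map_sum, LinearMap.rTensor_tmul, LinearMap.comp_apply, s.η_γ, map_smul, h1,
    TensorProduct.smul_tmul, ← TensorProduct.tmul_sum, sum_counit_smul]

variable [IsAlgClosed k]

lemma θ_incl_mul_inrA (v : t.H.groupAlg) (u : GroupAlg k O) :
    t.θ s (Double.inrA (t.H.incl v * u)) = t.inl (t.B v) * t.θ s (Double.inrA u) := by
  have h1 (u : GroupAlg k O) : t.BExt (s.η (t.H.incl v * u)) = t.B v * t.BExt (s.η u) := by
    obtain ⟨w, hw⟩ := s.η_mem u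
    change t.H.incl w = _ at hw
    rw [s.η_incl_mul, ← hw, ← t.H.incl_mul, BExt_incl, BExt_incl, map_mul]
  rw [θ_inrA, θ_inrA, map_mul, t.H.projCoact_incl]
  induction t.H.projCoact u with
  | zero => simp
  | add x y hx hy => simp only [mul_add, map_add, hx, hy]
  | tmul x y => simp [h1, inl_mul_tmul]

/-- To move `v` past `b ∈ O(G)` costs the coadjoint action, which `k[H]` performs trivially on
`O(K)`. Commutativity of `O(K)` then brings `B(v)` to the front. -/
lemma θ_incl_mul (v : t.H.groupAlg) (d : Double k O) :
    t.θ s (Double.inrA (t.H.incl v) * d) = t.inl (t.B v) * t.θ s d := by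
  induction d using Double.induction with
  | h0 => simp
  | hadd x y hx hy => simp only [mul_add, map_add, hx, hy]
  | h b u =>
    rw [← mul_assoc, Double.inrA_mul_inlO (t.H.reprIncl (ℛ k v)), Finset.sum_mul, map_sum]
    simp only [mul_assoc, θ_inlO_mul, ← NormalSubgroup.act_q, NormalSubgroup.reprIncl, act_incl,
      map_smul, smul_mul_assoc, ← map_mul, θ_incl_mul_inrA]
    have h1 := sum_counit_smul (ℛ k v)
    conv_rhs => rw [← h1]
    simp only [map_sum, map_smul, Finset.sum_mul, smul_mul_assoc]
    exact Finset.sum_congr rfl fun i _ => congrArg _ (by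
      rw [← mul_assoc, ← mul_assoc, ← map_mul, ← map_mul, mul_comm])

/-- The normal form in which all properties of `θ` are checked, together with `double_induction`. -/
lemma θ_apply (b : O) (v : t.H.groupAlg) (x : t.H.quotAlg) :
    t.θ s (Double.inlO b * Double.inrA (t.H.incl v * s.γ x)) = (t.K.q b * t.B v) ⊗ₜ x := by
  rw [θ_inlO_mul, map_mul, θ_incl_mul, θ_γ, inl_mul_tmul, inl_mul_tmul, mul_one]

omit [IsAlgClosed k] in
/-- `D(G)` is spanned by the products of elements of `O(G)`, of `k[H]`, and of the image of `γ`. -/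
lemma double_induction [IsAlgClosed k] {P : Double k O → Prop} (d : Double k O) (h0 : P 0)
    (hadd : ∀ x y, P x → P y → P (x + y))
    (h : ∀ b v x, P (Double.inlO b * Double.inrA (t.H.incl v * s.γ x))) : P d := by
  induction d using Double.induction with
  | h0 => exact h0
  | hadd x y hx hy => exact hadd x y hx hy
  | h b u =>
    induction u using s.induction with
    | h0 => rwa [map_zero, mul_zero]
    | hadd x y hx hy => rw [map_add, mul_add]; exact hadd _ _ hx hy
    | h v x => exact h b v x

/-- The map `u ↦ (u * a) # 1`, as an element of the convolution algebra. -/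
def actConv (a : t.K.coord) : WithConv (GroupAlg k O →ₗ[k] t.Carrier) :=
  toConv (t.inl.toLinearMap ∘ₗ t.K.act.flip a)

/-- The map `u ↦ θ(u d)`, as an element of the convolution algebra. -/
def θMul (d : Double k O) : WithConv (GroupAlg k O →ₗ[k] t.Carrier) :=
  toConv (t.θ s ∘ₗ LinearMap.mulRight k d ∘ₗ Double.inrA.toLinearMap)

omit [IsAlgClosed k] in
omit [IsAlgClosed k] in
omit [IsAlgClosed k] in
lemma actConv_mul (a b : t.K.coord) : t.actConv (a * b) = t.actConv a * t.actConv b := by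
  refine WithConv.ext (LinearMap.ext fun u => ?_)
  refine Eq.trans ?_ ((ℛ k u).convMul_apply _ _).symm
  change t.inl (t.K.act u (a * b)) = _
  rw [t.K.act_mul (ℛ k u), map_sum]
  simp only [map_mul]
  rfl

-- The relation `u b = (u₁ ⇀ b) u₂` of the double, as an identity of functions of `u` in the
-- convolution algebra.
omit [IsAlgClosed k] in
lemma θMul_inlO_mul (b : O) (d : Double k O) :
    t.θMul s (Double.inlO b * d) = t.actConv (t.K.q b) * t.θMul s d := by
  refine WithConv.ext (LinearMap.ext fun u => ?_)
  refine Eq.trans ?_ ((ℛ k u).convMul_apply _ _).symm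
  change t.θ s (Double.inrA u * (Double.inlO b * d)) = _
  rw [← mul_assoc, Double.inrA_mul_inlO (ℛ k u), Finset.sum_mul, map_sum]
  simp only [mul_assoc, θ_inlO_mul, ← NormalSubgroup.act_q]
  rfl

/-- The relation `u v = ad(u₁)(v) u₂`, in which equivariance of `B` turns the adjoint action into
the action on `O(K)`. So `v` behaves under `θ` like the function `B(v)`. -/
lemma θMul_incl_mul (v : t.H.groupAlg) (d : Double k O) :
    t.θMul s (Double.inrA (t.H.incl v) * d) = t.actConv (t.B v) * t.θMul s d := by
  refine WithConv.ext (LinearMap.ext fun u => ?_)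
  refine Eq.trans ?_ ((ℛ k u).convMul_apply _ _).symm
  change t.θ s (Double.inrA u * (Double.inrA (t.H.incl v) * d)) = _
  rw [← mul_assoc, ← map_mul, mul_eq_sum_adL_mul (ℛ k u), map_sum, Finset.sum_mul, map_sum]
  refine Finset.sum_congr rfl fun i _ => ?_
  obtain ⟨w, hw⟩ := t.H.exists_incl_eq_adL ((ℛ k u).left i) v
  rw [← hw, map_mul Double.inrA, mul_assoc, θ_incl_mul, ← t.equivariant _ v w hw]
  rfl

lemma θ_γ_mul_γ (x y : t.H.quotAlg) :
    t.θ s (Double.inrA (s.γ x * s.γ y)) = t.crossed s (x ⊗ₜ y) := by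
  rw [θ_inrA, map_mul, s.projCoact_γ_repr (ℛ k x), s.projCoact_γ_repr (ℛ k y),
    crossed_tmul t s (ℛ k x) (ℛ k y), Finset.sum_mul_sum]
  simp only [map_sum, Algebra.TensorProduct.tmul_mul_tmul, LinearMap.rTensor_tmul,
    LinearMap.comp_apply, s.η_γ_mul_γ]
  rfl

-- Colinearity of `γ` on the other side, available because `k[G]` and hence `k[G/H]` are
-- cocommutative.
omit [IsAlgClosed k] in
lemma sum_proj_tmul_γ (x : t.H.quotAlg) :
    (t.H.proj : GroupAlg k O →ₗ[k] t.H.quotAlg).rTensor (GroupAlg k O) (comul (R := k) (s.γ x)) =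
      s.γ.lTensor t.H.quotAlg (comul (R := k) x) := by
  have h := congrArg (TensorProduct.comm k _ _) (s.colinear x)
  have h3 : TensorProduct.comm k _ _ (comul (R := k) x) = comul x := by
    obtain ⟨u, rfl⟩ := t.H.proj_surjective x
    rw [t.H.comul_proj, comm_map, comm_comul]
  rw [LinearMap.rTensor, LinearMap.lTensor, comm_map, comm_map, h3, comm_comul] at h
  exact h.symm

/-- `k[G]` acts on `O(K)` through `k[G/H]`, so only `π` of the first leg of `Δ(γ(x))` matters. By
colinearity the convolution over `k[G]` at `γ(x)` becomes the sum over `Δ(x)` that defines the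
product of `D(K, H, B)`. -/
lemma leftMul_apply (x y : t.H.quotAlg) (a : t.K.coord) :
    t.leftMul s x (a ⊗ₜ y) = (t.actConv a * t.θMul s (Double.inrA (s.γ y))) (s.γ x) := by
  have h1 (z : GroupAlg k O ⊗[k] GroupAlg k O) : LinearMap.mul' k t.Carrier
      (TensorProduct.map (t.actConv a).ofConv (t.θMul s (Double.inrA (s.γ y))).ofConv z) =
      LinearMap.mul' k t.Carrier (TensorProduct.map (t.inl.toLinearMap ∘ₗ (t.dot s).flip a)
        (t.θMul s (Double.inrA (s.γ y))).ofConv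
          ((t.H.proj : GroupAlg k O →ₗ[k] t.H.quotAlg).rTensor (GroupAlg k O) z)) := by
    induction z with
    | zero => simp
    | add x y hx hy => simp only [map_add, hx, hy]
    | tmul u w =>
      simp only [TensorProduct.map_tmul, LinearMap.rTensor_tmul, LinearMap.mul'_apply,
        LinearMap.comp_apply, LinearMap.flip_apply]
      have := t.dot_proj s u
      exact congrArg (· * _) (congrArg t.inl congr($this.symm a))
  have h2 : (t.actConv a * t.θMul s (Double.inrA (s.γ y))) (s.γ x) = LinearMap.mul' k t.Carrier
      (TensorProduct.map (t.actConv a).ofConv (t.θMul s (Double.inrA (s.γ y))).ofConv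
        (comul (R := k) (s.γ x))) := rfl
  rw [h2, h1, sum_proj_tmul_γ, ← (ℛ k x).eq, leftMul, LinearMap.comp_apply, LinearMap.comp_apply,
    ← (ℛ k x).eq]
  simp only [map_sum, LinearMap.sum_apply]
  refine Finset.sum_congr rfl fun i _ => ?_
  simp only [LinearMap.lTensor_tmul, TensorProduct.map_tmul, LinearMap.mul'_apply,
    LinearMap.comp_apply, LinearMap.flip_apply]
  have h3 : (t.θMul s (Double.inrA (s.γ y))).ofConv (s.γ ((ℛ k x).right i)) =
      t.crossed s ((ℛ k x).right i ⊗ₜ y) := by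
    rw [← θ_γ_mul_γ, map_mul]; rfl
  rw [h3]
  change _ = t.inl _ * _
  rw [inl_mul]
  change (LinearMap.mul' k t.K.coord).rTensor t.H.quotAlg ((TensorProduct.assoc k t.K.coord t.K.coord
    t.H.quotAlg).symm ((t.dot s _ a) ⊗ₜ (t.crossed s (_ ⊗ₜ y)))) = _
  exact rTensor_mul_assoc_symm _ _

/-- For `d = b v γ(y)` the factors `b` and `v` are absorbed in turn into the convolution product;
what is left is the formula of `leftMul_apply` with `a = q(b) B(v)`. -/
lemma θ_γ_mul (x : t.H.quotAlg) (d : Double k O) :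
    t.θ s (Double.inrA (s.γ x) * d) = t.leftMul s x (t.θ s d) := by
  induction d using t.double_induction s with
  | h0 => simp
  | hadd x y hx hy => simp only [mul_add, map_add, hx, hy]
  | h b v y =>
    rw [θ_apply, leftMul_apply, actConv_mul, mul_assoc (t.actConv _), ← θMul_incl_mul,
      ← θMul_inlO_mul, ← map_mul]
    rfl

lemma mulD_inl_mul (a : t.K.coord) (c d : t.Carrier) :
    t.mulD s (t.inl a * c) d = t.inl a * t.mulD s c d := by
  induction c using TensorProduct.induction_on with
  | zero => simp
  | add x y hx hy => simp only [mul_add, map_add, LinearMap.add_apply, hx, hy]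
  | tmul b x =>
    rw [inl_mul_tmul, inl_mul]
    change (a * b) • t.leftMul s x d = a • b • t.leftMul s x d
    rw [mul_smul]

lemma θ_mul (d e : Double k O) : t.θ s (d * e) = t.mulD s (t.θ s d) (t.θ s e) := by
  induction d using t.double_induction s with
  | h0 => simp
  | hadd x y hx hy => simp only [add_mul, map_add, LinearMap.add_apply, hx, hy]
  | h b v x =>
    rw [map_mul Double.inrA, mul_assoc, mul_assoc, θ_inlO_mul, θ_inlO_mul, θ_incl_mul, θ_incl_mul, θ_γ_mul,
      mulD_inl_mul, mulD_inl_mul, θ_γ]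
    congr 2
    change _ = (1 : t.K.coord) • t.leftMul s x _
    rw [one_smul]

lemma θ_one : t.θ s 1 = 1 ⊗ₜ 1 := by
  rw [← map_one Double.inrA, ← s.γ_one, θ_γ]

lemma θ_surjective : Function.Surjective (t.θ s) := by
  intro c
  induction c using TensorProduct.induction_on with
  | zero => exact ⟨0, map_zero _⟩
  | add x y hx hy =>
    obtain ⟨d, rfl⟩ := hx
    obtain ⟨e, rfl⟩ := hy
    exact ⟨d + e, map_add _ _ _⟩
  | tmul a x =>
    obtain ⟨b, rfl⟩ := t.K.q_surjective a
    exact ⟨Double.inlO b * Double.inrA (s.γ x), by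
      rw [θ_inlO_mul, θ_γ, inl_mul_tmul, mul_one]⟩

lemma counitD_θ (d : Double k O) : t.counitD (t.θ s d) = counit (R := k) d := by
  induction d using t.double_induction s with
  | h0 => simp
  | hadd x y hx hy => simp only [map_add, hx, hy]
  | h b v x =>
    rw [θ_apply]
    change counit (R := k) (t.K.q b * t.B v) * counit (R := k) x = _
    rw [Bialgebra.counit_mul, ClosedSubgroup.counit_q, Bialgebra.counit_mul, Double.counit_inlO,
      Double.counit_inrA, Bialgebra.counit_mul, NormalSubgroup.counit_incl, s.counit_γ, mul_assoc]
    congr 2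
    exact CoalgHomClass.counit_comp_apply t.B v

/-- The formula is forced by reversing products: `S(a # x) = θ(S(γ(x))) (S(a) # 1)`. It is well
defined on the tensor product, and `B` commutes with the antipodes. -/
lemma exists_antipode : ∃ S : t.Carrier →ₗ[k] t.Carrier, ∀ d : Double k O,
    S (t.θ s d) = t.θ s (HopfAlgebra.antipode k d) := by
  let S : t.Carrier →ₗ[k] t.Carrier := TensorProduct.lift
    (((t.mulD s).flip ∘ₗ t.inl.toLinearMap ∘ₗ HopfAlgebra.antipode k).compl₂
      (t.θ s ∘ₗ Double.inrA.toLinearMap ∘ₗ HopfAlgebra.antipode k ∘ₗ s.γ))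
  refine ⟨S, fun d => ?_⟩
  induction d using t.double_induction s with
  | h0 => simp
  | hadd x y hx hy => simp only [map_add, hx, hy]
  | h b v x =>
    have hO : HopfAlgebra.antipode k (Double.inlO b : Double k O) =
      Double.inlO (HopfAlgebra.antipode k b) := Double.antipodeLin_inlO b
    have hA (u : GroupAlg k O) : HopfAlgebra.antipode k (Double.inrA u : Double k O) =
      Double.inrA (HopfAlgebra.antipode k u) := Double.antipodeLin_inrA u
    have hE : t.θ s (Double.inlO (HopfAlgebra.antipode k b)) =
        t.inl (t.K.q (HopfAlgebra.antipode k b)) := by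
      rw [← mul_one (Double.inlO (HopfAlgebra.antipode k b)), θ_inlO_mul, θ_one]
      exact mul_one _
    rw [θ_apply, HopfAlgebra.antipode_mul_antidistrib, hO, hA,
      HopfAlgebra.antipode_mul_antidistrib, map_mul Double.inrA, mul_assoc, θ_mul, t.H.antipode_incl,
      θ_incl_mul, hE]
    change t.mulD s (t.θ s (Double.inrA (HopfAlgebra.antipode k (s.γ x))))
      (t.inl (HopfAlgebra.antipode k (t.K.q b * t.B v))) = _
    rw [HopfAlgebra.antipode_mul_antidistrib, map_mul, map_antipode, ClosedSubgroup.antipode_q]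

end Triple

/-! ### Compatibility of `θ` with the comultiplication -/

namespace Cleaving

variable {k O : Type u} [Field k] [CommRing O] [HopfAlgebra k O] [Module.Finite k O]
  {H : NormalSubgroup k O} (s : Cleaving H)

/-- `coTwist(u₁) (γ(π(u₂)) ⊗ γ(π(u₃))) = Δ(γ(π(u)))` -/
lemma coTwist_mul : toConv s.coTwist * toConv (TensorProduct.map s.γπ.ofConv s.γπ.ofConv ∘ₗ comul) =
    toConv (comul ∘ₗ s.γπ.ofConv) := by
  let Δ := convPostcomp (GroupAlg k O) (Bialgebra.comulAlgHom k (GroupAlg k O))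
  let Γ := convPrecomp (GroupAlg k O ⊗[k] GroupAlg k O) (comulCoalgHom k (GroupAlg k O))
  have h1 : toConv s.coTwist = Δ (toConv s.ηinv) * Γ (toConv (TensorProduct.map s.η s.η)) := rfl
  -- Cocommutativity makes `Δ` a map of coalgebras, so `η * γπ = id` can be used in both legs at
  -- once. The remaining factor `Δ η⁻¹` then yields `Δ(γ π)`, since `η⁻¹ * id = γπ`.
  have h2 : Γ (toConv (TensorProduct.map s.η s.η)) *
      Γ (toConv (TensorProduct.map s.γπ.ofConv s.γπ.ofConv)) = Δ (toConv LinearMap.id) := by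
    rw [← map_mul]
    have h3 := TensorProduct.map_convMul_map (f := toConv s.η) (g := toConv s.η) (h := s.γπ)
      (k := s.γπ)
    rw [η_mul_γπ] at h3
    refine Eq.trans (congrArg Γ h3) ?_
    refine WithConv.ext (LinearMap.ext fun u => ?_)
    change TensorProduct.map LinearMap.id LinearMap.id (comul u) = comul u
    rw [TensorProduct.map_id, LinearMap.id_apply]
  refine Eq.trans (congrArg (· * _) h1) ?_
  rw [mul_assoc]
  refine Eq.trans (congrArg (_ * ·) h2) ?_
  rw [← map_mul, ηinv_mul_id]
  rfl

/-- `coTwist_mul` at `γ(x)`, with colinearity replacing `π` of the second leg. Under `B ⊗ B` the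
first factor becomes `τ`, so `τ` measures how far `γ` is from a map of coalgebras. -/
lemma comul_γ {ι : Type*} {x : H.quotAlg} (r : Coalgebra.Repr k x ι) :
    comul (R := k) (s.γ x) = ∑ i ∈ r.index, s.coTwist (s.γ (r.left i)) *
      TensorProduct.map s.γ s.γ (comul (R := k) (r.right i)) := by
  have h1 := congr($(s.coTwist_mul) (s.γ x))
  have h2 : (toConv (comul ∘ₗ s.γπ.ofConv) : WithConv (GroupAlg k O →ₗ[k] _)) (s.γ x) =
      comul (R := k) (s.γ x) :=
    congrArg (fun y => comul (R := k) (s.γ y)) (s.proj_γ x)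
  rw [h2] at h1
  rw [← h1]
  have h3 (z : GroupAlg k O ⊗[k] GroupAlg k O) : TensorProduct.map s.γπ.ofConv s.γπ.ofConv z =
      TensorProduct.map s.γ s.γ (TensorProduct.map (H.proj : GroupAlg k O →ₗ[k] H.quotAlg)
        (H.proj : GroupAlg k O →ₗ[k] H.quotAlg) z) := by
    rw [TensorProduct.map_map]; rfl
  have h4 (z : GroupAlg k O ⊗[k] GroupAlg k O) : LinearMap.mul' k (GroupAlg k O ⊗[k] GroupAlg k O)
      (TensorProduct.map s.coTwist (TensorProduct.map s.γπ.ofConv s.γπ.ofConv ∘ₗ comul) z) =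
      LinearMap.mul' k (GroupAlg k O ⊗[k] GroupAlg k O) (TensorProduct.map s.coTwist
        (TensorProduct.map s.γ s.γ ∘ₗ comul)
        ((H.proj : GroupAlg k O →ₗ[k] H.quotAlg).lTensor (GroupAlg k O) z)) := by
    induction z with
    | zero => simp
    | add x y hx hy => simp only [map_add, hx, hy]
    | tmul u w =>
      simp only [TensorProduct.map_tmul, LinearMap.lTensor_tmul, LinearMap.comp_apply, h3]
      rfl
  refine (h4 (comul (s.γ x))).trans ?_
  rw [← s.colinear, ← r.eq]
  simp

/-- The values of `coTwist` lie in `k[H] ⊗ k[H]`. -/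
lemma coTwist_mem [IsAlgClosed k] (u : GroupAlg k O) :
    ∃ z, TensorProduct.map H.incl H.incl z = s.coTwist u := by
  let R := (Algebra.TensorProduct.map H.inclHom H.inclHom).range
  suffices h : s.coTwist u ∈ R from h
  have h1 (w : GroupAlg k O) : comul (R := k) (s.ηinv w) ∈ R := by
    obtain ⟨v, hv⟩ := s.ηinv_mem w
    change H.incl v = _ at hv
    rw [← hv, NormalSubgroup.comul_incl]
    exact ⟨_, rfl⟩
  have h2 (z : GroupAlg k O ⊗[k] GroupAlg k O) : TensorProduct.map s.η s.η z ∈ R := by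
    induction z with
    | zero => rw [map_zero]; exact R.zero_mem
    | add x y hx hy => rw [map_add]; exact R.add_mem hx hy
    | tmul x y =>
      obtain ⟨v, hv⟩ := s.η_mem x
      obtain ⟨w, hw⟩ := s.η_mem y
      refine ⟨v ⊗ₜ w, ?_⟩
      change H.inclHom v = _ at hv
      change H.inclHom w = _ at hw
      rw [TensorProduct.map_tmul, ← hv, ← hw]
      rfl
  have h3 := (ℛ k u).convMul_apply (toConv (comul ∘ₗ s.ηinv))
    (toConv (TensorProduct.map s.η s.η ∘ₗ comul))
  have h4 : s.coTwist u = (toConv (comul ∘ₗ s.ηinv) *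
    toConv (TensorProduct.map s.η s.η ∘ₗ comul) : WithConv (GroupAlg k O →ₗ[k] _)) u := rfl
  rw [h4, h3]
  exact R.sum_mem fun i _ => R.mul_mem (h1 _) (h2 _)

end Cleaving

namespace Triple

variable {k O : Type u} [Field k] [CommRing O] [HopfAlgebra k O] [Module.Finite k O]
  (t : Triple k O) (s : Cleaving t.H)

/-- The action of `O(K) ⊗ O(K)` on `D(K, H, B) ⊗ D(K, H, B)`. -/
def lsmul₂ : t.K.coord ⊗[k] t.K.coord →ₐ[k] Module.End k (t.Carrier ⊗[k] t.Carrier) :=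
  (Module.endTensorEndAlgHom (R := k) (S := k) (A := k) (M := t.Carrier) (N := t.Carrier)).comp
    (Algebra.TensorProduct.map (Algebra.lsmul k k t.Carrier) (Algebra.lsmul k k t.Carrier))

lemma lsmul₂_tmul (a b : t.K.coord) (c d : t.Carrier) :
    t.lsmul₂ (a ⊗ₜ b) (c ⊗ₜ d) = (a • c) ⊗ₜ (b • d) := rfl

/-- The exchange of the middle factors in `(O(K) ⊗ O(K)) ⊗ (k[G/H] ⊗ k[G/H])`. -/
def middleSwap : (t.K.coord ⊗[k] t.K.coord) ⊗[k] (t.H.quotAlg ⊗[k] t.H.quotAlg) →ₗ[k]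
    t.Carrier ⊗[k] t.Carrier :=
  (TensorProduct.tensorTensorTensorComm k t.K.coord t.K.coord t.H.quotAlg t.H.quotAlg).toLinearMap

lemma middleSwap_tmul (a b : t.K.coord) (x y : t.H.quotAlg) :
    t.middleSwap ((a ⊗ₜ b) ⊗ₜ (x ⊗ₜ y)) = (a ⊗ₜ x) ⊗ₜ (b ⊗ₜ y) :=
  TensorProduct.tensorTensorTensorComm_tmul ..

set_option synthInstance.maxHeartbeats 100000 in
lemma middleSwap_mul (p τ : t.K.coord ⊗[k] t.K.coord) (z : t.H.quotAlg ⊗[k] t.H.quotAlg) :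
    t.middleSwap ((p * τ) ⊗ₜ z) = t.lsmul₂ p (t.middleSwap (τ ⊗ₜ z)) := by
  induction p with
  | zero => simp only [zero_mul, TensorProduct.zero_tmul, map_zero, LinearMap.zero_apply]
  | add x y hx hy => simp only [add_mul, TensorProduct.add_tmul, map_add, LinearMap.add_apply, hx, hy]
  | tmul a b =>
    induction τ with
    | zero => simp only [mul_zero, TensorProduct.zero_tmul, map_zero]
    | add x y hx hy => simp only [mul_add, TensorProduct.add_tmul, map_add, hx, hy]
    | tmul c d =>
      induction z with
      | zero => simp only [TensorProduct.tmul_zero, map_zero]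
      | add x y hx hy => simp only [TensorProduct.tmul_add, map_add, hx, hy]
      | tmul x y =>
        rw [Algebra.TensorProduct.tmul_mul_tmul, middleSwap_tmul, middleSwap_tmul, lsmul₂_tmul,
          TensorProduct.smul_tmul', TensorProduct.smul_tmul', smul_eq_mul, smul_eq_mul]

lemma comulD_eq_sum {ι : Type*} (a : t.K.coord) {x : t.H.quotAlg} (r : Coalgebra.Repr k x ι) :
    t.comulD s (a ⊗ₜ x) = t.lsmul₂ (TensorProduct.comm k _ _ (comul (R := k) a))
      (∑ i ∈ r.index, t.middleSwap (t.τ s (r.left i) ⊗ₜ comul (R := k) (r.right i))) := by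
  rw [comulD_tmul t s (ℛ k a) r (fun i => ℛ k (r.right i)), map_sum, Finset.sum_comm]
  refine Finset.sum_congr rfl fun i _ => ?_
  rw [← middleSwap_mul]
  conv_rhs => rw [← (ℛ k a).eq, ← (ℛ k (r.right i)).eq]
  simp only [map_sum, Finset.sum_mul, TensorProduct.sum_tmul, TensorProduct.tmul_sum,
    TensorProduct.comm_tmul]
  exact Finset.sum_comm

/-- The coproduct is linear over `O(K)` with its opposite coproduct, which reduces the compatibility
with `θ` to the elements `1 # x`. -/
lemma comulD_smul (a : t.K.coord) (c : t.Carrier) : t.comulD s (a • c) =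
    t.lsmul₂ (TensorProduct.comm k _ _ (comul (R := k) a)) (t.comulD s c) := by
  have h1 (p q : t.K.coord ⊗[k] t.K.coord) : TensorProduct.comm k _ _ (p * q) =
      TensorProduct.comm k _ _ p * TensorProduct.comm k _ _ q :=
    map_mul (Algebra.TensorProduct.comm k t.K.coord t.K.coord) p q
  induction c using TensorProduct.induction_on with
  | zero => simp only [smul_zero, map_zero]
  | add x y hx hy => simp only [smul_add, map_add, hx, hy]
  | tmul b x =>
    rw [TensorProduct.smul_tmul', smul_eq_mul, comulD_eq_sum t s _ (ℛ k x),
      comulD_eq_sum t s _ (ℛ k x), Bialgebra.comul_mul, h1, map_mul t.lsmul₂, Module.End.mul_apply]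

/-- `θ ⊗ θ` -/
def θ₂ : Double k O ⊗[k] Double k O →ₗ[k] t.Carrier ⊗[k] t.Carrier :=
  TensorProduct.map (t.θ s) (t.θ s)

lemma θ₂_inlO_mul (z : O ⊗[k] O) (w : Double k O ⊗[k] Double k O) :
    t.θ₂ s (Algebra.TensorProduct.map Double.inlO Double.inlO z * w) =
      t.lsmul₂ (Algebra.TensorProduct.map t.K.q t.K.q z) (t.θ₂ s w) := by
  induction z with
  | zero => simp only [zero_mul, map_zero, LinearMap.zero_apply]
  | add x y hx hy => simp only [add_mul, map_add, LinearMap.add_apply, hx, hy]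
  | tmul a b =>
    induction w with
    | zero => simp only [mul_zero, map_zero]
    | add x y hx hy => simp only [mul_add, map_add, hx, hy]
    | tmul x y =>
      simp only [θ₂, Algebra.TensorProduct.map_tmul, Algebra.TensorProduct.tmul_mul_tmul,
        TensorProduct.map_tmul, θ_inlO_mul, inl_mul, lsmul₂_tmul]

variable [IsAlgClosed k]

lemma θ₂_incl_mul (z : t.H.groupAlg ⊗[k] t.H.groupAlg) (w : Double k O ⊗[k] Double k O) :
    t.θ₂ s (Algebra.TensorProduct.map Double.inrA Double.inrA
      (TensorProduct.map t.H.incl t.H.incl z) * w) =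
      t.lsmul₂ (Algebra.TensorProduct.map (t.B : t.H.groupAlg →ₐ[k] t.K.coord)
        (t.B : t.H.groupAlg →ₐ[k] t.K.coord) z) (t.θ₂ s w) := by
  induction z with
  | zero => simp only [zero_mul, map_zero, LinearMap.zero_apply]
  | add x y hx hy => simp only [add_mul, map_add, LinearMap.add_apply, hx, hy]
  | tmul a b =>
    induction w with
    | zero => simp only [mul_zero, map_zero]
    | add x y hx hy => simp only [mul_add, map_add, hx, hy]
    | tmul x y =>
      simp only [θ₂, TensorProduct.map_tmul, Algebra.TensorProduct.map_tmul,
        Algebra.TensorProduct.tmul_mul_tmul, θ_incl_mul, inl_mul, lsmul₂_tmul]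
      rfl

lemma θ₂_inrA_γ (z : t.H.quotAlg ⊗[k] t.H.quotAlg) :
    t.θ₂ s (Algebra.TensorProduct.map Double.inrA Double.inrA (TensorProduct.map s.γ s.γ z)) =
      t.middleSwap (1 ⊗ₜ z) := by
  induction z with
  | zero => simp only [TensorProduct.tmul_zero, map_zero]
  | add x y hx hy => simp only [TensorProduct.tmul_add, map_add, hx, hy]
  | tmul x y =>
    simp only [θ₂, TensorProduct.map_tmul, Algebra.TensorProduct.map_tmul, θ_γ,
      Algebra.TensorProduct.one_def, middleSwap_tmul]

lemma comulD_θ_γ (x : t.H.quotAlg) : t.comulD s (1 ⊗ₜ x) =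
    t.θ₂ s (Algebra.TensorProduct.map Double.inrA Double.inrA (comul (R := k) (s.γ x))) := by
  have h1 : t.lsmul₂ (TensorProduct.comm k _ _ (comul (R := k) (1 : t.K.coord))) = 1 := by
    rw [Bialgebra.comul_one, Algebra.TensorProduct.one_def, TensorProduct.comm_tmul,
      ← Algebra.TensorProduct.one_def, map_one]
  rw [comulD_eq_sum t s _ (ℛ k x), h1, Module.End.one_apply, s.comul_γ (ℛ k x), map_sum, map_sum]
  refine Finset.sum_congr rfl fun i _ => ?_
  obtain ⟨z, hz⟩ := s.coTwist_mem (s.γ ((ℛ k x).left i))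
  have h2 (z : t.H.groupAlg ⊗[k] t.H.groupAlg) : TensorProduct.map t.BExt t.BExt
      (TensorProduct.map t.H.incl t.H.incl z) =
      Algebra.TensorProduct.map (t.B : t.H.groupAlg →ₐ[k] t.K.coord)
        (t.B : t.H.groupAlg →ₐ[k] t.K.coord) z := by
    induction z with
    | zero => simp only [map_zero]
    | add x y hx hy => simp only [map_add, hx, hy]
    | tmul a b =>
      simp only [TensorProduct.map_tmul, Algebra.TensorProduct.map_tmul, BExt_incl]
      rfl
  have h3 : t.τ s ((ℛ k x).left i) = Algebra.TensorProduct.map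
      (t.B : t.H.groupAlg →ₐ[k] t.K.coord) (t.B : t.H.groupAlg →ₐ[k] t.K.coord) z := by
    rw [← h2, hz]; rfl
  rw [h3, map_mul (Algebra.TensorProduct.map _ _), ← hz, θ₂_incl_mul, θ₂_inrA_γ, ← middleSwap_mul,
    mul_one]

lemma comulD_θ (d : Double k O) : t.comulD s (t.θ s d) = t.θ₂ s (comul (R := k) d) := by
  induction d using t.double_induction s with
  | h0 => simp only [map_zero]
  | hadd x y hx hy => simp only [map_add, hx, hy]
  | h b v x =>
    rw [θ_inlO_mul, inl_mul, comulD_smul, Bialgebra.comul_mul, Double.comul_inlO]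
    have h1 : (Double.comulO b : Double k O ⊗[k] Double k O) = Algebra.TensorProduct.map Double.inlO
      Double.inlO (TensorProduct.comm k O O (comul (R := k) b)) := rfl
    rw [h1, θ₂_inlO_mul, ClosedSubgroup.comul_q, comm_map]
    refine congrArg (t.lsmul₂ _) ?_
    rw [map_mul Double.inrA, θ_incl_mul, inl_mul, comulD_smul, Bialgebra.comul_mul, Double.comul_inrA]
    have h2 : (Double.comulA (t.H.incl v) : Double k O ⊗[k] Double k O) =
      Algebra.TensorProduct.map Double.inrA Double.inrA
        (TensorProduct.map t.H.incl t.H.incl (comul (R := k) v)) := by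
      rw [← NormalSubgroup.comul_incl]; rfl
    -- The opposite coproduct of `O(K)` does no harm on the image of `B`, because `k[H]` is
    -- cocommutative.
    have h3 : TensorProduct.comm k _ _ (comul (R := k) (t.B v)) = Algebra.TensorProduct.map
        (t.B : t.H.groupAlg →ₐ[k] t.K.coord) (t.B : t.H.groupAlg →ₐ[k] t.K.coord)
        (comul (R := k) v) := by
      have h4 : comul (R := k) (t.B v) = TensorProduct.map (t.B : t.H.groupAlg →ₗ[k] t.K.coord)
        (t.B : t.H.groupAlg →ₗ[k] t.K.coord) (comul v) :=
          (CoalgHomClass.map_comp_comul_apply t.B v).symm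
      rw [h4, comm_map, comm_comul]
      rfl
    rw [h2, θ₂_incl_mul, h3, θ_γ, comulD_θ_γ, Double.comul_inrA]
    rfl

theorem isHopfQuotient : t.IsHopfQuotient s where
  surjective := t.θ_surjective s
  map_one := t.θ_one s
  map_mul := t.θ_mul s
  map_counit := t.counitD_θ s
  map_comul := t.comulD_θ s
  antipode := t.exists_antipode s

end Triple

/-! ### Tensor subcategories and Hopf ideals -/

section Tannaka

variable {k A : Type u} [Field k] [Ring A]

namespace FDRep

/-- The `n`-fold direct sum of a representation. -/
def pow [Algebra k A] (X : FDRep k A) (n : ℕ) : FDRep k A where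
  V := Fin n → X.V
  ρ := AlgHom.ofLinearMap
    { toFun := fun a => LinearMap.pi fun i => X.ρ a ∘ₗ LinearMap.proj i
      map_add' := fun a b => by ext; simp
      map_smul' := fun c a => by ext; simp }
    (by ext; simp) (fun a b => by ext; simp)

/-- The representation of `A` on the quotient by an ideal. -/
def ofIdeal [Algebra k A] [Module.Finite k A] (J : Ideal A) [J.IsTwoSided] : FDRep k A where
  V := A ⧸ J
  ρ := (Algebra.lmul k (A ⧸ J)).comp (Ideal.Quotient.mkₐ k J)

end FDRep

namespace TensorSubcategory

variable [HopfAlgebra k A]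

lemma pow_mem (𝒞 : TensorSubcategory k A) {X : FDRep k A} (hX : X ∈ 𝒞.obj) (n : ℕ) :
    X.pow n ∈ 𝒞.obj := by
  induction n with
  | zero =>
    refine 𝒞.quot_mem _ 𝒞.unit_mem _ 0 (fun a v => (map_zero _).symm) fun v => ⟨0, ?_⟩
    exact funext (fun i : Fin 0 => i.elim0)
  | succ n ih =>
    let f : X.V × (Fin n → X.V) →ₗ[k] (Fin (n + 1) → X.V) := LinearMap.pi
      (Fin.cons (LinearMap.fst k _ _) fun i => LinearMap.proj i ∘ₗ LinearMap.snd k _ _)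
    refine 𝒞.quot_mem _ (𝒞.sum_mem _ hX _ ih) _ f (fun a v => ?_) (fun v => ?_)
    · refine funext fun i => ?_
      induction i using Fin.cases with
      | zero => rfl
      | succ i => rfl
    · refine ⟨(v 0, fun i => v i.succ), funext fun i => ?_⟩
      induction i using Fin.cases with
      | zero => rfl
      | succ i => rfl

/-- The tensor subcategory of the representations that are killed by a Hopf ideal. -/
def ofHopfIdeal (hS : ∀ a : A, HopfAlgebra.antipode k (HopfAlgebra.antipode k a) = a) (J : Ideal A)
    [hJ : J.IsHopfIdeal k] : TensorSubcategory k A where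
  obj := {X | ∀ a ∈ J, X.ρ a = 0}
  unit_mem a ha := LinearMap.ext fun c => by
    have h1 := FDRep.unit_ρ a (show k from c)
    rw [hJ.counit_eq_zero ha] at h1
    exact h1.trans (zero_mul (show k from c))
  sum_mem X hX Y hY a ha := LinearMap.ext fun v =>
    Prod.ext (congr($(hX a ha) v.1)) (congr($(hY a ha) v.2))
  sub_mem Y hY X f hf hinj a ha := LinearMap.ext fun v => hinj (by
    rw [hf, hY a ha]; simp)
  quot_mem X hX Y f hf hsurj a ha := LinearMap.ext fun v => by
    obtain ⟨v, rfl⟩ := hsurj v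
    rw [← hf, hX a ha]; simp
  tensor_mem X hX Y hY a ha := by
    let f := (J.restrictScalars k).liftQ X.ρ.toLinearMap hX
    let g := (J.restrictScalars k).liftQ Y.ρ.toLinearMap hY
    have h1 (z : A ⊗[k] A) : Algebra.TensorProduct.map X.ρ Y.ρ z = TensorProduct.map f g
        (TensorProduct.map (J.restrictScalars k).mkQ (J.restrictScalars k).mkQ z) := by
      rw [TensorProduct.map_map]; rfl
    change Module.endTensorEndAlgHom (R := k) (S := k) (A := k) (M := X.V) (N := Y.V)
      (Algebra.TensorProduct.map X.ρ Y.ρ (comul a)) = 0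
    rw [h1, hJ.map_mkQ_comul_eq_zero ha, map_zero, map_zero]
  dual_mem X hX a ha := LinearMap.ext fun f => LinearMap.ext fun v => by
    refine (FDRep.dual_ρ X a f v).trans ?_
    rw [hX _ (hJ.antipode_mem ha)]
    exact map_zero (show Module.Dual k X.V from f)
  mem_of_dual_mem X hX a ha := LinearMap.ext fun v => by
    refine (Module.forall_dual_apply_eq_zero_iff k _).mp fun f => ?_
    have h1 := FDRep.dual_ρ X (HopfAlgebra.antipode k a) f v
    rw [hS] at h1
    rw [← h1, hX _ (hJ.antipode_mem ha)]
    rfl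

variable [Module.Finite k A]

/-- The test object is `A/J`: an element that acts on it by zero maps `1` to `0`, so it lies in `J`.
-/
lemma le_of_forall_mem {J J' : Ideal A} [J.IsTwoSided]
    (h : ∀ X : FDRep k A, (∀ a ∈ J, X.ρ a = 0) → ∀ a ∈ J', X.ρ a = 0) : J' ≤ J := by
  intro a ha
  have h1 := h (FDRep.ofIdeal J) (fun b hb => by
    change Algebra.lmul k (A ⧸ J) (Ideal.Quotient.mk J b) = 0
    rw [Ideal.Quotient.eq_zero_iff_mem.mpr hb, map_zero]) a ha
  have h2 : Ideal.Quotient.mk J a * 1 = 0 := congr($h1 (1 : A ⧸ J))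
  rwa [mul_one, Ideal.Quotient.eq_zero_iff_mem] at h2

/-- A tensor subcategory contains a representation on which as few elements as possible act
trivially. -/
lemma exists_ker_le (𝒞 : TensorSubcategory k A) : ∃ X ∈ 𝒞.obj, ∀ Y ∈ 𝒞.obj, ∀ a : A,
    X.ρ a = 0 → Y.ρ a = 0 := by
  let S : Set (Submodule k A) := {W | ∃ X ∈ 𝒞.obj, W = LinearMap.ker X.ρ.toLinearMap}
  have : IsArtinian k A := inferInstance
  obtain ⟨W, ⟨X, hX, rfl⟩, hmin⟩ := WellFounded.has_min
    (wellFounded_lt (α := Submodule k A)) S ⟨_, _, 𝒞.unit_mem, rfl⟩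
  refine ⟨X, hX, fun Y hY a ha => ?_⟩
  have h1 : LinearMap.ker (X.sum Y).ρ.toLinearMap ≤ LinearMap.ker X.ρ.toLinearMap := by
    intro b hb
    refine LinearMap.ext fun v => ?_
    exact congrArg Prod.fst (congr($hb ((v, 0) : X.V × Y.V)))
  have h2 := (eq_or_lt_of_le h1).resolve_right (hmin _ ⟨_, 𝒞.sum_mem X hX Y hY, rfl⟩)
  have h3 : a ∈ LinearMap.ker (X.sum Y).ρ.toLinearMap := h2 ▸ ha
  refine LinearMap.ext fun v => ?_
  exact congrArg Prod.snd (congr($h3 ((0, v) : X.V × Y.V)))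

/-- Every tensor subcategory is given by a Hopf ideal. -/
theorem exists_hopfIdeal (𝒞 : TensorSubcategory k A) : ∃ J : Ideal A, J.IsTwoSided ∧
    J.IsHopfIdeal k ∧ ∀ X, X ∈ 𝒞.obj ↔ ∀ a ∈ J, X.ρ a = 0 := by
  obtain ⟨X, hX, hmin⟩ := 𝒞.exists_ker_le
  let J : Ideal A := RingHom.ker X.ρ
  have hJ2 : J.IsTwoSided := inferInstance
  refine ⟨J, hJ2, @Ideal.IsHopfIdeal.mk _ _ _ _ _ J ⟨fun a ha => ?_, fun a ha => ?_⟩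
    (fun a ha => ?_), fun Y => ⟨fun hY a ha => hmin Y hY a ha, fun hY => ?_⟩⟩
  · have h1 := FDRep.unit_ρ a (1 : k)
    rw [hmin _ 𝒞.unit_mem a ha, mul_one] at h1
    exact h1.symm
  · let f := (J.restrictScalars k).liftQ X.ρ.toLinearMap le_rfl
    have hf : Function.Injective f := by
      rw [← LinearMap.ker_eq_bot]
      exact Submodule.ker_liftQ_eq_bot _ _ _ le_rfl
    have h1 (z : A ⊗[k] A) : Algebra.TensorProduct.map X.ρ X.ρ z = TensorProduct.map f f
        (TensorProduct.map (J.restrictScalars k).mkQ (J.restrictScalars k).mkQ z) := by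
      rw [TensorProduct.map_map]; rfl
    have h2 : Module.endTensorEndAlgHom (R := k) (S := k) (A := k) (M := X.V) (N := X.V)
      (Algebra.TensorProduct.map X.ρ X.ρ (comul a)) = 0 := hmin _ (𝒞.tensor_mem X hX X hX) a ha
    -- In finite dimension `End X ⊗ End X` is `End (X ⊗ X)`; as `A/J` embeds in `End X`, the
    -- vanishing of `a` on `X ⊗ X` is the coideal condition.
    have h3 : Algebra.TensorProduct.map X.ρ X.ρ (comul (R := k) a) = 0 :=
      (homTensorHomEquiv k X.V X.V X.V X.V).injective (by
        rw [map_zero]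
        refine Eq.trans ?_ h2
        rw [homTensorHomEquiv_apply]
        rfl)
    rw [h1] at h3
    exact (TensorProduct.map_injective_of_flat_flat f f hf hf) (h3.trans (map_zero _).symm)
  · refine LinearMap.ext fun v => ?_
    refine (Module.forall_dual_apply_eq_zero_iff k _).mp fun f => ?_
    exact (FDRep.dual_ρ X a f v).symm.trans congr((show Module.Dual k X.V from
      $(hmin _ (𝒞.dual_mem X hX) a ha) f) v)
  · let β := Module.finBasis k X.V
    -- Acting on all vectors of a basis of `X` embeds `A/J` in a power of `X`, because an
    -- endomorphism is determined by its values on a basis. A basis of `Y` then presents `Y` as a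
    -- quotient of a free `A/J`-module.
    let f : A ⧸ J →ₗ[k] (Fin (Module.finrank k X.V) → X.V) :=
      (J.restrictScalars k).liftQ (LinearMap.pi fun i => LinearMap.applyₗ (β i) ∘ₗ X.ρ.toLinearMap)
        fun a ha => funext fun i => congr($(show X.ρ a = 0 from ha) (β i))
    have hR : FDRep.ofIdeal J ∈ 𝒞.obj := by
      refine 𝒞.sub_mem _ (𝒞.pow_mem hX (Module.finrank k X.V)) _ f (fun a v => ?_) ?_
      · obtain ⟨b, rfl⟩ := Ideal.Quotient.mk_surjective v
        refine funext fun i => ?_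
        exact congr($(map_mul X.ρ a b) (β i))
      · refine (injective_iff_map_eq_zero f).mpr fun v hv => ?_
        obtain ⟨b, rfl⟩ := Ideal.Quotient.mk_surjective v
        exact Ideal.Quotient.eq_zero_iff_mem.mpr (β.ext fun i => congrFun hv i)
    let e := Module.finBasis k Y.V
    let ρY : A ⧸ J →ₗ[k] Module.End k Y.V := (J.restrictScalars k).liftQ Y.ρ.toLinearMap hY
    let g : (Fin (Module.finrank k Y.V) → A ⧸ J) →ₗ[k] Y.V :=
      ∑ i, LinearMap.applyₗ (e i) ∘ₗ ρY ∘ₗ LinearMap.proj i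
    have hg (v) : g v = ∑ i, ρY (v i) (e i) := by simp [g]
    refine 𝒞.quot_mem _ (𝒞.pow_mem hR (Module.finrank k Y.V)) _ g (fun a v => ?_) (fun y => ?_)
    · refine (hg _).trans (Eq.trans ?_ (congrArg (Y.ρ a) (hg v)).symm)
      rw [map_sum]
      refine Finset.sum_congr rfl fun i _ => ?_
      obtain ⟨b, hb⟩ := Ideal.Quotient.mk_surjective ((show Fin _ → A ⧸ J from v) i)
      have h1 : (show Fin _ → A ⧸ J from ((FDRep.ofIdeal J).pow _).ρ a v) i =
          Ideal.Quotient.mk J (a * b) :=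
        (congrArg (fun z : A ⧸ J => Ideal.Quotient.mk J a * z) hb.symm).trans
          (map_mul (Ideal.Quotient.mk J) a b).symm
      refine (congrArg (fun z => ρY z (e i)) h1).trans ?_
      refine Eq.trans ?_ (congrArg (fun z => Y.ρ a (ρY z (e i))) hb)
      exact congr($(map_mul Y.ρ a b) (e i))
    · refine ⟨fun i => algebraMap k (A ⧸ J) (e.repr y i), (hg _).trans ?_⟩
      conv_rhs => rw [← e.sum_repr y]
      refine Finset.sum_congr rfl fun i _ => ?_
      exact congr($(Y.ρ.commutes (e.repr y i)) (e i))

end TensorSubcategory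

end Tannaka

/-! ### Hopf ideals -/

section HopfIdeal

variable {k A B N : Type*} [Field k] [AddCommGroup N] [Module k N]

/-- The map induced on `A/W` is injective, and so is its tensor square over a field. The coideal
condition can thus be tested in `N ⊗ N`, with no structure on `N`. -/
lemma isCoideal_of_ker_eq [AddCommGroup A] [Module k A] [Coalgebra k A] {W : Submodule k A}
    (f : A →ₗ[k] N) (hf : LinearMap.ker f = W) (hε : ∀ a ∈ W, counit (R := k) a = 0)
    (hΔ : ∀ a ∈ W, TensorProduct.map f f (comul (R := k) a) = 0) : W.IsCoideal where
  counit_eq_zero a ha := hε a ha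
  map_mkQ_comul_eq_zero a ha := by
    let g : A ⧸ W →ₗ[k] N := W.liftQ f hf.ge
    have hg : Function.Injective g := LinearMap.ker_eq_bot.mp (Submodule.ker_liftQ_eq_bot' W f hf.symm)
    have h1 : TensorProduct.map f f = TensorProduct.map g g ∘ₗ TensorProduct.map W.mkQ W.mkQ := by
      rw [← TensorProduct.map_comp, Submodule.liftQ_mkQ]
    have h2 := hΔ a ha
    rw [h1, LinearMap.comp_apply] at h2
    exact TensorProduct.map_injective_of_flat_flat g g hg hg (h2.trans (map_zero _).symm)

variable [Ring A] [HopfAlgebra k A] [Ring B] [HopfAlgebra k B]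

lemma mem_map_ideal_iff (f : A →ₐc[k] B) (hf : Function.Surjective f) (J : Ideal A) {b : B} :
    b ∈ J.map f ↔ ∃ a ∈ J, f a = b :=
  Ideal.mem_map_iff_of_surjective (f : A →+* B) hf

lemma map_isTwoSided (f : A →ₐc[k] B) (hf : Function.Surjective f) (J : Ideal A) [J.IsTwoSided] :
    (J.map f).IsTwoSided where
  mul_mem_of_left b h := by
    obtain ⟨a, ha, rfl⟩ := (mem_map_ideal_iff f hf J).mp h
    obtain ⟨b, rfl⟩ := hf b
    rw [← map_mul]
    exact Ideal.mem_map_of_mem f (J.mul_mem_right _ ha)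

/-- The image of a Hopf ideal under a surjective map of Hopf algebras is a Hopf ideal. -/
lemma map_isHopfIdeal (f : A →ₐc[k] B) (hf : Function.Surjective f) (J : Ideal A)
    [hJ : J.IsHopfIdeal k] : (J.map f).IsHopfIdeal k := by
  refine { counit_eq_zero := ?_, map_mkQ_comul_eq_zero := ?_, antipode_mem := ?_ }
  · intro b hb
    obtain ⟨a, ha, rfl⟩ := (mem_map_ideal_iff f hf J).mp hb
    rw [CoalgHomClass.counit_comp_apply]
    exact hJ.counit_eq_zero ha
  · intro b hb
    obtain ⟨a, ha, rfl⟩ := (mem_map_ideal_iff f hf J).mp hb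
    let W := (J.map f).restrictScalars k
    let g : A ⧸ J.restrictScalars k →ₗ[k] B ⧸ W := Submodule.mapQ _ _ (f : A →ₗ[k] B)
      (fun a ha => Ideal.mem_map_of_mem f ha)
    have h1 := congrArg (TensorProduct.map g g) (hJ.map_mkQ_comul_eq_zero ha)
    rw [map_zero, TensorProduct.map_map] at h1
    rw [← CoalgHomClass.map_comp_comul_apply, TensorProduct.map_map]
    exact h1
  · intro b hb
    obtain ⟨a, ha, rfl⟩ := (mem_map_ideal_iff f hf J).mp hb
    rw [← map_antipode]
    exact Ideal.mem_map_of_mem f (hJ.antipode_mem ha)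

end HopfIdeal

/-! ### The involutive antipode of the double and its projection to the group algebra -/

namespace Double

variable {k O : Type*} [Field k] [CommRing O] [HopfAlgebra k O] [Module.Finite k O]

lemma antipode_inlO (b : O) : HopfAlgebra.antipode k (inlO b : Double k O) =
    inlO (HopfAlgebra.antipode k b) := antipodeLin_inlO b

lemma antipode_inrA (u : GroupAlg k O) : HopfAlgebra.antipode k (inrA u : Double k O) =
    inrA (HopfAlgebra.antipode k u) := antipodeLin_inrA u

lemma antipode_antipode (d : Double k O) :
    HopfAlgebra.antipode k (HopfAlgebra.antipode k d) = d := by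
  induction d using induction with
  | h0 => simp
  | hadd x y hx hy => simp only [map_add, hx, hy]
  | h b u => rw [HopfAlgebra.antipode_mul_antidistrib, HopfAlgebra.antipode_mul_antidistrib,
      antipode_inlO, antipode_inlO, antipode_inrA, antipode_inrA, antipode_antipode_coord,
      antipode_antipode_groupAlg]

/-- The map `D(G) → k[G]`, `b ⋈ u ↦ ε(b) u`, as a map of algebras. -/
def prAlgHom : Double k O →ₐ[k] GroupAlg k O :=
  lift ((Algebra.ofId k (GroupAlg k O)).comp (Bialgebra.counitAlgHom k O))
    (AlgHom.id k (GroupAlg k O)) (fun u b => by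
      have h (c : O) : (Algebra.ofId k (GroupAlg k O)).comp (Bialgebra.counitAlgHom k O) c =
          counit (R := k) c • (1 : GroupAlg k O) :=
        Algebra.algebraMap_eq_smul_one (A := GroupAlg k O) (counit (R := k) c)
      simp only [h, counit_coadj, AlgHom.id_apply, mul_smul_comm, mul_one, smul_mul_assoc, one_mul,
        mul_comm _ (counit (R := k) b), mul_smul]
      rw [← Finset.smul_sum, Coalgebra.sum_counit_smul])

lemma prAlgHom_inlO (b : O) : prAlgHom (inlO b : Double k O) = counit (R := k) b • 1 :=
  (lift_inlO _ _ _ b).trans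
    (Algebra.algebraMap_eq_smul_one (A := GroupAlg k O) (counit (R := k) b))

lemma prAlgHom_inrA (u : GroupAlg k O) : prAlgHom (inrA u) = u := lift_inrA _ _ _ u

/-- The map `D(G) → k[G]`, `b ⋈ u ↦ ε(b) u`. -/
def pr : Double k O →ₐc[k] GroupAlg k O :=
  BialgHom.ofAlgHom prAlgHom
    (algHom_ext (fun b => by simp [prAlgHom_inlO, counit_inlO])
      (fun u => by simp [prAlgHom_inrA, counit_inrA]))
    (algHom_ext (fun b => by
      simp only [AlgHom.comp_apply, Bialgebra.comulAlgHom_apply, comul_inlO, prAlgHom_inlO, map_smul,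
        Bialgebra.comul_one, comulO_apply (ℛ k b), map_sum, Algebra.TensorProduct.map_tmul]
      have h := congrArg (counit (R := k)) (Coalgebra.sum_counit_smul (ℛ k b))
      rw [map_sum] at h
      rw [← h, Finset.sum_smul]
      exact Finset.sum_congr rfl fun i _ => by
        rw [map_smul, TensorProduct.smul_tmul_smul, smul_eq_mul, mul_comm]; rfl) (fun u => by
      simp only [AlgHom.comp_apply, Bialgebra.comulAlgHom_apply, comul_inrA, prAlgHom_inrA,
        comulA_apply (ℛ k u), map_sum, Algebra.TensorProduct.map_tmul, (ℛ k u).eq]))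

lemma pr_inlO (b : O) : pr (inlO b : Double k O) = counit (R := k) b • 1 := prAlgHom_inlO b

lemma pr_inrA (u : GroupAlg k O) : pr (inrA u) = u := prAlgHom_inrA u

lemma pr_surjective : Function.Surjective (pr : Double k O →ₐc[k] GroupAlg k O) :=
  fun u => ⟨inrA u, pr_inrA u⟩

end Double

namespace NormalSubgroup

variable {k O : Type u} [Field k] [CommRing O] [HopfAlgebra k O] [Module.Finite k O]
  [IsAlgClosed k]

lemma mem_ideal_of_mem_invariants (H : NormalSubgroup k O) {a : O} (ha : a ∈ H.invariants)
    (hε : counit (R := k) a = 0) : a ∈ H.ideal := by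
  have h := H.counit_rTensor_coactR a
  rw [H.mem_invariants.mp ha] at h
  rw [← H.q_eq_zero_iff, ← h]
  simp [hε]

/-- A normal subgroup scheme is determined by the kernel of `k[G] → k[G/H]`. -/
lemma eq_of_augIdeal_eq {H H' : NormalSubgroup k O} (h : H.augIdeal = H'.augIdeal) : H = H' := by
  have hle {H H' : NormalSubgroup k O} (h : H.augIdeal = H'.augIdeal) : H.ideal ≤ H'.ideal := by
    intro b hb
    refine Ideal.span_le.mpr ?_ (H.mem_span_of_mem_ideal hb)
    rintro a ⟨ha, hε⟩
    refine H'.mem_ideal_of_mem_invariants ?_ hε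
    rw [H'.mem_invariants_iff, ← h]
    exact H.mem_invariants_iff.mp ha
  exact NormalSubgroup.ext (le_antisymm (hle h) (hle h.symm))

end NormalSubgroup

/-! ### The kernel of `θ` determines the triple -/

namespace Triple

variable {k O : Type u} [Field k] [CommRing O] [HopfAlgebra k O] [Module.Finite k O]
  [IsAlgClosed k] (t : Triple k O) (s : Cleaving t.H)

/-- The kernel of `θ`. -/
def kerIdeal : Ideal (Double k O) where
  carrier := {d | t.θ s d = 0}
  add_mem' {x y} hx hy := by
    rw [Set.mem_ofPred_eq] at hx hy ⊢
    rw [map_add, hx, hy, add_zero]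
  zero_mem' := map_zero _
  smul_mem' c x hx := by
    rw [Set.mem_ofPred_eq] at hx ⊢
    rw [smul_eq_mul, θ_mul, hx, map_zero]

lemma mem_kerIdeal {d : Double k O} : d ∈ t.kerIdeal s ↔ t.θ s d = 0 := Iff.rfl

instance : (t.kerIdeal s).IsTwoSided where
  mul_mem_of_left b h := by
    rw [mem_kerIdeal] at h ⊢
    rw [θ_mul, h, map_zero, LinearMap.zero_apply]

instance : (t.kerIdeal s).IsHopfIdeal k where
  toIsCoideal := isCoideal_of_ker_eq (t.θ s) rfl
    (fun d hd => by
      rw [← t.counitD_θ s, show t.θ s d = 0 from hd, map_zero])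
    (fun d hd => by
      rw [← (t.isHopfQuotient s).map_comul, show t.θ s d = 0 from hd, map_zero])
  antipode_mem {d} hd := by
    obtain ⟨S, hS⟩ := t.exists_antipode s
    rw [mem_kerIdeal] at hd ⊢
    rw [← hS, hd, map_zero]

lemma mem_zObj {X : FDRep k (Double k O)} : X ∈ t.zObj s ↔ ∀ d ∈ t.kerIdeal s, X.ρ d = 0 := by
  constructor
  · rintro ⟨α, hα⟩ d hd
    rw [hα, show t.θ s d = 0 from hd, map_zero]
  · intro h
    -- Any linear section of `θ` transports the action: `X` kills `ker θ`, so the choice does not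
    -- matter and the result is multiplicative.
    obtain ⟨g, hg⟩ := (t.θ s).exists_rightInverse_of_surjective
      (LinearMap.range_eq_top.mpr (t.θ_surjective s))
    have h1 (d : Double k O) : X.ρ (g (t.θ s d)) = X.ρ d := by
      rw [← sub_eq_zero, ← map_sub]
      refine h _ ?_
      rw [mem_kerIdeal, map_sub, sub_eq_zero]
      exact congr($hg (t.θ s d))
    refine ⟨⟨X.ρ.toLinearMap ∘ₗ g, ?_, fun c d => ?_⟩, fun d => (h1 d).symm⟩
    · rw [← t.θ_one s]
      exact (h1 1).trans (map_one _)
    · obtain ⟨c, rfl⟩ := t.θ_surjective s c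
      obtain ⟨d, rfl⟩ := t.θ_surjective s d
      rw [← θ_mul]
      refine (h1 (c * d)).trans ((map_mul _ c d).trans ?_)
      exact congrArg₂ (· * ·) (h1 c).symm (h1 d).symm

lemma inl_injective : Function.Injective t.inl := by
  intro a b h
  have h1 := congrArg (TensorProduct.rid k t.K.coord ∘
    (counit (R := k) (A := t.H.quotAlg)).lTensor t.K.coord) h
  simpa [inl_apply] using h1

lemma θ_inlO (b : O) : t.θ s (Double.inlO b) = t.inl (t.K.q b) := by
  have h := t.θ_inlO_mul s b 1
  rwa [mul_one, θ_one, ← Algebra.TensorProduct.one_def, mul_one] at h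

lemma θ_incl (v : t.H.groupAlg) : t.θ s (Double.inrA (t.H.incl v)) = t.inl (t.B v) := by
  have h := t.θ_incl_mul s v 1
  rwa [mul_one, θ_one, ← Algebra.TensorProduct.one_def, mul_one] at h

lemma inlO_mem_kerIdeal {b : O} : Double.inlO b ∈ t.kerIdeal s ↔ b ∈ t.K.ideal := by
  rw [mem_kerIdeal, θ_inlO, map_eq_zero_iff _ t.inl_injective, ClosedSubgroup.q_eq_zero_iff]

/-- `ker θ` contains the graph of `B`, modulo the ideal of `K`; this is how `B` is recovered. -/
lemma incl_sub_inlO_mem_kerIdeal {v : t.H.groupAlg} {b : O} :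
    Double.inrA (t.H.incl v) - Double.inlO b ∈ t.kerIdeal s ↔ t.B v = t.K.q b := by
  rw [mem_kerIdeal, map_sub, θ_inlO, θ_incl, sub_eq_zero, t.inl_injective.eq_iff]

lemma counit_rTensor_θ (d : Double k O) :
    TensorProduct.lid k t.H.quotAlg ((counit (R := k)).rTensor t.H.quotAlg (t.θ s d)) =
      t.H.proj (Double.pr d) := by
  induction d using t.double_induction s with
  | h0 => simp
  | hadd x y hx hy => simp only [map_add, hx, hy]
  | h b v x =>
    rw [θ_apply, map_mul, Double.pr_inlO, Double.pr_inrA, map_mul, map_mul, t.H.proj_incl, s.proj_γ]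
    simp [mul_smul, CoalgHomClass.counit_comp_apply, ClosedSubgroup.counit_q,
      smul_comm (counit (R := k) v)]

/-- One inclusion holds as `(ε ⊗ 1) θ = π ∘ pr`. For the other, `v - b ∈ ker θ` with `q(b) = B(v)`
is mapped to `v - ε(v)`, a generator of the ideal of `H`. -/
lemma map_pr_kerIdeal : (t.kerIdeal s).map Double.pr = t.H.augIdeal := by
  have hts := map_isTwoSided Double.pr Double.pr_surjective (t.kerIdeal s)
  refine le_antisymm (fun u hu => ?_) (fun u hu => ?_)
  · obtain ⟨d, hd, rfl⟩ := (mem_map_ideal_iff _ Double.pr_surjective _).mp hu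
    rw [← t.H.proj_eq_zero_iff, ← t.counit_rTensor_θ s, show t.θ s d = 0 from hd, map_zero, map_zero]
  · refine Ideal.Quotient.eq_zero_iff_mem.mp (t.H.map_eq_zero_of_mem_augIdeal
      (Ideal.Quotient.mkₐ k ((t.kerIdeal s).map Double.pr)) (fun v => ?_) hu)
    obtain ⟨b, hb⟩ := t.K.q_surjective (t.B v)
    have h1 := Ideal.mem_map_of_mem Double.pr ((t.incl_sub_inlO_mem_kerIdeal s).mpr hb.symm)
    have h2 : counit (R := k) b = counit (R := k) v := by
      rw [← t.K.counit_q, hb, CoalgHomClass.counit_comp_apply]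
    rw [map_sub, Double.pr_inrA, Double.pr_inlO, h2] at h1
    rw [← AlgHom.commutes (Ideal.Quotient.mkₐ k ((t.kerIdeal s).map Double.pr)),
      Algebra.algebraMap_eq_smul_one]
    exact Ideal.Quotient.eq.mpr h1

/-- A triple is determined by the kernel of `θ`. -/
theorem eq_of_kerIdeal_eq {t t' : Triple k O} (s : Cleaving t.H) (s' : Cleaving t'.H)
    (h : t.kerIdeal s = t'.kerIdeal s') : t = t' := by
  have hK : t.K = t'.K := by
    refine NormalSubgroup.ext (Ideal.ext fun b => ?_)
    rw [← t.inlO_mem_kerIdeal s, ← t'.inlO_mem_kerIdeal s', h]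
  have hH : t.H = t'.H := by
    refine NormalSubgroup.eq_of_augIdeal_eq ?_
    rw [← t.map_pr_kerIdeal s, ← t'.map_pr_kerIdeal s', h]
  obtain ⟨K, H, hc, B, he⟩ := t
  obtain ⟨K', H', hc', B', he'⟩ := t'
  obtain rfl : K = K' := hK
  obtain rfl : H = H' := hH
  have hB : B = B' := by
    refine BialgHom.ext fun v => ?_
    obtain ⟨b, hb⟩ := K.q_surjective (B v)
    have h1 := (Triple.incl_sub_inlO_mem_kerIdeal ⟨K, H, hc, B, he⟩ s).mpr hb.symm
    rw [h] at h1
    exact hb.symm.trans ((Triple.incl_sub_inlO_mem_kerIdeal _ s').mp h1).symm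
  subst hB
  rfl

end Triple

/-! ### Coinvariants -/

section Coinvariants

variable {k R Q : Type*} [Field k] [Ring R] [Bialgebra k R] [Ring Q] [Bialgebra k Q]
  (p : R →ₐc[k] Q)

/-- The coinvariants `{c | c₁ ⊗ p(c₂) = c ⊗ 1}` of a map of bialgebras. -/
def coinvariants : Subalgebra k R :=
  AlgHom.equalizer (coactAlong p) Algebra.TensorProduct.includeLeft

lemma mem_coinvariants {c : R} : c ∈ coinvariants p ↔ coactAlong p c = c ⊗ₜ 1 := Iff.rfl

lemma lTensor_coactAlong_comul (r : R) : (coactAlong p).toLinearMap.lTensor R (comul (R := k) r) =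
    TensorProduct.assoc k R R Q ((comul (R := k)).rTensor Q (coactAlong p r)) := by
  have h1 (a : R ⊗[k] R) (b : R) : ((p : R →ₗ[k] Q).lTensor R).lTensor R
      (TensorProduct.assoc k R R R (a ⊗ₜ b)) = TensorProduct.assoc k R R Q (a ⊗ₜ p b) := by
    induction a with
    | zero => simp
    | add x y hx hy => simp only [TensorProduct.add_tmul, map_add, hx, hy]
    | tmul x y => rfl
  have h2 (z : R ⊗[k] R) : ((p : R →ₗ[k] Q).lTensor R).lTensor R
      (TensorProduct.assoc k R R R ((comul (R := k)).rTensor R z)) =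
      TensorProduct.assoc k R R Q ((comul (R := k)).rTensor Q ((p : R →ₗ[k] Q).lTensor R z)) := by
    induction z with
    | zero => simp
    | add x y hx hy => simp only [map_add, hx, hy]
    | tmul x y => exact h1 _ _
  rw [coactAlong_apply, ← h2, Coalgebra.coassoc_apply]
  exact congr($(LinearMap.lTensor_comp R ((p : R →ₗ[k] Q).lTensor R) (comul (R := k)))
    (comul (R := k) r))

/-- The coinvariants form a left coideal. -/
lemma comul_mem_of_mem_coinvariants {c : R} (hc : c ∈ coinvariants p) : comul (R := k) c ∈
    LinearMap.range ((Subalgebra.toSubmodule (coinvariants p)).subtype.lTensor R) := by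
  -- The coinvariants are the kernel of `D`. Tensoring with `R` preserves kernels over a field, so
  -- it suffices that `D` kills the second leg of `Δ(c)`, which is coassociativity.
  let D : R →ₗ[k] R ⊗[k] Q := (coactAlong p).toLinearMap -
    (Algebra.TensorProduct.includeLeft : R →ₐ[k] R ⊗[k] Q).toLinearMap
  have hD : LinearMap.ker D = Subalgebra.toSubmodule (coinvariants p) :=
    Submodule.ext fun x => sub_eq_zero
  have h1 (z : R ⊗[k] R) : (Algebra.TensorProduct.includeLeft : R →ₐ[k] R ⊗[k] Q).toLinearMap.lTensor
      R z = TensorProduct.assoc k R R Q (z ⊗ₜ 1) := by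
    induction z with
    | zero => simp
    | add x y hx hy => simp only [TensorProduct.add_tmul, map_add, hx, hy]
    | tmul x y => rfl
  have h2 : D.lTensor R (comul (R := k) c) = 0 := by
    rw [LinearMap.lTensor_sub, LinearMap.sub_apply, lTensor_coactAlong_comul,
      (mem_coinvariants p).mp hc, h1, LinearMap.rTensor_tmul, sub_self]
  rw [← hD]
  exact (Module.Flat.lTensor_exact R (LinearMap.exact_subtype_ker_map D) (comul (R := k) c)).mp h2

lemma coactAlong_map {S : Type*} [Ring S] [Bialgebra k S] (f : S →ₐc[k] R) (x : S) :
    coactAlong p (f x) = (f : S →ₗ[k] R).rTensor Q (coactAlong (p.comp f) x) := by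
  rw [coactAlong_repr p ((ℛ k x).induced f), coactAlong_repr _ (ℛ k x), map_sum]
  rfl

lemma counit_rTensor_coactAlong (r : R) :
    TensorProduct.lid k Q ((counit (R := k)).rTensor Q (coactAlong p r)) = p r := by
  rw [coactAlong_repr p (ℛ k r)]
  simp

lemma apply_of_mem_coinvariants {c : R} (hc : c ∈ coinvariants p) :
    p c = counit (R := k) c • 1 := by
  rw [← counit_rTensor_coactAlong, (mem_coinvariants p).mp hc]
  simp

lemma cleftRetraction_of_mem_coinvariants {g' : Q →ₗ[k] R} (h1 : g' 1 = 1) {c : R}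
    (hc : c ∈ coinvariants p) : cleftRetraction p g' c = c := by
  rw [cleftRetraction_eq, (mem_coinvariants p).mp hc]
  simp [h1]

end Coinvariants

/-! ### The quotient `D(G)/J` by a Hopf ideal and its projection to `k[G/M]` -/

namespace Double

variable {k O : Type u} [Field k] [CommRing O] [HopfAlgebra k O] [Module.Finite k O]

/-- On `b u` the difference is `(b - ε(b)) u`: modulo the augmentation ideal of `O(G)`, the double
is `k[G]`. -/
lemma sub_inrA_pr_mem (d : Double k O) : d - inrA (pr d) ∈
    Submodule.span k {y : Double k O | ∃ a : O, counit (R := k) a = 0 ∧ ∃ e, inlO a * e = y} := by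
  induction d using induction with
  | h0 => simp
  | hadd x y hx hy =>
    rw [map_add, map_add, add_sub_add_comm]
    exact Submodule.add_mem _ hx hy
  | h b u =>
    refine Submodule.subset_span ⟨b - counit (R := k) b • 1, by simp, inrA u, ?_⟩
    rw [map_mul, pr_inlO, pr_inrA, map_sub, map_smul, map_one, sub_mul, smul_mul_assoc, one_mul,
      smul_mul_assoc, one_mul, map_smul]

/-- The inclusion of `k[G]` in `D(G)`, as a map of bialgebras. -/
def inrBialg : GroupAlg k O →ₐc[k] Double k O :=
  BialgHom.ofAlgHom inrA (AlgHom.ext fun u => counit_inrA u) (AlgHom.ext fun u => (comul_inrA u).symm)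

section HopfIdeal

variable (J : Ideal (Double k O)) [J.IsTwoSided] [J.IsHopfIdeal k]

/-- The projection `D(G) → D(G) / J`. -/
def mkJ : Double k O →ₐc[k] Double k O ⧸ J := Bialgebra.Quotient.mkBialgHom J

lemma mkJ_surjective : Function.Surjective (mkJ J) := Ideal.Quotient.mk_surjective

lemma mkJ_eq_zero_iff {d : Double k O} : mkJ J d = 0 ↔ d ∈ J := Ideal.Quotient.eq_zero_iff_mem

/-- The map `O(G) → D(G) / J`. -/
def quotO : O →ₐ[k] Double k O ⧸ J := (mkJ J : Double k O →ₐ[k] Double k O ⧸ J).comp inlO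

lemma quotO_apply (b : O) : quotO J b = mkJ J (inlO b) := rfl

/-- The map `k[G] → D(G) / J`. -/
def quotA : GroupAlg k O →ₐc[k] Double k O ⧸ J := (mkJ J).comp inrBialg

lemma comul_quotO (b : O) : comul (R := k) (quotO J b) = TensorProduct.comm k _ _
    (TensorProduct.map (quotO J).toLinearMap (quotO J).toLinearMap (comul (R := k) b)) := by
  rw [quotO_apply, ← CoalgHomClass.map_comp_comul_apply, comul_inlO, comulO_apply (ℛ k b),
    ← (ℛ k b).eq]
  simp only [map_sum]
  rfl

lemma counit_quotO (b : O) : counit (R := k) (quotO J b) = counit (R := k) b := by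
  rw [quotO_apply, CoalgHomClass.counit_comp_apply, counit_inlO]

lemma quotO_coadj {ι : Type*} {u : GroupAlg k O} (r : Coalgebra.Repr k u ι) (b : O) :
    quotO J (coadj k O u b) = ∑ i ∈ r.index,
      quotA J (r.left i) * quotO J b * quotA J (HopfAlgebra.antipode k (r.right i)) := by
  rw [quotO_apply, inlO_coadj r, map_sum]
  simp only [map_mul]
  rfl

/-- The kernel of `O(G) → D(G) / J`, as a normal subgroup scheme. -/
def kerNormal : NormalSubgroup k O where
  ideal := J.comap inlO
  isHopfIdeal :=
    { toIsCoideal := by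
        have hker : LinearMap.ker (quotO J).toLinearMap = (J.comap inlO).restrictScalars k :=
          Submodule.ext fun b => mkJ_eq_zero_iff J
        refine isCoideal_of_ker_eq (quotO J).toLinearMap hker (fun b hb => ?_) (fun b hb => ?_)
        · rw [← counit_quotO J, show quotO J b = 0 from (mkJ_eq_zero_iff J).mpr hb, map_zero]
        · refine (TensorProduct.comm k _ _).injective ?_
          rw [← comul_quotO, show quotO J b = 0 from (mkJ_eq_zero_iff J).mpr hb, map_zero, map_zero]
      antipode_mem := fun {b} hb => by
        rw [Ideal.mem_comap, ← antipode_inlO]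
        exact Ideal.IsHopfIdeal.antipode_mem hb }
  normal := ClosedSubgroup.isNormal_of_coadj_mem _ fun u b hb => by
    refine (mkJ_eq_zero_iff J).mp ((quotO_coadj J (ℛ k u) b).trans ?_)
    rw [show quotO J b = 0 from (mkJ_eq_zero_iff J).mpr hb]
    simp

/-- The embedding of `O(K)` in `D(G) / J`, where `K` is the subgroup scheme `kerNormal J`. -/
def coordEmb : (kerNormal J).coord →ₐ[k] Double k O ⧸ J :=
  Ideal.Quotient.liftₐ (kerNormal J).ideal (quotO J) fun _ hb => (mkJ_eq_zero_iff J).mpr hb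

lemma coordEmb_q (b : O) : coordEmb J ((kerNormal J).q b) = quotO J b := rfl

lemma coordEmb_injective : Function.Injective (coordEmb J) := by
  refine (injective_iff_map_eq_zero _).mpr fun a ha => ?_
  obtain ⟨b, rfl⟩ := (kerNormal J).q_surjective a
  exact ((kerNormal J).q_eq_zero_iff).mpr ((mkJ_eq_zero_iff J).mp ha)

lemma counit_coordEmb (a : (kerNormal J).coord) :
    counit (R := k) (coordEmb J a) = counit (R := k) a := by
  obtain ⟨b, rfl⟩ := (kerNormal J).q_surjective a
  rw [coordEmb_q, counit_quotO, ClosedSubgroup.counit_q]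

lemma comul_coordEmb (a : (kerNormal J).coord) : comul (R := k) (coordEmb J a) =
    TensorProduct.comm k _ _ (TensorProduct.map (coordEmb J).toLinearMap (coordEmb J).toLinearMap
      (comul (R := k) a)) := by
  obtain ⟨b, rfl⟩ := (kerNormal J).q_surjective a
  rw [coordEmb_q, comul_quotO, ClosedSubgroup.comul_q]
  rw [TensorProduct.map_map]
  rfl

variable {J} {M : NormalSubgroup k O} (hM : M.augIdeal = J.map pr)

/-- The projection `D(G) / J → k[G/M]`, where the image of `J` in `k[G]` is the ideal of `M`. -/
def quotProj : Double k O ⧸ J →ₐc[k] M.quotAlg :=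
  let f : Double k O →ₐc[k] M.quotAlg := M.proj.comp pr
  BialgHom.ofAlgHom
    (Ideal.Quotient.liftₐ J (f : Double k O →ₐ[k] M.quotAlg) fun d hd =>
      M.proj_eq_zero_iff.mpr (hM.symm ▸ Ideal.mem_map_of_mem pr hd))
    (AlgHom.ext fun x => by
      obtain ⟨d, rfl⟩ := mkJ_surjective J x
      change counit (R := k) (f d) = counit (R := k) (mkJ J d)
      simp only [CoalgHomClass.counit_comp_apply])
    (AlgHom.ext fun x => by
      obtain ⟨d, rfl⟩ := mkJ_surjective J x
      change _ = comul (R := k) (f d)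
      rw [← CoalgHomClass.map_comp_comul_apply, AlgHom.comp_apply, Bialgebra.comulAlgHom_apply,
        ← CoalgHomClass.map_comp_comul_apply]
      exact TensorProduct.map_map _ _ _ _ _)

lemma quotProj_mkJ (d : Double k O) : quotProj hM (mkJ J d) = M.proj (pr d) := rfl

lemma coactAlong_quotA (u : GroupAlg k O) : coactAlong (quotProj hM) (quotA J u) =
    (quotA J : GroupAlg k O →ₗ[k] Double k O ⧸ J).rTensor M.quotAlg (M.projCoact u) := by
  have h : (quotProj hM).comp (quotA J) = M.proj :=
    BialgHom.ext fun u => congrArg M.proj (pr_inrA u)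
  rw [coactAlong_map, h]
  rfl

/-- The coproduct of `b` is `b₂ ⊗ b₁`, and the projection acts on the second leg by the counit. -/
lemma quotO_mem_coinvariants (b : O) : quotO J b ∈ coinvariants (quotProj hM) := by
  rw [mem_coinvariants, coactAlong_apply, comul_quotO, ← (ℛ k b).eq]
  have h (c : O) : quotProj hM (quotO J c) = counit (R := k) c • 1 := by
    rw [quotO_apply, quotProj_mkJ, pr_inlO, map_smul, map_one]
  simp only [map_sum, TensorProduct.map_tmul, TensorProduct.comm_tmul, LinearMap.lTensor_tmul]
  have h1 := congrArg (fun c => quotO J c ⊗ₜ[k] (1 : M.quotAlg)) (Coalgebra.sum_counit_smul (ℛ k b))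
  simp only [map_sum, map_smul, TensorProduct.sum_tmul] at h1
  rw [← h1]
  refine Finset.sum_congr rfl fun i _ => ?_
  change quotO J _ ⊗ₜ[k] quotProj hM (quotO J _) = _
  rw [h, TensorProduct.tmul_smul, TensorProduct.smul_tmul']

lemma quotA_incl_mem_coinvariants (v : M.groupAlg) :
    quotA J (M.incl v) ∈ coinvariants (quotProj hM) := by
  rw [mem_coinvariants, coactAlong_quotA, M.projCoact_incl]
  rfl

variable (s : Cleaving M)

/-- The section `k[G/M] → D(G) / J` given by a section `k[G/M] → k[G]`. -/
def quotSection (J : Ideal (Double k O)) [J.IsTwoSided] [J.IsHopfIdeal k] :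
    M.quotAlg →ₗ[k] Double k O ⧸ J := (quotA J : GroupAlg k O →ₗ[k] _) ∘ₗ s.γ

/-- The convolution inverse of `quotSection`. -/
def quotSectionInv (J : Ideal (Double k O)) [J.IsTwoSided] [J.IsHopfIdeal k] :
    M.quotAlg →ₗ[k] Double k O ⧸ J := (quotA J : GroupAlg k O →ₗ[k] _) ∘ₗ s.γinv

lemma quotSection_mul_inv :
    toConv (quotSection s J) * toConv (quotSectionInv s J) = 1 := by
  have h := congrArg (convPostcomp M.quotAlg (quotA J : GroupAlg k O →ₐ[k] Double k O ⧸ J)) s.γ_mul_γinv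
  rw [map_mul, map_one] at h
  exact h

lemma quotSectionInv_mul :
    toConv (quotSectionInv s J) * toConv (quotSection s J) = 1 := by
  have h := congrArg (convPostcomp M.quotAlg (quotA J : GroupAlg k O →ₐ[k] Double k O ⧸ J)) s.γinv_mul_γ
  rw [map_mul, map_one] at h
  exact h

lemma coactAlong_quotSection (x : M.quotAlg) : coactAlong (quotProj hM) (quotSection s J x) =
    (quotSection s J).rTensor M.quotAlg (comul (R := k) x) := by
  rw [quotSection, LinearMap.comp_apply]
  refine (coactAlong_quotA hM _).trans ?_
  rw [s.projCoact_γ, ← LinearMap.comp_apply, ← LinearMap.rTensor_comp]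

/-- This normalization, inherited from `γ(1) = 1`, makes the retraction fix the coinvariants. -/
lemma quotSectionInv_one : quotSectionInv s J 1 = 1 := by
  have h := congr($(quotSection_mul_inv (J := J) s) 1)
  have h1 : quotSection s J 1 = 1 := by
    rw [quotSection, LinearMap.comp_apply, s.γ_one]
    exact map_one (quotA J)
  have h2 : (toConv (quotSection s J) * toConv (quotSectionInv s J)) 1 =
    LinearMap.mul' k _ (TensorProduct.map (quotSection s J) (quotSectionInv s J)
      (comul (R := k) 1)) := rfl
  rw [h2, Bialgebra.comul_one, Algebra.TensorProduct.one_def, TensorProduct.map_tmul, h1,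
    LinearMap.mul'_apply, one_mul] at h
  rw [h, LinearMap.convOne_apply, Bialgebra.counit_one, map_one (algebraMap k _)]

end HopfIdeal

end Double

/-! ### The coinvariants of `D(G)/J` and the triple they produce -/

namespace Double

variable {k O : Type u} [Field k] [CommRing O] [HopfAlgebra k O] [Module.Finite k O]
  {J : Ideal (Double k O)} [J.IsTwoSided] [J.IsHopfIdeal k]
  {M : NormalSubgroup k O} (hM : M.augIdeal = J.map pr)

lemma cleftRetraction_mem_coinvariants (s : Cleaving M) (x : Double k O ⧸ J) :
    cleftRetraction (quotProj hM) (quotSectionInv s J) x ∈ coinvariants (quotProj hM) :=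
  coactAlong_cleftRetraction (quotProj hM) (quotSection_mul_inv s) (quotSectionInv_mul s)
    (coactAlong_quotSection hM s) x

lemma exists_pr_eq_of_mem_map {x : GroupAlg k O} (hx : x ∈ J.map pr) : ∃ j ∈ J, pr j = x := by
  have h := (mem_map_ideal_iff pr pr_surjective J (b := x)).mp
  exact h hx

/-- A coinvariant projects to a scalar of `k[G/M]`. So for any lift the image in `k[G]` is that
scalar up to the ideal of `M`, which is the image of `J`; the lift is corrected by an element of
`J`. -/
lemma exists_mkJ_eq_of_mem_coinvariants {c : Double k O ⧸ J} (hc : c ∈ coinvariants (quotProj hM)) :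
    ∃ d : Double k O, mkJ J d = c ∧ pr d = counit (R := k) c • 1 := by
  obtain ⟨d, rfl⟩ := mkJ_surjective J c
  have h1 : pr d - counit (R := k) (mkJ J d) • 1 ∈ M.augIdeal := by
    have h2 := apply_of_mem_coinvariants (quotProj hM) hc
    rw [quotProj_mkJ] at h2
    rw [← M.proj_eq_zero_iff, map_sub M.proj, map_smul M.proj, map_one M.proj, sub_eq_zero]
    exact h2
  obtain ⟨j, hj, hpr⟩ := exists_pr_eq_of_mem_map (hM.le h1)
  refine ⟨d - j, ?_, ?_⟩
  · rw [map_sub (mkJ J), (mkJ_eq_zero_iff J).mpr hj, sub_zero]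
  · rw [map_sub pr, hpr, sub_sub_cancel]

/-- The coinvariants are generated by the image of `O(G)` modulo its augmentation ideal. -/
lemma coinvariants_le_sup (s : Cleaving M) :
    Subalgebra.toSubmodule (coinvariants (quotProj hM)) ≤
      Subalgebra.toSubmodule (quotO J).range ⊔ Submodule.span k
        {y | ∃ a ∈ (quotO J).range, counit (R := k) a = 0 ∧
          ∃ c ∈ Subalgebra.toSubmodule (coinvariants (quotProj hM)), a * c = y} := by
  intro c hc
  obtain ⟨d, hd, hpr⟩ := exists_mkJ_eq_of_mem_coinvariants hM hc
  let E := cleftRetraction (quotProj hM) (quotSectionInv s J)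
  let F : Double k O →ₗ[k] Double k O ⧸ J := E ∘ₗ (mkJ J : Double k O →ₗ[k] Double k O ⧸ J)
  -- The retraction fixes `c`. The first summand is a scalar by the choice of `d`; the second lies
  -- in `O(G)⁺ D(G)`, and the retraction, linear over the image of `O(G)`, sends it to `O(G)⁺` times
  -- coinvariants.
  have h1 : d = inrA (pr d) + (d - inrA (pr d)) := by abel
  have h2 : c = F (inrA (pr d)) + F (d - inrA (pr d)) := by
    rw [← map_add, ← h1]
    refine Eq.trans ?_ (congrArg E hd.symm)
    exact (cleftRetraction_of_mem_coinvariants _ (quotSectionInv_one s) hc).symm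
  have hE1 : E 1 = 1 := cleftRetraction_of_mem_coinvariants _ (quotSectionInv_one s) (one_mem _)
  rw [h2]
  refine Submodule.add_mem_sup ?_ ?_
  · rw [hpr, map_smul, map_smul, map_one]
    refine Submodule.smul_mem _ _ ?_
    change E (mkJ J 1) ∈ _
    rw [map_one, hE1]
    exact one_mem (quotO J).range
  · refine Submodule.mem_comap.mp
      ((Submodule.span_le (p := Submodule.comap F _)).mpr ?_ (sub_inrA_pr_mem d))
    rintro _ ⟨a, ha, e, rfl⟩
    refine Submodule.subset_span ⟨quotO J a, ⟨a, rfl⟩, (counit_quotO J a).trans ha, E (mkJ J e),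
      cleftRetraction_mem_coinvariants hM s _, ?_⟩
    change _ = E (mkJ J (inlO a * e))
    rw [map_mul]
    exact (cleftRetraction_mul _ _ (quotO_mem_coinvariants hM a) _).symm

lemma range_quotO_le : (quotO J).range ≤ coinvariants (quotProj hM) := by
  rintro _ ⟨b, rfl⟩
  exact quotO_mem_coinvariants hM b

/-- The criterion `le_of_le_sup_augmentation_mul` for the commutative image of `O(G)` inside the
coinvariants. -/
theorem coinvariants_le_range_quotO [IsAlgClosed k] :
    coinvariants (quotProj hM) ≤ (quotO J).range := by
  obtain ⟨s⟩ := M.nonempty_cleaving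
  refine le_of_le_sup_augmentation_mul (quotO J).range ?_ ?_
    (Subalgebra.toSubmodule (coinvariants (quotProj hM))) ?_ (range_quotO_le hM)
    (fun c hc => comul_mem_of_mem_coinvariants _ hc) (coinvariants_le_sup hM s)
  · rintro _ ⟨a, rfl⟩ _ ⟨b, rfl⟩
    rw [AlgHom.toRingHom_eq_coe, RingHom.coe_coe, ← map_mul, ← map_mul, mul_comm]
  · rintro _ ⟨b, rfl⟩
    change comul (R := k) (quotO J b) ∈ _
    rw [comul_quotO, ← (ℛ k b).eq]
    simp only [map_sum]
    exact Submodule.sum_mem _ fun i _ => ⟨quotO J _ ⊗ₜ ⟨quotO J _, ⟨_, rfl⟩⟩, rfl⟩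
  · exact fun a ha c hc => (coinvariants (quotProj hM)).mul_mem (range_quotO_le hM ha) hc

variable [IsAlgClosed k]

/-- The inclusion of `O(K)` in `D(G) / J` as an isomorphism onto its image. -/
def coordEquiv (J : Ideal (Double k O)) [J.IsTwoSided] [J.IsHopfIdeal k] :
    (kerNormal J).coord ≃ₐ[k] (coordEmb J).range :=
  AlgEquiv.ofInjective (coordEmb J) (coordEmb_injective J)

lemma quotA_incl_mem_range (hM : M.augIdeal = J.map pr) (v : M.groupAlg) : quotA J (M.incl v) ∈ (coordEmb J).range := by
  obtain ⟨b, hb⟩ := coinvariants_le_range_quotO hM (quotA_incl_mem_coinvariants hM v)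
  exact ⟨(kerNormal J).q b, hb⟩

/-- The map `k[M] → O(K)` given by the inclusions of both algebras in `D(G) / J`. -/
def quotB : M.groupAlg →ₐ[k] (kerNormal J).coord :=
  (coordEquiv J).symm.toAlgHom.comp
    (((quotA J : GroupAlg k O →ₐ[k] Double k O ⧸ J).comp M.inclHom).codRestrict (coordEmb J).range
      (quotA_incl_mem_range hM))

lemma coordEmb_quotB (v : M.groupAlg) : coordEmb J (quotB hM v) = quotA J (M.incl v) :=
  congrArg Subtype.val ((coordEquiv J).apply_symm_apply ⟨_, quotA_incl_mem_range hM v⟩)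

/-- `quotB` as a map of bialgebras. -/
def quotBBialg : M.groupAlg →ₐc[k] (kerNormal J).coord :=
  BialgHom.ofAlgHom (quotB hM)
    (AlgHom.ext fun v => by
      change counit (R := k) (quotB hM v) = counit (R := k) v
      rw [← counit_coordEmb, coordEmb_quotB, CoalgHomClass.counit_comp_apply, M.counit_incl])
    (AlgHom.ext fun v => by
      -- The identity is checked after embedding `O(K)` in `D(G)/J`, which reverses its coproduct;
      -- the flip is absorbed by the cocommutativity of `k[M]`.
      refine TensorProduct.map_injective_of_flat_flat (coordEmb J).toLinearMap
        (coordEmb J).toLinearMap (coordEmb_injective J) (coordEmb_injective J) ?_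
      refine (TensorProduct.comm k _ _).injective ?_
      change _ = TensorProduct.comm k _ _ (TensorProduct.map _ _ (comul (R := k) (quotB hM v)))
      rw [← comul_coordEmb, coordEmb_quotB, ← CoalgHomClass.map_comp_comul_apply, M.comul_incl,
        TensorProduct.map_map, ← comm_comul k v, ← comm_map, AlgHom.comp_apply,
        Bialgebra.comulAlgHom_apply]
      refine congrArg (TensorProduct.comm k _ _) ((TensorProduct.map_map _ _ _ _ _).trans ?_)
      have h : (coordEmb J).toLinearMap ∘ₗ (quotB hM).toLinearMap =
          (quotA J : GroupAlg k O →ₗ[k] Double k O ⧸ J) ∘ₗ M.incl :=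
        LinearMap.ext (coordEmb_quotB hM)
      exact congr(TensorProduct.map $h $h (comul (R := k) v)))

lemma coordEmb_quotBBialg (v : M.groupAlg) :
    coordEmb J (quotBBialg hM v) = quotA J (M.incl v) := coordEmb_quotB hM v

/-- Inside `D(G)/J` the coadjoint action on `O(K)` and the adjoint action on `k[M]` are both `u₁ ·
S(u₂)`. -/
lemma quotBBialg_equivariant (u : GroupAlg k O) (v w : M.groupAlg)
    (h : M.incl w = adL k (GroupAlg k O) u (M.incl v)) :
    (kerNormal J).act u (quotBBialg hM v) = quotBBialg hM w := by
  obtain ⟨b, hb⟩ := (kerNormal J).q_surjective (quotBBialg hM v)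
  apply coordEmb_injective J
  rw [coordEmb_quotBBialg, h, ← hb, NormalSubgroup.act_q, coordEmb_q, quotO_coadj J (ℛ k u),
    ← coordEmb_q, hb, coordEmb_quotBBialg, adL_apply (ℛ k u), map_sum]
  simp only [map_mul]

/-- The image of `k[M]` lies in the commutative algebra `O(K)`, so conjugation by it is trivial on
the image of `O(G)`. This is the source of the centralizing condition. -/
lemma quotO_coadj_incl (hM : M.augIdeal = J.map pr) (v : M.groupAlg) (b : O) :
    quotO J (coadj k O (M.incl v) b) = counit (R := k) v • quotO J b := by
  have hcomm (v : M.groupAlg) : quotA J (M.incl v) * quotO J b = quotO J b * quotA J (M.incl v) := by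
    rw [← coordEmb_quotBBialg hM, ← coordEmb_q, ← map_mul, mul_comm, map_mul]
  have h := congrArg (quotA J) (HopfAlgebra.sum_mul_antipode_eq_smul (M.reprIncl (ℛ k v)))
  rw [map_sum, map_smul, map_one, M.counit_incl] at h
  rw [quotO_coadj J (M.reprIncl (ℛ k v))]
  calc _ = ∑ i ∈ (ℛ k v).index, quotO J b * (quotA J (M.incl ((ℛ k v).left i) *
        HopfAlgebra.antipode k (M.incl ((ℛ k v).right i)))) :=
        Finset.sum_congr rfl fun i _ => by
          rw [map_mul, ← mul_assoc, ← hcomm]; rfl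
    _ = quotO J b * (counit (R := k) v • 1) := by rw [← Finset.mul_sum, ← h]; rfl
    _ = _ := by rw [mul_smul_comm, mul_one]

/-- Trivial action of `k[M]` on `O(K)` dualizes to `ad(v)(w) = ε(v) w`, and then `v w = ad(v₁)(w) v₂
= w v`. -/
lemma incl_mul_incl_comm (hM : M.augIdeal = J.map pr) (v : M.groupAlg)
    (w : (kerNormal J).groupAlg) :
    M.incl v * (kerNormal J).incl w = (kerNormal J).incl w * M.incl v := by
  have h (v : M.groupAlg) : adL k (GroupAlg k O) (M.incl v) ((kerNormal J).incl w) =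
      counit (R := k) v • (kerNormal J).incl w := by
    refine GroupAlg.ext fun b => ?_
    have h1 : (kerNormal J).q (coadj k O (M.incl (HopfAlgebra.antipode k v)) b) =
        counit (R := k) v • (kerNormal J).q b := by
      apply coordEmb_injective J
      rw [map_smul, coordEmb_q, coordEmb_q, quotO_coadj_incl hM, HopfAlgebra.counit_antipode]
    rw [pair_adL, M.antipode_incl, ClosedSubgroup.incl_apply, h1, map_smul, map_smul,
      LinearMap.smul_apply, ClosedSubgroup.incl_apply]
  rw [mul_eq_sum_adL_mul (M.reprIncl (ℛ k v))]
  calc _ = ∑ i ∈ (ℛ k v).index, (kerNormal J).incl w *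
        M.incl (counit (R := k) ((ℛ k v).left i) • (ℛ k v).right i) :=
        Finset.sum_congr rfl fun i _ => by
          refine (congrArg (· * _) (h _)).trans ?_
          rw [map_smul, smul_mul_assoc, mul_smul_comm]; rfl
    _ = _ := by rw [← Finset.mul_sum, ← map_sum, Coalgebra.sum_counit_smul]

/-- The triple of a Hopf ideal of `D(G)`. -/
def toTriple : Triple k O where
  K := kerNormal J
  H := M
  centralize v w := incl_mul_incl_comm hM v w
  B := quotBBialg hM
  equivariant := quotBBialg_equivariant hM

end Double

/-! ### Every Hopf ideal of the double is the kernel of some `θ` -/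

namespace Double

variable {k O : Type u} [Field k] [CommRing O] [HopfAlgebra k O] [Module.Finite k O]
  [IsAlgClosed k] {J : Ideal (Double k O)} [J.IsTwoSided] [J.IsHopfIdeal k]
  {t : Triple k O} (hM : t.H.augIdeal = J.map pr) (s : Cleaving t.H)
  {f : t.K.coord →ₐ[k] Double k O ⧸ J}

lemma mkJ_inlO_mul_inrA (b : O) (v : t.H.groupAlg) (x : t.H.quotAlg) :
    mkJ J (inlO b * inrA (t.H.incl v * s.γ x)) =
      quotO J b * quotA J (t.H.incl v) * quotSection s J x := by
  rw [map_mul, map_mul inrA, map_mul (mkJ J), mul_assoc]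
  rfl

lemma cleftRetraction_mul_quotSection (b : O) (v : t.H.groupAlg) (x : t.H.quotAlg) :
    cleftRetraction (quotProj hM) (quotSectionInv s J)
      (quotO J b * quotA J (t.H.incl v) * quotSection s J x) =
      counit (R := k) x • (quotO J b * quotA J (t.H.incl v)) := by
  have h := (coinvariants (quotProj hM)).mul_mem (quotO_mem_coinvariants hM b)
    (quotA_incl_mem_coinvariants hM v)
  rw [cleftRetraction_mul (quotProj hM) (quotSectionInv s J) ((mem_coinvariants _).mp h),
    cleftRetraction_apply (quotProj hM) (quotSection_mul_inv s) (coactAlong_quotSection hM s),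
    mul_smul_comm, mul_one]

/-- The projection to `D(G)/J` factors through `θ`, which gives `ker θ ⊆ J`. -/
lemma mul_map_θ (hq : ∀ b, f (t.K.q b) = quotO J b)
    (hB : ∀ v, f (t.B v) = quotA J (t.H.incl v)) (d : Double k O) :
    LinearMap.mul' k _ (TensorProduct.map f.toLinearMap (quotSection s J) (t.θ s d)) = mkJ J d := by
  induction d using t.double_induction s with
  | h0 => simp
  | hadd x y hx hy => simp only [map_add, hx, hy]
  | h b v x =>
    rw [Triple.θ_apply, mkJ_inlO_mul_inrA, ← hB, ← hq, ← map_mul]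
    rfl

/-- Conversely `θ`, followed by the embedding of `O(K)`, depends only on the class modulo `J`: it is
the retraction applied to the first leg of the coaction. For injective `f` this gives `J ⊆ ker θ`.
-/
lemma rTensor_θ (hq : ∀ b, f (t.K.q b) = quotO J b)
    (hB : ∀ v, f (t.B v) = quotA J (t.H.incl v)) (d : Double k O) :
    f.toLinearMap.rTensor t.H.quotAlg (t.θ s d) =
    (cleftRetraction (quotProj hM) (quotSectionInv s J)).rTensor t.H.quotAlg
      (coactAlong (quotProj hM) (mkJ J d)) := by
  induction d using t.double_induction s with
  | h0 => simp
  | hadd x y hx hy => simp only [map_add, hx, hy]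
  | h b v x =>
    have h2 := (coinvariants (quotProj hM)).mul_mem (quotO_mem_coinvariants hM b)
      (quotA_incl_mem_coinvariants hM v)
    rw [Triple.θ_apply, mkJ_inlO_mul_inrA,
      map_mul (coactAlong _), (mem_coinvariants _).mp h2, coactAlong_quotSection, ← (ℛ k x).eq]
    simp only [map_sum, Finset.mul_sum, LinearMap.rTensor_tmul,
      Algebra.TensorProduct.tmul_mul_tmul, one_mul]
    simp only [cleftRetraction_mul_quotSection, TensorProduct.smul_tmul, ← TensorProduct.tmul_sum,
      Coalgebra.sum_counit_smul]
    exact congrArg (fun y => y ⊗ₜ[k] x)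
      ((map_mul f (t.K.q b) (t.B v)).trans (congrArg₂ (· * ·) (hq b) (hB v)))

lemma kerIdeal_eq (hq : ∀ b, f (t.K.q b) = quotO J b)
    (hB : ∀ v, f (t.B v) = quotA J (t.H.incl v))
    (hM : t.H.augIdeal = J.map pr) (hf : Function.Injective f) :
    t.kerIdeal s = J := by
  refine Ideal.ext fun d => ?_
  rw [Triple.mem_kerIdeal, ← mkJ_eq_zero_iff]
  constructor
  · intro h
    rw [← mul_map_θ s hq hB, h, map_zero, map_zero]
  · intro h
    refine Module.Flat.rTensor_preserves_injective_linearMap (M := t.H.quotAlg) f.toLinearMap hf ?_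
    rw [rTensor_θ hM s hq hB, h, map_zero, map_zero, map_zero]

/-- Every Hopf ideal of `D(G)` is the kernel of `θ` for some triple. -/
theorem exists_triple (J : Ideal (Double k O)) [J.IsTwoSided] [J.IsHopfIdeal k] :
    ∃ t : Triple k O, ∀ s : Cleaving t.H, t.kerIdeal s = J := by
  have := map_isTwoSided pr pr_surjective J
  have := map_isHopfIdeal pr pr_surjective J
  obtain ⟨M, hM⟩ := NormalSubgroup.exists_augIdeal_eq (J.map pr)
  exact ⟨toTriple hM, fun s => kerIdeal_eq (t := toTriple hM) (f := coordEmb J) s (coordEmb_q J)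
    (coordEmb_quotBBialg hM) hM (coordEmb_injective J)⟩

end Double

end

end FiniteGroupScheme

theorem theorem4p2 {k : Type u} [Field k] [IsAlgClosed k]
    (O : Type u) [CommRing O] [HopfAlgebra k O] [Module.Finite k O] :
    (∀ H : FiniteGroupScheme.NormalSubgroup k O, Nonempty (FiniteGroupScheme.Cleaving H)) ∧
    ∀ s : ∀ t : FiniteGroupScheme.Triple k O, FiniteGroupScheme.Cleaving t.H,
      (∀ t : FiniteGroupScheme.Triple k O, t.IsHopfQuotient (s t)) ∧
      ∃ Z : FiniteGroupScheme.Triple k O →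
          FiniteGroupScheme.TensorSubcategory k (FiniteGroupScheme.Double k O),
        (∀ t : FiniteGroupScheme.Triple k O, (Z t).obj = t.zObj (s t)) ∧
          Function.Bijective Z := by
  refine ⟨fun H => H.nonempty_cleaving, fun s => ⟨fun t => t.isHopfQuotient (s t), ?_⟩⟩
  -- The representations that factor through `θ` are those killed by the Hopf ideal `ker θ`, so
  -- bijectivity is a statement about these ideals.
  let Z (t : FiniteGroupScheme.Triple k O) :=
    FiniteGroupScheme.TensorSubcategory.ofHopfIdeal FiniteGroupScheme.Double.antipode_antipode
      (t.kerIdeal (s t))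
  refine ⟨Z, fun t => Set.ext fun X => (t.mem_zObj (s t)).symm, fun t t' h => ?_, fun C => ?_⟩
  · have hobj (X : FiniteGroupScheme.FDRep k (FiniteGroupScheme.Double k O)) :
        (∀ a ∈ t.kerIdeal (s t), X.ρ a = 0) ↔ ∀ a ∈ t'.kerIdeal (s t'), X.ρ a = 0 :=
      iff_of_eq (congrArg (fun C => X ∈ C.obj) h)
    exact FiniteGroupScheme.Triple.eq_of_kerIdeal_eq (s t) (s t') (le_antisymm
      (FiniteGroupScheme.TensorSubcategory.le_of_forall_mem fun X => (hobj X).mpr)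
      (FiniteGroupScheme.TensorSubcategory.le_of_forall_mem fun X => (hobj X).mp))
  · obtain ⟨J, hJ, hJ', hC⟩ := FiniteGroupScheme.TensorSubcategory.exists_hopfIdeal C
    obtain ⟨t, ht⟩ := FiniteGroupScheme.Double.exists_triple J
    refine ⟨t, FiniteGroupScheme.TensorSubcategory.ext (Set.ext fun X => ?_)⟩
    rw [hC, ← ht (s t)]
    rfl
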